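/- Let $-\infty<\omega_*<\omega^*<+\infty$, $T>0$, $G>0$, $K_p>0$. Write $e_3=(0,0,1)$ and let $H^1=H^1((\omega_*,\omega^*),\mathbb{R}^3)$ be the space of $f\in L^2((\omega_*,\omega^*),\mathbb{R}^3)$ whose distributional derivative $f'$ is in $L^2$, with norm $\|f\|_{H^1}=\big(\int_{\omega_*}^{\omega^*}|f'|^2+|f|^2\,d\omega\big)^{1/2}$; let $H^1((\omega_*,\omega^*),\mathbb{S}^2)$ be the set of those $f\in H^1$ with values in the unit sphere. For $M=(x,y,z)\in H^1$ put $Z=x+iy$, and let a prime denote $\partial/\partial\omega$. Let $\varsigma(t)=(-1)^{\lfloor t/T\rfloor}$ (the sign generated by a train of $\pi$-impulses at the times $kT$) and $S(t)=\int_0^t\varsigma(\tau)\,d\tau$. Consider the Bloch ensemble in driftless form $$\dot Z(t,\omega)=\Omega(t)\,z(t,\omega)\,e^{-i\omega S(t)},\qquad \dot z(t,\omega)=-\Re\big[\Omega(t)\,\overline{Z(t,\omega)}\,e^{-i\omega S(t)}\big],$$ in closed loop with the feedback $$\Omega(t)=K_p\int_{\omega_*}^{\omega^*}\Big\{iS(t)\big(Z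 z'-Z' z\big)+G Z\Big\}(t,\omega)\,e^{i\omega S(t)}\,d\omega .$$ A solution is a curve $M\in C^0([0,\infty),H^1)$ that is $C^1$ with values in $H^1$ on each interval $(kT,(k+1)T)$, $k\in\mathbb{N}$, whose time derivative has limits in $H^1$ at both ends of each of these intervals, and that satisfies the equations, as an identity in $H^1$, at each time of these intervals. Theorem. There exists $\delta'>0$ such that, for every $M_0\in H^1((\omega_*,\omega^*),\mathbb{S}^2)$ with $\|M_0+e_3\|_{H^1}\le\delta'$, the closed-loop system has a unique solution $M$ on $[0,\infty)$ with $M(0)=M_0$; this solution takes values in $H^1((\omega_*,\omega^*),\mathbb{S}^2)$, and $M(t)$ converges to $-e_3$ weakly in $H^1$ when $t\to+\infty$. In particular (through the continuous representatives) $M(t,\omega)\to-e_3$ when $t\to+\infty$, uniformly with respect to $\omega$. -/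

import Mathlib

open MeasureTheory Set Filter Topology

noncomputable section

namespace BlochEnsemble

/-- The space `ℝ³` of magnetization vectors `(x, y, z)`, with its Euclidean norm. -/
abbrev Vec : Type := EuclideanSpace ℝ (Fin 3)

/-- The third vector of the canonical basis of `ℝ³`. -/
def e3 : Vec := EuclideanSpace.single 2 1

/-- The complex transverse component `Z = x + i y`. -/
def transverse (m : Vec) : ℂ := (m 0 : ℂ) + Complex.I * (m 1 : ℂ)

/-- Lebesgue measure on the frequency interval `(a, b)`. -/
abbrev freqMeasure (a b : ℝ) : Measure ℝ := volume.restrict (Ioo a b)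

/-- `L²((a, b), ℝ³)`. -/
abbrev L2Space (a b : ℝ) : Type := Lp Vec 2 (freqMeasure a b)

/-- `φ` is a real-valued smooth function with compact support contained in `(a, b)`. -/
structure IsTestFunction (a b : ℝ) (φ : ℝ → ℝ) : Prop where
  smooth : ContDiff ℝ (⊤ : ℕ∞) φ
  compact : HasCompactSupport φ
  support : tsupport φ ⊆ Ioo a b

/-- `g` is the distributional derivative of `f` on `(a, b)`. -/
def IsWeakDeriv (a b : ℝ) (f g : ℝ → Vec) : Prop :=
  ∀ φ : ℝ → ℝ, IsTestFunction a b φ →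
    ∫ ω in Ioo a b, deriv φ ω • f ω = - ∫ ω in Ioo a b, φ ω • g ω

theorem IsTestFunction.deriv_compact {a b : ℝ} {φ : ℝ → ℝ} (h : IsTestFunction a b φ) :
    Continuous (deriv φ) ∧ HasCompactSupport (deriv φ) :=
  ⟨h.smooth.continuous_deriv (by simp), h.compact.deriv⟩

theorem integrable_smul_of_L2 {a b : ℝ} {ψ : ℝ → ℝ} (hc : Continuous ψ)
    (hs : HasCompactSupport ψ) (f : L2Space a b) :
    Integrable (fun ω => ψ ω • f ω) (freqMeasure a b) := by
  obtain ⟨C, hC⟩ := hs.exists_bound_of_continuous hc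
  have hf : Integrable f (freqMeasure a b) := (Lp.memLp f).integrable (by norm_num)
  exact hf.bdd_smul C hc.aestronglyMeasurable (Eventually.of_forall hC)

/-- The Sobolev space `H¹((a, b), ℝ³)`, as the space of pairs `(f, f')` in `L² × L²` in which
`f'` is the distributional derivative of `f` (and so is determined by `f`).  The norm that it
inherits from the Hilbert product `L² × L²` is `(∫ |f'|² + |f|²)^(1/2)`. -/
def H1 (a b : ℝ) : Submodule ℝ (WithLp 2 (L2Space a b × L2Space a b)) where
  carrier := {p | IsWeakDeriv a b p.fst p.snd}
  zero_mem' := by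
    intro φ _
    have h0 : ((0 : L2Space a b) : ℝ → Vec) =ᵐ[freqMeasure a b] 0 := Lp.coeFn_zero _ _ _
    have h1 : ∀ ψ : ℝ → ℝ, ∫ ω in Ioo a b, ψ ω • (0 : L2Space a b) ω = 0 := by
      intro ψ
      apply integral_eq_zero_of_ae
      filter_upwards [h0] with ω h
      simp only [h, Pi.zero_apply, smul_zero]
    simp only [WithLp.zero_fst, WithLp.zero_snd, h1, neg_zero]
  add_mem' := by
    intro p q hp hq φ hφ
    have key : ∀ (ψ : ℝ → ℝ), Continuous ψ → HasCompactSupport ψ → ∀ f g : L2Space a b,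
        ∫ ω in Ioo a b, ψ ω • (f + g : L2Space a b) ω
          = (∫ ω in Ioo a b, ψ ω • f ω) + ∫ ω in Ioo a b, ψ ω • g ω := by
      intro ψ hc hs f g
      rw [← integral_add (integrable_smul_of_L2 hc hs f) (integrable_smul_of_L2 hc hs g)]
      apply integral_congr_ae
      filter_upwards [Lp.coeFn_add f g] with ω h
      rw [h, Pi.add_apply, smul_add]
    rw [WithLp.add_fst, WithLp.add_snd,
      key _ hφ.deriv_compact.1 hφ.deriv_compact.2, key _ hφ.smooth.continuous hφ.compact,
      hp φ hφ, hq φ hφ, neg_add]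
  smul_mem' := by
    intro c p hp φ hφ
    have key : ∀ (ψ : ℝ → ℝ) (f : L2Space a b),
        ∫ ω in Ioo a b, ψ ω • (c • f : L2Space a b) ω = c • ∫ ω in Ioo a b, ψ ω • f ω := by
      intro ψ f
      rw [← integral_smul]
      apply integral_congr_ae
      filter_upwards [Lp.coeFn_smul c f] with ω h
      rw [h, Pi.smul_apply, smul_comm]
    rw [WithLp.smul_fst, WithLp.smul_snd, key, key, hp φ hφ, smul_neg]

/-- The profile `ω ↦ M(ω)` of an element of `H¹` (a representative, defined a.e.). -/
def profile {a b : ℝ} (M : H1 a b) : ℝ → Vec := (M : WithLp 2 (L2Space a b × L2Space a b)).fst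

/-- The distributional derivative `M' = ∂M/∂ω` of an element of `H¹`. -/
def profileDeriv {a b : ℝ} (M : H1 a b) : ℝ → Vec :=
  (M : WithLp 2 (L2Space a b × L2Space a b)).snd

theorem integral_deriv_test {a b : ℝ} {φ : ℝ → ℝ} (h : IsTestFunction a b φ) :
    ∫ ω in Ioo a b, deriv φ ω = 0 := by
  rcases le_or_gt b a with hab | hab
  · simp [Ioo_eq_empty_of_le hab]
  · have hz : ∀ x, x ∉ Ioo a b → φ x = 0 := fun x hx =>
      image_eq_zero_of_notMem_tsupport (fun hx' => hx (h.support hx'))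
    rw [← integral_Ioc_eq_integral_Ioo, ← intervalIntegral.integral_of_le hab.le,
      intervalIntegral.integral_deriv_eq_sub
        (fun x _ => (h.smooth.differentiable (by simp)).differentiableAt)
        (h.deriv_compact.1.intervalIntegrable _ _),
      hz b (by simp), hz a (by simp), sub_zero]

/-- The constant profile `M(ω) = c` as an element of `H¹`. -/
def constProfile (a b : ℝ) (c : Vec) : H1 a b :=
  ⟨WithLp.toLp 2 (Lp.const 2 (freqMeasure a b) c, 0), by
    intro φ hφ
    have h1 : ∫ ω in Ioo a b, deriv φ ω • (Lp.const 2 (freqMeasure a b) c) ω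
        = ∫ ω in Ioo a b, deriv φ ω • c := by
      apply integral_congr_ae
      filter_upwards [Lp.coeFn_const (p := 2) (μ := freqMeasure a b) (c := c)] with ω h
      rw [h, Function.const_apply]
    have h2 : ∫ ω in Ioo a b, φ ω • (0 : L2Space a b) ω = 0 := by
      apply integral_eq_zero_of_ae
      filter_upwards [Lp.coeFn_zero Vec 2 (freqMeasure a b)] with ω h
      simp only [h, Pi.zero_apply, smul_zero]
    change ∫ ω in Ioo a b, deriv φ ω • (Lp.const 2 (freqMeasure a b) c) ω
        = - ∫ ω in Ioo a b, φ ω • (0 : L2Space a b) ω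
    rw [h1, h2, integral_smul_const, integral_deriv_test hφ, zero_smul, neg_zero]⟩

/-- `M` belongs to `H¹((a, b), 𝕊²)`: its profile takes values in the unit sphere of `ℝ³`. -/
def IsSphereValued {a b : ℝ} (M : H1 a b) : Prop :=
  ∀ᵐ ω ∂freqMeasure a b, profile M ω ∈ Metric.sphere (0 : Vec) 1

/-- The sign `ς(t) = (-1)^⌊t/T⌋` produced by the train of `π`-impulses at the times `k T`. -/
def switchSign (T t : ℝ) : ℝ := (-1) ^ ⌊t / T⌋

/-- The primitive `∫₀ᵗ ς`. -/
def switchPrim (T t : ℝ) : ℝ := ∫ τ in (0 : ℝ)..t, switchSign T τ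

/-- The feedback law
`Ω(t) = K ∫_a^b { i (∫₀ᵗ ς) (Z z' - Z' z) + G Z } e^{i ω ∫₀ᵗ ς} dω`,
evaluated at time `t` on the state `M = (Z, z)`. -/
def feedback {a b : ℝ} (T G K t : ℝ) (M : H1 a b) : ℂ :=
  (K : ℂ) * ∫ ω in Ioo a b,
    (Complex.I * (switchPrim T t : ℂ)
        * (transverse (profile M ω) * (profileDeriv M ω 2 : ℂ)
            - transverse (profileDeriv M ω) * (profile M ω 2 : ℂ))
      + (G : ℂ) * transverse (profile M ω))
    * Complex.exp (Complex.I * (ω : ℂ) * (switchPrim T t : ℂ))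

/-- The right-hand side of the driftless form at frequency `ω`, with control value `Ω` and
`s = ∫₀ᵗ ς`: the vector `(x, y, z)` with `x + i y = Ω z e^{-i ω s}` and
`z = - Re (Ω conj(Z) e^{-i ω s})`, at the point `m = (Z, z)`. -/
def driftlessField (Ω : ℂ) (s ω : ℝ) (m : Vec) : Vec :=
  !₂[(Ω * (m 2 : ℂ) * Complex.exp (-Complex.I * (ω : ℂ) * (s : ℂ))).re,
     (Ω * (m 2 : ℂ) * Complex.exp (-Complex.I * (ω : ℂ) * (s : ℂ))).im,
     -(Ω * (starRingEnd ℂ) (transverse m)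
        * Complex.exp (-Complex.I * (ω : ℂ) * (s : ℂ))).re]

/-- `M` is a curve of class `C¹_pw([0, ∞), H¹)`: it is continuous on `[0, ∞)`, of class `C¹` on
each interval `(kT, (k+1)T)`, and its time derivative has limits in `H¹` at both ends of each of
these intervals. -/
structure IsPiecewiseC1 {a b : ℝ} (T : ℝ) (M : ℝ → H1 a b) : Prop where
  continuousOn : ContinuousOn M (Ici 0)
  differentiableOn : ∀ k : ℕ, ∀ t ∈ Ioo (k * T) ((k + 1) * T), DifferentiableAt ℝ M t
  continuousOn_deriv : ∀ k : ℕ, ContinuousOn (deriv M) (Ioo (k * T) ((k + 1) * T))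
  limit_right : ∀ k : ℕ, ∃ D : H1 a b, Tendsto (deriv M) (𝓝[>] (k * T)) (𝓝 D)
  limit_left : ∀ k : ℕ, ∃ D : H1 a b, Tendsto (deriv M) (𝓝[<] ((k + 1) * T)) (𝓝 D)

/-- `M` is a solution on `[0, ∞)` of the driftless Bloch ensemble in closed loop with the
feedback law: a `C¹_pw` curve in `H¹` whose time derivative (taken in `H¹`) is the closed-loop
vector field at each time other than the switching times `k T`. -/
structure IsClosedLoopSolution {a b : ℝ} (T G K : ℝ) (M : ℝ → H1 a b) : Prop where
  regular : IsPiecewiseC1 T M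
  equation : ∀ k : ℕ, ∀ t ∈ Ioo (k * T) ((k + 1) * T),
    profile (deriv M t) =ᵐ[freqMeasure a b]
      fun ω => driftlessField (feedback T G K t (M t)) (switchPrim T t) ω (profile (M t) ω)

/-- `M(t) ⇀ N` weakly in `H¹` when `t → +∞`. -/
def TendstoWeakly {a b : ℝ} (M : ℝ → H1 a b) (N : H1 a b) : Prop :=
  Tendsto (fun t => toWeakSpace ℝ (H1 a b) (M t)) atTop (𝓝 (toWeakSpace ℝ (H1 a b) N))

/-- `M(t)` converges to the constant `c` in `C⁰([a, b])` when `t → +∞`: for `t ≥ 0` the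
continuous representatives of the profiles converge to `c` uniformly in `ω`. -/
def TendstoUniformlyToConst {a b : ℝ} (M : ℝ → H1 a b) (c : Vec) : Prop :=
  ∃ m : ℝ → ℝ → Vec,
    (∀ t, 0 ≤ t → ContinuousOn (m t) (Icc a b) ∧ profile (M t) =ᵐ[freqMeasure a b] m t) ∧
    TendstoUniformlyOn m (fun _ => c) atTop (Icc a b)

end BlochEnsemble

end

/-! Since |ς| = 1, S is a continuous triangle wave with values in [0, T], and the impulses enter
only through S. The system reads Ṁ = u₀ A₀(S) M + u₁ A₁(S) M, where the A_j(s) are bounded operators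
on H¹ acting at each ω by a skew matrix (`inner_ctrlField`). Take E(M) = ½∫|M'|² + G∫z. On the
sphere |m + e₃|² = 2 + 2z, so E + G(b - a) = ½‖M'‖² + ½G‖M + e₃‖² (norms of L²) is comparable with
the squared H¹ distance to -e₃ (`energy_bounds`). Let y_j(s, M) be the derivative of E along A_j(s)
M. An algebraic identity gives Ω = -K(y₀ + i y₁) (`feedback_eq`), hence Ė = -K(y₀² + y₁²): solutions
that start near -e₃ stay near it, and are global (`exists_solution`).

The decay of E gives only boundedness in H¹, so the invariance argument is run in the weak topology.
Barbalat's lemma gives y_j(S(t), M(t)) → 0, hence Ṁ → 0. During a time 3T the state then hardly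
moves while S takes every value in [0, T], so y_j(s, M(t)) → 0 for each fixed s
(`tendsto_ctrlOutput`). Skewness removes from y_j the term quadratic in M'; what remains pairs M'
with M, or is linear, and is weakly continuous on bounded sets because H¹ embeds compactly in C⁰
(`tendsto_ctrlOutput_of_weak`). Every weak limit N therefore satisfies y_j(s, N) = 0 for all s in
[0, T].

Such an N is rigid. Let V be the primitive of GZ with V(a) = 0. Vanishing outputs mean is∫(Zz' - Z'z
- V)e^{iωs} + V(b)e^{ibs} = 0. At s = 0 this is V(b) = 0; then a function supported in a bounded
interval has a Fourier transform that vanishes on an interval, so Zz' - Z'z = V (`flux_ae_eq`).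
Multiplying by the conjugate of Z', taking real parts, integrating by parts and using N·N' = 0 gives
∫(-z|N'|² + G|Z|²) = 0. As z < 0 near -e₃, Z = 0 and z = -1 (`eq_constProfile_of_ctrlOutput`). Thus
-e₃ is the only weak limit, and the compact embedding makes the convergence uniform in ω. -/

noncomputable section

namespace BlochEnsemble

section

variable {a b : ℝ}

/-! ### Square integrable profiles -/

theorem integrable_L2 (f : L2Space a b) : Integrable f (freqMeasure a b) :=
  (Lp.memLp f).integrable (by norm_num)

/-- Cauchy–Schwarz. The factor √|s| for subsets is what later yields the Hölder-1/2 modulus of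
continuity of elements of H¹. -/
theorem setIntegral_norm_le {s : Set ℝ} (hs : s ⊆ Ioo a b) (f : L2Space a b) :
    ∫ ω in s, ‖f ω‖ ≤ √(volume.real s) * ‖f‖ := by
  have hle : volume.restrict s ≤ freqMeasure a b := Measure.restrict_mono hs le_rfl
  have hm : MemLp f 2 (volume.restrict s) := (Lp.memLp f).mono_measure hle
  have hfin : volume s ≠ ⊤ := measure_ne_top_of_subset hs (by simp)
  have h1 : eLpNorm f 1 (volume.restrict s)
      ≤ eLpNorm f 2 (freqMeasure a b) * volume s ^ (1 / 2 : ℝ) := by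
    refine (eLpNorm_le_eLpNorm_mul_rpow_measure_univ (q := 2) (by norm_num) hm.1).trans ?_
    rw [Measure.restrict_apply_univ]
    have : (1 / (1 : ENNReal).toReal - 1 / (2 : ENNReal).toReal) = (1 / 2 : ℝ) := by norm_num
    rw [this]
    gcongr
  have h2 : ∫ ω in s, ‖f ω‖ = (eLpNorm f 1 (volume.restrict s)).toReal := by
    rw [eLpNorm_one_eq_lintegral_enorm, integral_norm_eq_lintegral_enorm hm.1]
  rw [h2, Lp.norm_def, Real.sqrt_eq_rpow, mul_comm]
  refine (ENNReal.toReal_mono ?_ h1).trans_eq ?_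
  · exact ENNReal.mul_ne_top (Lp.memLp f).2.ne (ENNReal.rpow_ne_top_of_nonneg (by norm_num) hfin)
  · rw [ENNReal.toReal_mul, ← ENNReal.toReal_rpow]
    rfl

/-- The integral of a square integrable profile. -/
def intL2 (a b : ℝ) : L2Space a b →L[ℝ] Vec :=
  LinearMap.mkContinuous
    { toFun := fun f => ∫ ω in Ioo a b, f ω
      map_add' := fun f g => by
        rw [← integral_add (integrable_L2 f) (integrable_L2 g)]
        exact integral_congr_ae (Lp.coeFn_add f g)
      map_smul' := fun c f => by
        rw [RingHom.id_apply, ← integral_smul]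
        exact integral_congr_ae (Lp.coeFn_smul c f) }
    (√(volume.real (Ioo a b)))
    (fun f => (norm_integral_le_integral_norm _).trans (setIntegral_norm_le Subset.rfl f))

theorem memLp_smul {p : ℝ → ℝ} (hp : Continuous p) (f : L2Space a b) :
    MemLp (fun ω => p ω • f ω) 2 (freqMeasure a b) := by
  obtain ⟨C, hC⟩ := isCompact_Icc.exists_bound_of_continuousOn (s := Icc a b) hp.continuousOn
  refine (Lp.memLp f).of_le_mul (c := C) (hp.aestronglyMeasurable.smul (Lp.memLp f).1) ?_
  filter_upwards [ae_restrict_mem measurableSet_Ioo] with ω hω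
  rw [norm_smul]
  exact mul_le_mul_of_nonneg_right (hC ω (Ioo_subset_Icc_self hω)) (norm_nonneg _)

/-- Multiplication of square integrable profiles by a continuous function. -/
def mulL2 (a b : ℝ) {p : ℝ → ℝ} (hp : Continuous p) : L2Space a b →L[ℝ] L2Space a b :=
  LinearMap.mkContinuousOfExistsBound
    { toFun := fun f => (memLp_smul hp f).toLp
      map_add' := fun f g => by
        rw [← MemLp.toLp_add]
        apply MemLp.toLp_congr
        filter_upwards [Lp.coeFn_add f g] with ω h
        rw [h, Pi.add_apply, smul_add, Pi.add_apply]
      map_smul' := fun c f => by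
        rw [RingHom.id_apply, ← MemLp.toLp_const_smul]
        apply MemLp.toLp_congr
        filter_upwards [Lp.coeFn_smul c f] with ω h
        rw [h, Pi.smul_apply, Pi.smul_apply, smul_comm] }
    (by
      obtain ⟨C, hC⟩ := isCompact_Icc.exists_bound_of_continuousOn (s := Icc a b) hp.continuousOn
      refine ⟨C, fun f => Lp.norm_le_mul_norm_of_ae_le_mul ?_⟩
      filter_upwards [ae_restrict_mem measurableSet_Ioo, (memLp_smul hp f).coeFn_toLp]
        with ω hω h
      change ‖((memLp_smul hp f).toLp) ω‖ ≤ _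
      rw [h, norm_smul]
      exact mul_le_mul_of_nonneg_right (hC ω (Ioo_subset_Icc_self hω)) (norm_nonneg _))

theorem coeFn_mulL2 {p : ℝ → ℝ} (hp : Continuous p) (f : L2Space a b) :
    mulL2 a b hp f =ᵐ[freqMeasure a b] fun ω => p ω • f ω :=
  (memLp_smul hp f).coeFn_toLp

theorem norm_mulL2_le {p : ℝ → ℝ} (hp : Continuous p) {B : ℝ} (hB : ∀ ω ∈ Ioo a b, |p ω| ≤ B)
    (f : L2Space a b) : ‖mulL2 a b hp f‖ ≤ B * ‖f‖ := by
  refine Lp.norm_le_mul_norm_of_ae_le_mul ?_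
  filter_upwards [ae_restrict_mem measurableSet_Ioo, coeFn_mulL2 hp f] with ω hω h
  rw [h, norm_smul]
  exact mul_le_mul_of_nonneg_right (hB ω hω) (norm_nonneg _)

theorem intL2_mulL2 {p : ℝ → ℝ} (hp : Continuous p) (f : L2Space a b) :
    intL2 a b (mulL2 a b hp f) = ∫ ω in Ioo a b, p ω • f ω :=
  integral_congr_ae (coeFn_mulL2 hp f)

/-! ### The Sobolev space -/

/-- Each test function imposes a closed condition, an equality of two continuous maps of the pair
(f, f'). The resulting completeness of H¹ is needed both for Picard–Lindelöf and for weak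
compactness. -/
theorem isClosed_H1 (a b : ℝ) :
    IsClosed (H1 a b : Set (WithLp 2 (L2Space a b × L2Space a b))) := by
  have h : (H1 a b : Set (WithLp 2 (L2Space a b × L2Space a b))) =
      ⋂ (φ : ℝ → ℝ) (hφ : IsTestFunction a b φ),
        {p | intL2 a b (mulL2 a b hφ.deriv_compact.1 p.fst)
          = - intL2 a b (mulL2 a b hφ.smooth.continuous p.snd)} := by
    ext p
    simp only [mem_iInter, mem_ofPred_eq, intL2_mulL2]
    exact Iff.rfl
  rw [h]
  refine isClosed_iInter fun φ => isClosed_iInter fun hφ => isClosed_eq ?_ ?_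
  · exact ((intL2 a b).comp (mulL2 a b _)).continuous.comp (WithLp.fstL 2 ℝ _ _).continuous
  · exact (((intL2 a b).comp (mulL2 a b _)).continuous.comp
      (WithLp.sndL 2 ℝ _ _).continuous).neg

instance : CompleteSpace (H1 a b) := (isClosed_H1 a b).completeSpace_coe

/-- The inclusion of `H¹` in `L²`. -/
def toL2 (a b : ℝ) : H1 a b →L[ℝ] L2Space a b :=
  (WithLp.fstL 2 ℝ (L2Space a b) (L2Space a b)).comp (H1 a b).subtypeL

/-- The derivative, from `H¹` to `L²`. -/
def derivL2 (a b : ℝ) : H1 a b →L[ℝ] L2Space a b :=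
  (WithLp.sndL 2 ℝ (L2Space a b) (L2Space a b)).comp (H1 a b).subtypeL

theorem coeFn_toL2 (M : H1 a b) : ⇑(toL2 a b M) = profile M := rfl

theorem coeFn_derivL2 (M : H1 a b) : ⇑(derivL2 a b M) = profileDeriv M := rfl

theorem norm_sq_H1 (M : H1 a b) : ‖M‖ ^ 2 = ‖toL2 a b M‖ ^ 2 + ‖derivL2 a b M‖ ^ 2 :=
  WithLp.prod_norm_sq_eq_of_L2 (M : WithLp 2 (L2Space a b × L2Space a b))

theorem norm_toL2_le (M : H1 a b) : ‖toL2 a b M‖ ≤ ‖M‖ := by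
  refine le_of_sq_le_sq ?_ (norm_nonneg _)
  rw [norm_sq_H1]
  nlinarith [sq_nonneg ‖derivL2 a b M‖]

theorem norm_derivL2_le (M : H1 a b) : ‖derivL2 a b M‖ ≤ ‖M‖ := by
  refine le_of_sq_le_sq ?_ (norm_nonneg _)
  rw [norm_sq_H1]
  nlinarith [sq_nonneg ‖toL2 a b M‖]

theorem norm_H1_le (M : H1 a b) : ‖M‖ ≤ ‖toL2 a b M‖ + ‖derivL2 a b M‖ := by
  refine le_of_sq_le_sq ?_ (by positivity)
  rw [norm_sq_H1]
  nlinarith [norm_nonneg (toL2 a b M), norm_nonneg (derivL2 a b M)]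

theorem isWeakDeriv (M : H1 a b) : IsWeakDeriv a b (profile M) (profileDeriv M) := M.2

theorem IsWeakDeriv.congr {f f' g g' : ℝ → Vec} (h : IsWeakDeriv a b f g)
    (hf : f =ᵐ[freqMeasure a b] f') (hg : g =ᵐ[freqMeasure a b] g') : IsWeakDeriv a b f' g' := by
  intro φ hφ
  have h1 : ∫ ω in Ioo a b, deriv φ ω • f' ω = ∫ ω in Ioo a b, deriv φ ω • f ω := by
    apply integral_congr_ae
    filter_upwards [hf] with ω h
    rw [h]
  have h2 : ∫ ω in Ioo a b, φ ω • g' ω = ∫ ω in Ioo a b, φ ω • g ω := by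
    apply integral_congr_ae
    filter_upwards [hg] with ω h
    rw [h]
  rw [h1, h2, h φ hφ]

/-- A continuous linear map on `H¹` given by a pair of maps to `L²`. -/
def mkH1Map (F F' : H1 a b →L[ℝ] L2Space a b) (h : ∀ M, IsWeakDeriv a b (F M) (F' M)) :
    H1 a b →L[ℝ] H1 a b :=
  ((WithLp.prodContinuousLinearEquiv 2 ℝ (L2Space a b) (L2Space a b)).symm.toContinuousLinearMap.comp
    (F.prod F')).codRestrict (H1 a b) h

theorem IsTestFunction.mul {φ p : ℝ → ℝ} (hφ : IsTestFunction a b φ)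
    (hp : ContDiff ℝ (⊤ : ℕ∞) p) : IsTestFunction a b (fun ω => φ ω * p ω) where
  smooth := hφ.smooth.mul hp
  compact := hφ.compact.mul_right
  support := (tsupport_mul_subset_left (f := φ) (g := p)).trans hφ.support

/-- Leibniz rule, obtained by testing the derivative of M against φp, again a test function. -/
theorem IsWeakDeriv.smul {p : ℝ → ℝ} (hp : ContDiff ℝ (⊤ : ℕ∞) p) (M : H1 a b) :
    IsWeakDeriv a b (fun ω => p ω • profile M ω)
      (fun ω => p ω • profileDeriv M ω + deriv p ω • profile M ω) := by
  intro φ hφ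
  have hp' : Continuous (deriv p) := hp.continuous_deriv (by simp)
  have hw := isWeakDeriv M _ (hφ.mul hp)
  have hd : ∀ ω, deriv (fun ω => φ ω * p ω) ω = deriv φ ω * p ω + φ ω * deriv p ω := fun ω =>
    deriv_fun_mul ((hφ.smooth.differentiable (by simp)) ω) ((hp.differentiable (by simp)) ω)
  have i1 : Integrable (fun ω => (deriv φ ω * p ω) • profile M ω) (freqMeasure a b) :=
    integrable_smul_of_L2 (hφ.deriv_compact.1.mul hp.continuous) hφ.deriv_compact.2.mul_right
      (toL2 a b M)
  have i2 : Integrable (fun ω => (φ ω * deriv p ω) • profile M ω) (freqMeasure a b) :=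
    integrable_smul_of_L2 (hφ.smooth.continuous.mul hp') hφ.compact.mul_right (toL2 a b M)
  have i3 : Integrable (fun ω => (φ ω * p ω) • profileDeriv M ω) (freqMeasure a b) :=
    integrable_smul_of_L2 (hφ.smooth.continuous.mul hp.continuous) hφ.compact.mul_right
      (derivL2 a b M)
  have e1 : ∫ ω in Ioo a b, deriv φ ω • p ω • profile M ω
      = ∫ ω in Ioo a b, (deriv φ ω * p ω) • profile M ω := by simp only [mul_smul]
  have e2 : ∫ ω in Ioo a b, φ ω • (p ω • profileDeriv M ω + deriv p ω • profile M ω)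
      = (∫ ω in Ioo a b, (φ ω * p ω) • profileDeriv M ω)
        + ∫ ω in Ioo a b, (φ ω * deriv p ω) • profile M ω := by
    rw [← integral_add i3 i2]
    simp only [mul_smul, smul_add]
  simp only [hd, add_smul] at hw
  rw [integral_add i1 i2] at hw
  rw [e1, e2, neg_add, ← hw]
  abel

/-- Multiplication by a smooth function, on `H¹`. -/
def mulH1 (a b : ℝ) {p : ℝ → ℝ} (hp : ContDiff ℝ (⊤ : ℕ∞) p) : H1 a b →L[ℝ] H1 a b :=
  mkH1Map ((mulL2 a b hp.continuous).comp (toL2 a b))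
    ((mulL2 a b hp.continuous).comp (derivL2 a b)
      + (mulL2 a b (hp.continuous_deriv (by simp))).comp (toL2 a b)) (by
    intro M
    refine (IsWeakDeriv.smul hp M).congr (coeFn_mulL2 hp.continuous (toL2 a b M)).symm ?_
    refine EventuallyEq.symm ((Lp.coeFn_add _ _).trans ?_)
    exact (coeFn_mulL2 hp.continuous (derivL2 a b M)).add
      (coeFn_mulL2 (hp.continuous_deriv (by simp)) (toL2 a b M)))

theorem profile_mulH1 {p : ℝ → ℝ} (hp : ContDiff ℝ (⊤ : ℕ∞) p) (M : H1 a b) :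
    profile (mulH1 a b hp M) =ᵐ[freqMeasure a b] fun ω => p ω • profile M ω :=
  coeFn_mulL2 hp.continuous (toL2 a b M)

theorem profileDeriv_mulH1 {p : ℝ → ℝ} (hp : ContDiff ℝ (⊤ : ℕ∞) p) (M : H1 a b) :
    profileDeriv (mulH1 a b hp M) =ᵐ[freqMeasure a b]
      fun ω => p ω • profileDeriv M ω + deriv p ω • profile M ω :=
  (Lp.coeFn_add _ _).trans ((coeFn_mulL2 hp.continuous (derivL2 a b M)).add
    (coeFn_mulL2 (hp.continuous_deriv (by simp)) (toL2 a b M)))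

theorem norm_mulH1_le {p : ℝ → ℝ} (hp : ContDiff ℝ (⊤ : ℕ∞) p) {B B' : ℝ}
    (hB : ∀ ω ∈ Ioo a b, |p ω| ≤ B) (hB' : ∀ ω ∈ Ioo a b, |deriv p ω| ≤ B')
    (hB0 : 0 ≤ B) (hB0' : 0 ≤ B') : ‖mulH1 a b hp‖ ≤ 2 * B + B' := by
  refine ContinuousLinearMap.opNorm_le_bound _ (by positivity) fun M => ?_
  have h1 := norm_mulL2_le hp.continuous hB (toL2 a b M)
  have h2 := norm_mulL2_le hp.continuous hB (derivL2 a b M)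
  have h3 := norm_mulL2_le (hp.continuous_deriv (by simp)) hB' (toL2 a b M)
  have h4 := norm_add_le (mulL2 a b hp.continuous (derivL2 a b M))
    (mulL2 a b (hp.continuous_deriv (by simp)) (toL2 a b M))
  have h5 : ‖mulH1 a b hp M‖ ≤ ‖mulL2 a b hp.continuous (toL2 a b M)‖
    + ‖mulL2 a b hp.continuous (derivL2 a b M)
      + mulL2 a b (hp.continuous_deriv (by simp)) (toL2 a b M)‖ := norm_H1_le _
  have h6 := mul_le_mul_of_nonneg_left (norm_toL2_le M) hB0
  have h7 := mul_le_mul_of_nonneg_left (norm_derivL2_le M) hB0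
  have h8 := mul_le_mul_of_nonneg_left (norm_toL2_le M) hB0'
  linarith

/-- Reduces the dependence of multiplication operators on a parameter to `norm_mulH1_le` applied to
the difference of the multipliers. -/
theorem mulH1_sub {p q : ℝ → ℝ} (hp : ContDiff ℝ (⊤ : ℕ∞) p) (hq : ContDiff ℝ (⊤ : ℕ∞) q) :
    mulH1 a b hp - mulH1 a b hq = mulH1 a b (hp.sub hq) := by
  have key : ∀ {p q r : ℝ → ℝ} (hp : Continuous p) (hq : Continuous q) (hr : Continuous r),
      (∀ ω, r ω = p ω - q ω) → ∀ f : L2Space a b,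
      mulL2 a b hp f - mulL2 a b hq f = mulL2 a b hr f := by
    intro p q r hp hq hr h f
    apply Lp.ext
    filter_upwards [Lp.coeFn_sub (mulL2 a b hp f) (mulL2 a b hq f), coeFn_mulL2 hp f,
      coeFn_mulL2 hq f, coeFn_mulL2 hr f] with ω h1 h2 h3 h4
    rw [h1, Pi.sub_apply, h2, h3, h4, h, sub_smul]
  refine ContinuousLinearMap.ext fun M => Subtype.ext ?_
  refine (WithLp.ext_iff 2).2 (Prod.ext ?_ ?_)
  · exact key hp.continuous hq.continuous (hp.sub hq).continuous (fun _ => rfl) (toL2 a b M)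
  · have e1 := key hp.continuous hq.continuous (hp.sub hq).continuous (fun _ => rfl)
      (derivL2 a b M)
    have e2 := key (hp.continuous_deriv (by simp)) (hq.continuous_deriv (by simp))
      ((hp.sub hq).continuous_deriv (by simp)) (fun ω => deriv_fun_sub
        (hp.differentiable (by simp) ω) (hq.differentiable (by simp) ω)) (toL2 a b M)
    change (_ + _ : L2Space a b) - (_ + _) = _ + _
    exact (add_sub_add_comm _ _ _ _).trans (congrArg₂ (· + ·) e1 e2)

/-- A constant linear map applied to the values of the profiles of `H¹`. -/
def constH1 (a b : ℝ) (R : Vec →L[ℝ] Vec) : H1 a b →L[ℝ] H1 a b :=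
  mkH1Map ((R.compLpL 2 (freqMeasure a b)).comp (toL2 a b))
    ((R.compLpL 2 (freqMeasure a b)).comp (derivL2 a b)) (by
    intro M
    have h : IsWeakDeriv a b (fun ω => R (profile M ω)) (fun ω => R (profileDeriv M ω)) := by
      intro φ hφ
      have i1 := integrable_smul_of_L2 hφ.deriv_compact.1 hφ.deriv_compact.2 (toL2 a b M)
      have i2 := integrable_smul_of_L2 hφ.smooth.continuous hφ.compact (derivL2 a b M)
      have h1 := R.integral_comp_comm i1
      have h2 := R.integral_comp_comm i2
      simp only [map_smul] at h1 h2
      have h3 := congrArg R (isWeakDeriv M φ hφ)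
      rw [map_neg] at h3
      exact h1.trans (h3.trans (congrArg Neg.neg h2.symm))
    exact h.congr (R.coeFn_compLpL (toL2 a b M)).symm (R.coeFn_compLpL (derivL2 a b M)).symm)

theorem profile_constH1 (R : Vec →L[ℝ] Vec) (M : H1 a b) :
    profile (constH1 a b R M) =ᵐ[freqMeasure a b] fun ω => R (profile M ω) :=
  R.coeFn_compLpL (toL2 a b M)

theorem profileDeriv_constH1 (R : Vec →L[ℝ] Vec) (M : H1 a b) :
    profileDeriv (constH1 a b R M) =ᵐ[freqMeasure a b] fun ω => R (profileDeriv M ω) :=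
  R.coeFn_compLpL (derivL2 a b M)

end

section

variable {a b : ℝ}

/-! ### Continuous representatives -/

theorem absolutelyContinuous_primitive {f : ℝ → ℝ} (hf : IntervalIntegrable f volume a b) (c : ℝ) :
    AbsolutelyContinuousOnInterval (fun x => c + ∫ t in a..x, f t) a b :=
  ((LipschitzWith.const c).lipschitzOnWith (s := uIcc a b)).absolutelyContinuousOnInterval.add
    (hf.absolutelyContinuousOnInterval_intervalIntegral left_mem_uIcc)

theorem ae_deriv_primitive {E : Type*} [NormedAddCommGroup E] [NormedSpace ℝ E] [CompleteSpace E]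
    {f : ℝ → E} (hf : IntervalIntegrable f volume a b) (c : E) :
    ∀ᵐ x, x ∈ uIcc a b → HasDerivAt (fun x => c + ∫ t in a..x, f t) (f x) x := by
  filter_upwards [hf.ae_hasDerivAt_integral] with x hx hxm
  exact (hx hxm a left_mem_uIcc).const_add c

/-- Integration by parts for primitives of integrable functions. -/
theorem integral_primitive_parts {f g : ℝ → ℝ} (hf : IntervalIntegrable f volume a b)
    (hg : IntervalIntegrable g volume a b) (c d : ℝ) :
    ∫ x in a..b, (f x * (d + ∫ t in a..x, g t) + (c + ∫ t in a..x, f t) * g x)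
      = (c + ∫ t in a..b, f t) * (d + ∫ t in a..b, g t) - c * d := by
  have h := (absolutelyContinuous_primitive hf c).integral_deriv_mul_eq_sub
    (absolutelyContinuous_primitive hg d)
  simp only [intervalIntegral.integral_same, add_zero] at h
  rw [← h]
  apply intervalIntegral.integral_congr_ae
  filter_upwards [ae_deriv_primitive hf c, ae_deriv_primitive hg d] with x h1 h2 hx
  have hx' := uIoc_subset_uIcc hx
  rw [(h1 hx').deriv, (h2 hx').deriv]

theorem intervalIntegrable_of_Ioo {E : Type*} [NormedAddCommGroup E] (hab : a ≤ b)
    {f : ℝ → E} (hf : IntegrableOn f (Ioo a b)) : IntervalIntegrable f volume a b :=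
  (intervalIntegrable_iff_integrableOn_Ioo_of_le hab).2 hf

theorem setIntegral_Ioo_eq {E : Type*} [NormedAddCommGroup E] [NormedSpace ℝ E] (hab : a ≤ b)
    (f : ℝ → E) : ∫ ω in Ioo a b, f ω = ∫ ω in a..b, f ω := by
  rw [intervalIntegral.integral_of_le hab, integral_Ioc_eq_integral_Ioo]

theorem IsTestFunction.eq_zero {φ : ℝ → ℝ} (h : IsTestFunction a b φ) {x : ℝ}
    (hx : x ∉ Ioo a b) : φ x = 0 :=
  image_eq_zero_of_notMem_tsupport (fun hx' => hx (h.support hx'))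

/-- Integration by parts in each coordinate; the boundary terms vanish since φ(a) = φ(b) = 0. -/
theorem integral_deriv_test_smul_primitive (hab : a ≤ b) {φ : ℝ → ℝ} (hφ : IsTestFunction a b φ)
    {g : ℝ → Vec} (hg : IntegrableOn g (Ioo a b)) :
    ∫ ω in Ioo a b, deriv φ ω • (∫ t in a..ω, g t) = - ∫ ω in Ioo a b, φ ω • g ω := by
  have hgi := intervalIntegrable_of_Ioo hab hg
  have hφ' : IntervalIntegrable (deriv φ) volume a b := hφ.deriv_compact.1.intervalIntegrable _ _
  have hcont : ContinuousOn (fun x => ∫ t in a..x, g t) (uIcc a b) :=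
    intervalIntegral.continuousOn_primitive_interval
      (by rw [uIcc_of_le hab, integrableOn_Icc_iff_integrableOn_Ioo]; exact hg)
  have hi1 : IntervalIntegrable (fun ω => deriv φ ω • ∫ t in a..ω, g t) volume a b :=
    (hφ.deriv_compact.1.continuousOn.smul hcont).intervalIntegrable
  have hi2 : IntervalIntegrable (fun ω => φ ω • g ω) volume a b :=
    hgi.continuousOn_smul hφ.smooth.continuous.continuousOn
  rw [setIntegral_Ioo_eq hab, setIntegral_Ioo_eq hab]
  have hφint : ∀ x, ∫ t in a..x, deriv φ t = φ x := by
    intro x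
    rw [intervalIntegral.integral_deriv_eq_sub
      (fun y _ => (hφ.smooth.differentiable (by simp)).differentiableAt)
      (hφ.deriv_compact.1.intervalIntegrable _ _), hφ.eq_zero (x := a) (by simp), sub_zero]
  ext i
  have hproj : ∀ {u : ℝ → Vec} {c d : ℝ}, IntervalIntegrable u volume c d →
      (∫ t in c..d, u t) i = ∫ t in c..d, u t i := fun hu =>
    ((EuclideanSpace.proj (𝕜 := ℝ) i).intervalIntegral_comp_comm hu).symm
  have hgi' : IntervalIntegrable (fun t => g t i) volume a b :=
    ⟨(EuclideanSpace.proj (𝕜 := ℝ) i).integrable_comp hgi.1,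
      (EuclideanSpace.proj (𝕜 := ℝ) i).integrable_comp hgi.2⟩
  rw [PiLp.neg_apply, hproj hi1, hproj hi2, eq_neg_iff_add_eq_zero,
    ← intervalIntegral.integral_add]
  · have h := integral_primitive_parts hφ' hgi' 0 0
    simp only [zero_add, hφint, hφ.eq_zero (x := b) (by simp), zero_mul, sub_zero] at h
    rw [← h]
    apply intervalIntegral.integral_congr
    intro x hx
    have hx' : IntervalIntegrable g volume a x := hgi.mono_set (uIcc_subset_uIcc_left hx)
    simp only [PiLp.smul_apply, smul_eq_mul, hproj hx']
  · exact ⟨(EuclideanSpace.proj (𝕜 := ℝ) i).integrable_comp hi1.1,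
      (EuclideanSpace.proj (𝕜 := ℝ) i).integrable_comp hi1.2⟩
  · exact ⟨(EuclideanSpace.proj (𝕜 := ℝ) i).integrable_comp hi2.1,
      (EuclideanSpace.proj (𝕜 := ℝ) i).integrable_comp hi2.2⟩

/-- The primitive from a vanishes to the left of the support of η, and the zero mean makes it vanish
to the right as well. -/
theorem exists_testFunction_primitive (hab : a < b) {η : ℝ → ℝ} (hη : IsTestFunction a b η)
    (h0 : ∫ ω in Ioo a b, η ω = 0) : ∃ φ, IsTestFunction a b φ ∧ deriv φ = η := by
  have hc := hη.smooth.continuous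
  have hder : deriv (fun x => ∫ t in a..x, η t) = η := by
    funext x
    exact Continuous.deriv_integral _ hc _ _
  -- A compact interval strictly inside (a, b) is needed for the support of the primitive, which may
  -- fill the gaps in that of η.
  have hsub : ∃ c d, a < c ∧ d < b ∧ tsupport η ⊆ Icc c d := by
    rcases (tsupport η).eq_empty_or_nonempty with h | h
    · exact ⟨(a + b) / 2, (a + b) / 2, by linarith, by linarith, by simp [h]⟩
    · obtain ⟨c, hcm, hcl⟩ := hη.compact.exists_isLeast h
      obtain ⟨d, hdm, hdl⟩ := hη.compact.exists_isGreatest h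
      exact ⟨c, d, (hη.support hcm).1, (hη.support hdm).2, fun x hx => ⟨hcl hx, hdl hx⟩⟩
  obtain ⟨c, d, hac, hdb, hcd⟩ := hsub
  have hz : ∀ x, x ∉ Icc c d → η x = 0 := fun x hx =>
    image_eq_zero_of_notMem_tsupport (fun h => hx (hcd h))
  have hsupp : tsupport (fun x => ∫ t in a..x, η t) ⊆ Icc c d := by
    refine closure_minimal (fun x hx => ?_) isClosed_Icc
    by_contra hx'
    apply hx
    rw [mem_Icc, not_and_or, not_le, not_le] at hx'
    rcases hx' with hx' | hx'
    · refine (intervalIntegral.integral_congr_ae (g := fun _ => (0 : ℝ))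
        (Eventually.of_forall fun t ht => hz t ?_)).trans (by simp)
      intro h
      rcases mem_uIoc.1 ht with h1 | h1
      · linarith [h.1, h1.2]
      · linarith [h.1, h1.2]
    · have e1 : ∫ t in x..b, η t = 0 := by
        refine (intervalIntegral.integral_congr_ae (g := fun _ => (0 : ℝ))
          (Eventually.of_forall fun t ht => hz t ?_)).trans (by simp)
        intro h
        rcases mem_uIoc.1 ht with h1 | h1
        · linarith [h.2, h1.1]
        · linarith [h.2, h1.1]
      have e2 := intervalIntegral.integral_add_adjacent_intervals
        (hc.intervalIntegrable (μ := volume) a x) (hc.intervalIntegrable (μ := volume) x b)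
      rw [setIntegral_Ioo_eq hab.le] at h0
      rw [e1, h0, add_zero] at e2
      exact e2
  refine ⟨fun x => ∫ t in a..x, η t, ⟨?_, ?_, ?_⟩, hder⟩
  · rw [contDiff_infty_iff_deriv, hder]
    exact ⟨fun x => (hc.integral_hasStrictDerivAt a x).hasDerivAt.differentiableAt, hη.smooth⟩
  · exact HasCompactSupport.of_support_subset_isCompact isCompact_Icc
      ((subset_tsupport _).trans hsupp)
  · exact hsupp.trans fun x hx => ⟨hac.trans_le hx.1, hx.2.trans_lt hdb⟩

theorem integral_test_smul {E : Type*} [NormedAddCommGroup E] [NormedSpace ℝ E] {φ : ℝ → ℝ}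
    (hφ : IsTestFunction a b φ) (h : ℝ → E) :
    ∫ ω in Ioo a b, φ ω • h ω = ∫ ω, φ ω • h ω :=
  setIntegral_eq_integral_of_forall_compl_eq_zero fun x hx => by rw [hφ.eq_zero hx, zero_smul]

theorem ae_eq_zero_of_integral_test {E : Type*} [NormedAddCommGroup E] [NormedSpace ℝ E]
    {h : ℝ → E} [CompleteSpace E] (hi : IntegrableOn h (Ioo a b))
    (h0 : ∀ φ, IsTestFunction a b φ → ∫ ω in Ioo a b, φ ω • h ω = 0) :
    h =ᵐ[freqMeasure a b] 0 := by
  rw [EventuallyEq, ae_restrict_iff' measurableSet_Ioo]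
  refine isOpen_Ioo.ae_eq_zero_of_integral_contDiff_smul_eq_zero hi.locallyIntegrableOn ?_
  intro g hg hc hs
  rw [← integral_test_smul ⟨hg, hc, hs⟩]
  exact h0 g ⟨hg, hc, hs⟩

theorem IsTestFunction.integrable_smul {E : Type*} [NormedAddCommGroup E] [NormedSpace ℝ E]
    {φ : ℝ → ℝ} (hc : Continuous φ) (hs : HasCompactSupport φ) {h : ℝ → E}
    (hi : IntegrableOn h (Ioo a b)) : IntegrableOn (fun ω => φ ω • h ω) (Ioo a b) := by
  obtain ⟨C, hC⟩ := hs.exists_bound_of_continuous hc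
  exact Integrable.bdd_smul hi C hc.aestronglyMeasurable (Eventually.of_forall hC)

theorem IsTestFunction.sub_smul {φ ψ : ℝ → ℝ} (hφ : IsTestFunction a b φ)
    (hψ : IsTestFunction a b ψ) (c : ℝ) : IsTestFunction a b (fun x => φ x - c * ψ x) where
  smooth := hφ.smooth.sub (contDiff_const.mul hψ.smooth)
  compact := hφ.compact.sub hψ.compact.mul_left
  support := by
    refine (tsupport_sub φ (fun x => c * ψ x)).trans (union_subset hφ.support ?_)
    exact (tsupport_mul_subset_right (f := fun _ => c) (g := ψ)).trans hψ.support

theorem exists_testFunction_integral_eq_one (hab : a < b) :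
    ∃ ρ, IsTestFunction a b ρ ∧ ∫ ω in Ioo a b, ρ ω = 1 := by
  obtain ⟨f, hs, hc, hd, hr, h1⟩ := exists_contDiff_tsupport_subset (n := ⊤)
    (Ioo_mem_nhds (show a < (a + b) / 2 by linarith) (show (a + b) / 2 < b by linarith))
  have hf : IsTestFunction a b f := ⟨hd, hc, hs⟩
  have hpos : 0 < ∫ ω, f ω :=
    hd.continuous.integral_pos_of_hasCompactSupport_nonneg_nonzero hc
      (fun x => (hr (mem_range_self x)).1) (x := (a + b) / 2) (by rw [h1]; exact one_ne_zero)
  have he : ∫ ω in Ioo a b, f ω = ∫ ω, f ω :=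
    setIntegral_eq_integral_of_forall_compl_eq_zero fun x hx => hf.eq_zero hx
  refine ⟨fun ω => f ω * (∫ ω, f ω)⁻¹, hf.mul contDiff_const, ?_⟩
  rw [integral_mul_const, he, mul_inv_cancel₀ hpos.ne']

/-- The du Bois-Reymond lemma: a function with zero distributional derivative is constant. -/
theorem ae_const_of_integral_deriv_test (hab : a < b) {h : ℝ → Vec}
    (hi : IntegrableOn h (Ioo a b))
    (h0 : ∀ φ, IsTestFunction a b φ → ∫ ω in Ioo a b, deriv φ ω • h ω = 0) :
    ∃ c : Vec, h =ᵐ[freqMeasure a b] fun _ => c := by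
  obtain ⟨ρ, hρ, hρ1⟩ := exists_testFunction_integral_eq_one hab
  set c := ∫ ω in Ioo a b, ρ ω • h ω with hc
  have key : (fun ω => h ω - c) =ᵐ[freqMeasure a b] 0 := by
    refine ae_eq_zero_of_integral_test (hi.sub (integrable_const c)) fun ψ hψ => ?_
    have iψ : IntegrableOn ψ (Ioo a b) :=
      (hψ.smooth.continuous.integrable_of_hasCompactSupport hψ.compact).integrableOn
    have iρ : IntegrableOn ρ (Ioo a b) :=
      (hρ.smooth.continuous.integrable_of_hasCompactSupport hρ.compact).integrableOn
    -- Subtracting the multiple of ρ with the same integral turns ψ into a function of zero mean,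
    -- hence into the derivative of a test function.
    obtain ⟨φ, hφ, hφ'⟩ := exists_testFunction_primitive hab
      (hψ.sub_smul hρ (∫ ω in Ioo a b, ψ ω)) (by
        rw [integral_sub iψ (iρ.const_mul _), integral_const_mul, hρ1, mul_one, sub_self])
    have h1 := h0 φ hφ
    simp only [hφ', sub_smul, mul_smul] at h1
    have i1 := IsTestFunction.integrable_smul hψ.smooth.continuous hψ.compact hi
    have i2 := IsTestFunction.integrable_smul hρ.smooth.continuous hρ.compact hi
    rw [integral_sub i1 (Integrable.fun_smul _ i2), integral_smul, ← hc] at h1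
    simp only [smul_sub]
    rw [integral_sub i1 (iψ.smul_const c), integral_smul_const, h1]
  refine ⟨c, ?_⟩
  filter_upwards [key] with ω hω
  exact sub_eq_zero.1 hω

theorem continuousOn_primitive (hab : a ≤ b) (f : L2Space a b) :
    ContinuousOn (fun x => ∫ t in a..x, f t) (Icc a b) := by
  rw [← uIcc_of_le hab]
  apply intervalIntegral.continuousOn_primitive_interval
  rw [uIcc_of_le hab, integrableOn_Icc_iff_integrableOn_Ioo]
  exact integrable_L2 f

/-- The value at the left end of the continuous representative. -/
def repBase (M : H1 a b) : Vec :=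
  (b - a)⁻¹ • ∫ ω in Ioo a b, (profile M ω - ∫ t in a..ω, profileDeriv M t)

/-- The continuous representative of an element of `H¹`. -/
def rep (M : H1 a b) (ω : ℝ) : Vec := repBase M + ∫ t in a..ω, profileDeriv M t

theorem continuousOn_rep (hab : a ≤ b) (M : H1 a b) : ContinuousOn (rep M) (Icc a b) :=
  continuousOn_const.add (continuousOn_primitive hab (derivL2 a b M))

/-- The profile minus the primitive of its derivative has zero weak derivative, so it is a constant;
`repBase` recovers that constant as a mean value. -/
theorem profile_ae_eq_rep (hab : a < b) (M : H1 a b) : profile M =ᵐ[freqMeasure a b] rep M := by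
  have i1 : IntegrableOn (profile M) (Ioo a b) := integrable_L2 (toL2 a b M)
  have i2 : IntegrableOn (profileDeriv M) (Ioo a b) := integrable_L2 (derivL2 a b M)
  have i3 : IntegrableOn (fun ω => ∫ t in a..ω, profileDeriv M t) (Ioo a b) :=
    ((continuousOn_primitive hab.le (derivL2 a b M)).integrableOn_Icc).mono_set Ioo_subset_Icc_self
  obtain ⟨c, hc⟩ := ae_const_of_integral_deriv_test hab (i1.sub i3) (fun φ hφ => by
    have j1 := IsTestFunction.integrable_smul hφ.deriv_compact.1 hφ.deriv_compact.2 i1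
    have j3 := IsTestFunction.integrable_smul hφ.deriv_compact.1 hφ.deriv_compact.2 i3
    simp only [Pi.sub_apply, smul_sub]
    rw [integral_sub j1 j3, integral_deriv_test_smul_primitive hab.le hφ i2,
      isWeakDeriv M φ hφ, sub_self])
  have hb : repBase M = c := by
    have : ∫ ω in Ioo a b, (profile M ω - ∫ t in a..ω, profileDeriv M t) = (b - a) • c := by
      refine (integral_congr_ae hc).trans ?_
      simp [hab.le]
    rw [repBase, this, smul_smul, inv_mul_cancel₀ (by linarith), one_smul]
  filter_upwards [hc] with ω hω
  rw [rep, hb, ← hω, Pi.sub_apply, sub_add_cancel]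

theorem eqOn_Icc_of_ae_eq_Ioo {E : Type*} [TopologicalSpace E] [T2Space E] (hab : a < b)
    {f g : ℝ → E} (h : f =ᵐ[freqMeasure a b] g) (hf : ContinuousOn f (Icc a b))
    (hg : ContinuousOn g (Icc a b)) : EqOn f g (Icc a b) :=
  Measure.eqOn_Icc_of_ae_eq volume hab.ne (by rwa [← restrict_Ioo_eq_restrict_Icc]) hf hg

theorem rep_eq_of_ae (hab : a < b) {M : H1 a b} {f : ℝ → Vec}
    (h : profile M =ᵐ[freqMeasure a b] f) (hf : ContinuousOn f (Icc a b)) :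
    EqOn (rep M) f (Icc a b) :=
  eqOn_Icc_of_ae_eq_Ioo hab ((profile_ae_eq_rep hab M).symm.trans h) (continuousOn_rep hab.le M) hf

/-- Cauchy–Schwarz for the derivative on [y, x]. The modulus depends on M only through its norm, so
bounded families are equicontinuous. -/
theorem norm_rep_sub_le {M : H1 a b} {x y : ℝ} (hx : x ∈ Icc a b) (hy : y ∈ Icc a b) :
    ‖rep M x - rep M y‖ ≤ √|x - y| * ‖M‖ := by
  wlog hxy : y ≤ x generalizing x y
  · rw [norm_sub_rev, abs_sub_comm]
    exact this hy hx (le_of_not_ge hxy)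
  have hab : a ≤ b := hx.1.trans hx.2
  have hi : ∀ z ∈ Icc a b, IntervalIntegrable (profileDeriv M) volume a z := fun z hz =>
    (intervalIntegrable_of_Ioo hab (integrable_L2 (derivL2 a b M))).mono_set
      (by rw [uIcc_of_le hz.1, uIcc_of_le hab]; exact Icc_subset_Icc_right hz.2)
  rw [rep, rep, add_sub_add_left_eq_sub,
    intervalIntegral.integral_interval_sub_left (hi x hx) (hi y hy),
    intervalIntegral.integral_of_le hxy, integral_Ioc_eq_integral_Ioo]
  refine (norm_integral_le_integral_norm _).trans
    ((setIntegral_norm_le (Ioo_subset_Ioo hy.1 hx.2) (derivL2 a b M)).trans ?_)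
  rw [Real.volume_real_Ioo_of_le hxy, abs_of_nonneg (sub_nonneg.2 hxy)]
  exact mul_le_mul_of_nonneg_left (norm_derivL2_le M) (Real.sqrt_nonneg _)

/-- Compare the value at ω with the value at x by the Hölder estimate, then average over x. -/
theorem norm_rep_le (hab : a < b) (M : H1 a b) {ω : ℝ} (hω : ω ∈ Icc a b) :
    ‖rep M ω‖ ≤ (√(b - a) / (b - a) + √(b - a)) * ‖M‖ := by
  have hpos : 0 < b - a := sub_pos.2 hab
  have h1 : ∀ x ∈ Icc a b, ‖rep M ω‖ ≤ ‖rep M x‖ + √(b - a) * ‖M‖ := by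
    intro x hx
    have h2 : ‖rep M ω‖ ≤ ‖rep M x‖ + ‖rep M ω - rep M x‖ := by
      have := norm_add_le (rep M x) (rep M ω - rep M x)
      rwa [add_sub_cancel] at this
    have h3 : √|ω - x| ≤ √(b - a) :=
      Real.sqrt_le_sqrt (abs_le.2 ⟨by linarith [hx.2, hω.1], by linarith [hx.1, hω.2]⟩)
    have h4 := norm_rep_sub_le (M := M) hω hx
    have h5 := mul_le_mul_of_nonneg_right h3 (norm_nonneg M)
    linarith
  have hci : IntegrableOn (fun x => ‖rep M x‖) (Ioo a b) :=
    ((continuousOn_rep hab.le M).norm.integrableOn_Icc).mono_set Ioo_subset_Icc_self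
  have h6 : ∫ _ in Ioo a b, ‖rep M ω‖ ≤ ∫ x in Ioo a b, (‖rep M x‖ + √(b - a) * ‖M‖) :=
    setIntegral_mono_on (by simp) (hci.add (integrable_const _)) measurableSet_Ioo
      (fun x hx => h1 x (Ioo_subset_Icc_self hx))
  have h7 : ∫ x in Ioo a b, ‖rep M x‖ ≤ √(b - a) * ‖M‖ := by
    have e : ∫ x in Ioo a b, ‖rep M x‖ = ∫ x in Ioo a b, ‖profile M x‖ := by
      apply integral_congr_ae
      filter_upwards [profile_ae_eq_rep hab M] with x hx
      rw [hx]
    rw [e]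
    refine (setIntegral_norm_le Subset.rfl (toL2 a b M)).trans ?_
    rw [Real.volume_real_Ioo_of_le hab.le]
    exact mul_le_mul_of_nonneg_left (norm_toL2_le M) (Real.sqrt_nonneg _)
  rw [integral_add hci (integrable_const _), setIntegral_const, setIntegral_const,
    Real.volume_real_Ioo_of_le hab.le, smul_eq_mul, smul_eq_mul] at h6
  have h8 : (b - a) * ‖rep M ω‖ ≤ (b - a) * ((√(b - a) / (b - a) + √(b - a)) * ‖M‖) := by
    have : (b - a) * ((√(b - a) / (b - a) + √(b - a)) * ‖M‖)
        = √(b - a) * ‖M‖ + (b - a) * (√(b - a) * ‖M‖) := by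
      field_simp
    linarith
  exact le_of_mul_le_mul_left h8 hpos

/-- A weak derivative is determined by the function. This turns the a.e. equation for the profiles
into an identity in H¹. -/
theorem ext_profile {M N : H1 a b}
    (h : profile M =ᵐ[freqMeasure a b] profile N) : M = N := by
  have hd : profileDeriv M =ᵐ[freqMeasure a b] profileDeriv N := by
    have hi := (integrable_L2 (derivL2 a b M)).sub (integrable_L2 (derivL2 a b N))
    have key := ae_eq_zero_of_integral_test (h := profileDeriv M - profileDeriv N) hi
      (fun φ hφ => by
        have i1 := integrable_smul_of_L2 hφ.smooth.continuous hφ.compact (derivL2 a b M)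
        have i2 := integrable_smul_of_L2 hφ.smooth.continuous hφ.compact (derivL2 a b N)
        have h1 := ((isWeakDeriv M).congr h (EventuallyEq.refl _ _)) φ hφ
        have h2 := isWeakDeriv N φ hφ
        simp only [Pi.sub_apply, smul_sub]
        refine (integral_sub i1 i2).trans (sub_eq_zero.2 ?_)
        exact neg_injective (h1.symm.trans h2))
    filter_upwards [key] with ω hω
    exact sub_eq_zero.1 hω
  refine Subtype.ext ((WithLp.ext_iff 2).2 (Prod.ext (Lp.ext h) (Lp.ext hd)))

theorem rep_add (hab : a < b) (M N : H1 a b) {ω : ℝ} (hω : ω ∈ Icc a b) :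
    rep (M + N) ω = rep M ω + rep N ω := by
  refine rep_eq_of_ae hab (f := fun ω => rep M ω + rep N ω) ?_
    ((continuousOn_rep hab.le M).add (continuousOn_rep hab.le N)) hω
  filter_upwards [Lp.coeFn_add (toL2 a b M) (toL2 a b N), profile_ae_eq_rep hab M,
    profile_ae_eq_rep hab N] with x h1 h2 h3
  rw [← h2, ← h3]
  exact h1

theorem rep_smul (hab : a < b) (c : ℝ) (M : H1 a b) {ω : ℝ} (hω : ω ∈ Icc a b) :
    rep (c • M) ω = c • rep M ω := by
  refine rep_eq_of_ae hab (f := fun ω => c • rep M ω) ?_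
    ((continuousOn_rep hab.le M).const_smul c) hω
  filter_upwards [Lp.coeFn_smul c (toL2 a b M), profile_ae_eq_rep hab M] with x h1 h2
  rw [← h2]
  exact h1

/-- Evaluation of the continuous representative. -/
def evalH1 (hab : a < b) {ω : ℝ} (hω : ω ∈ Icc a b) : H1 a b →L[ℝ] Vec :=
  LinearMap.mkContinuous
    { toFun := fun M => rep M ω
      map_add' := fun M N => rep_add hab M N hω
      map_smul' := fun c M => rep_smul hab c M hω }
    (√(b - a) / (b - a) + √(b - a)) (fun M => norm_rep_le hab M hω)

theorem evalH1_apply (hab : a < b) {ω : ℝ} (hω : ω ∈ Icc a b) (M : H1 a b) :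
    evalH1 hab hω M = rep M ω := rfl

theorem rep_constProfile (hab : a < b) (c : Vec) {ω : ℝ} (hω : ω ∈ Icc a b) :
    rep (constProfile a b c) ω = c := by
  refine rep_eq_of_ae hab (f := fun _ => c) ?_ continuousOn_const hω
  exact Lp.coeFn_const (p := 2) (μ := freqMeasure a b) (c := c)

theorem ae_hasDerivAt_rep (hab : a < b) (M : H1 a b) :
    ∀ᵐ ω ∂freqMeasure a b, HasDerivAt (rep M) (profileDeriv M ω) ω := by
  rw [ae_restrict_iff' measurableSet_Ioo]
  filter_upwards [ae_deriv_primitive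
    (intervalIntegrable_of_Ioo hab.le (integrable_L2 (derivL2 a b M))) (repBase M)] with ω h hω
  exact h (by rw [uIcc_of_le hab.le]; exact Ioo_subset_Icc_self hω)

end

section

/-! ### Global solutions of differential equations with bounded Lipschitz right-hand side -/

section GlobalSolution

variable {H : Type*} [NormedAddCommGroup H] [NormedSpace ℝ H] [CompleteSpace H]

/-- The bound L confines a solution on [-(n+1), n+1] to a ball of radius L(n+1), so Picard–Lindelöf
applies on the whole interval; the solutions are glued by uniqueness. -/
theorem exists_global_solution {f : ℝ → H → H} {κ L : NNReal} (hf : ∀ t, LipschitzWith κ (f t))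
    (hL : ∀ t x, ‖f t x‖ ≤ L) (hc : ∀ x, Continuous fun t => f t x) (x₀ : H) :
    ∃ α : ℝ → H, α 0 = x₀ ∧ ∀ t, HasDerivAt α (f t (α t)) t := by
  have hn : ∀ n : ℕ, ∃ α : ℝ → H, α 0 = x₀ ∧
      ∀ t ∈ Ioo (-(n + 1 : ℝ)) (n + 1), HasDerivAt α (f t (α t)) t := by
    intro n
    have h0 : (0 : ℝ) ∈ Icc (-(n + 1 : ℝ)) (n + 1) := ⟨by linarith [n.cast_nonneg (α := ℝ)],
      by positivity⟩
    have hp : IsPicardLindelof f (⟨0, h0⟩ : Icc (-(n + 1 : ℝ)) (n + 1)) x₀ (L * (n + 1)) 0 L κ :=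
      { lipschitzOnWith := fun t _ => (hf t).lipschitzOnWith
        continuousOn := fun x _ => (hc x).continuousOn
        norm_le := fun t _ x _ => hL t x
        mul_max_le := by simp }
    obtain ⟨α, h1, h2⟩ := hp.exists_eq_forall_mem_Icc_hasDerivWithinAt₀
    exact ⟨α, h1, fun t ht => (h2 t (Ioo_subset_Icc_self ht)).hasDerivAt (Icc_mem_nhds ht.1 ht.2)⟩
  choose α hα0 hα using hn
  have hagree : ∀ m n : ℕ, m ≤ n → EqOn (α m) (α n) (Ioo (-(m + 1 : ℝ)) (m + 1)) := by
    intro m n hmn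
    have hmn' : (m : ℝ) ≤ n := by exact_mod_cast hmn
    have hm : (0 : ℝ) ≤ m := m.cast_nonneg
    refine ODE_solution_unique_of_mem_Ioo (v := f) (s := fun _ => univ) (K := κ) (t₀ := 0)
      (fun t _ => (hf t).lipschitzOnWith) ⟨by linarith, by linarith⟩
      (fun t ht => ⟨hα m t ht, mem_univ _⟩)
      (fun t ht => ⟨hα n t ⟨by linarith [ht.1], by linarith [ht.2]⟩, mem_univ _⟩) ?_
    rw [hα0, hα0]
  have hmem : ∀ t : ℝ, t ∈ Ioo (-((⌈|t|⌉₊ : ℝ) + 1)) ((⌈|t|⌉₊ : ℝ) + 1) := by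
    intro t
    have h1 := Nat.le_ceil |t|
    have h2 := abs_le.1 h1
    exact ⟨by linarith [h2.1], by linarith [h2.2]⟩
  -- The index changes with t, but all times near t have index at most ⌈|t|⌉ + 1, so near t the
  -- glued curve agrees with a single solution.
  refine ⟨fun t => α ⌈|t|⌉₊ t, by simp [hα0], fun t => ?_⟩
  have hev : (fun t => α ⌈|t|⌉₊ t) =ᶠ[𝓝 t] α (⌈|t|⌉₊ + 1) := by
    have hnear : ∀ᶠ u in 𝓝 t, |u| < |t| + 1 :=
      continuous_abs.continuousAt.eventually_lt continuousAt_const (by linarith)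
    filter_upwards [hnear] with u hu
    refine hagree _ _ (Nat.ceil_le.2 ?_) (hmem u)
    push_cast
    linarith [Nat.le_ceil |t|]
  have hmem' : t ∈ Ioo (-(((⌈|t|⌉₊ + 1 : ℕ) : ℝ) + 1)) (((⌈|t|⌉₊ + 1 : ℕ) : ℝ) + 1) := by
    have := hmem t
    push_cast
    exact ⟨by linarith [this.1], by linarith [this.2]⟩
  have h := (hα (⌈|t|⌉₊ + 1) t hmem').congr_of_eventuallyEq hev
  rwa [← hev.self_of_nhds] at h

end GlobalSolution

/-! ### Truncation -/

section Cutoff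

variable {H : Type*} [NormedAddCommGroup H]

/-- A Lipschitz function equal to `1` on the ball of radius `R` and to `0` outside of the ball of
radius `R + 1`. -/
def cutoff (R : ℝ) (M : H) : ℝ := max 0 (min 1 (R + 1 - ‖M‖))

theorem cutoff_nonneg (R : ℝ) (M : H) : 0 ≤ cutoff R M := le_max_left _ _

theorem cutoff_le_one (R : ℝ) (M : H) : cutoff R M ≤ 1 := max_le zero_le_one (min_le_left _ _)

theorem cutoff_eq_one {R : ℝ} {M : H} (h : ‖M‖ ≤ R) : cutoff R M = 1 := by
  rw [cutoff, min_eq_left (by linarith), max_eq_right zero_le_one]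

theorem cutoff_eq_zero {R : ℝ} {M : H} (h : R + 1 ≤ ‖M‖) : cutoff R M = 0 :=
  max_eq_left ((min_le_right _ _).trans (by linarith))

theorem abs_cutoff_sub_le (R : ℝ) (M N : H) : |cutoff R M - cutoff R N| ≤ ‖M - N‖ := by
  refine (abs_max_sub_max_le_max _ _ _ _).trans (max_le (by simp) ?_)
  refine (abs_min_sub_min_le_max _ _ _ _).trans (max_le (by simp) ?_)
  rw [sub_sub_sub_cancel_left, abs_sub_comm]
  exact abs_norm_sub_norm_le M N

end Cutoff

/-! ### Damping feedbacks -/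

section Damping

variable {H : Type*} [NormedAddCommGroup H] [NormedSpace ℝ H]

/-- The derivative of `M ↦ B(M, M) / 2 + ℓ(M)` in the direction `A M`. -/
def dampingOutput (B : H →L[ℝ] H →L[ℝ] ℝ) (ℓ : H →L[ℝ] ℝ) (A : H →L[ℝ] H) (M : H) : ℝ :=
  B M (A M) + ℓ (A M)

/-- The vector field of the control system `Ṁ = ∑ u_j A_j M` in closed loop with the damping
feedback of gain `K` associated with `M ↦ B(M, M) / 2 + ℓ(M)`. -/
def dampedField (B : H →L[ℝ] H →L[ℝ] ℝ) (ℓ : H →L[ℝ] ℝ) (K : ℝ) (A : Fin 2 → H →L[ℝ] H)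
    (M : H) : H :=
  ∑ j, (-K * dampingOutput B ℓ (A j) M) • A j M

variable (B : H →L[ℝ] H →L[ℝ] ℝ) (ℓ : H →L[ℝ] ℝ) (K : ℝ)

theorem norm_apply_le {A : H →L[ℝ] H} {M : H} {C R : ℝ} (hA : ‖A‖ ≤ C) (hM : ‖M‖ ≤ R) :
    ‖A M‖ ≤ C * R :=
  (A.le_opNorm M).trans (mul_le_mul hA hM (norm_nonneg _) ((norm_nonneg _).trans hA))

theorem norm_apply_sub_le {A A' : H →L[ℝ] H} {M N : H} {C R : ℝ} (hA : ‖A‖ ≤ C) (hN : ‖N‖ ≤ R) :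
    ‖A M - A' N‖ ≤ C * ‖M - N‖ + R * ‖A - A'‖ := by
  have e : A M - A' N = A (M - N) + (A - A') N := by
    rw [map_sub, _root_.sub_apply]; abel
  rw [e]
  refine (norm_add_le _ _).trans (add_le_add (norm_apply_le hA le_rfl) ?_)
  rw [mul_comm]
  exact norm_apply_le le_rfl hN

/-- The output is affine in M for one occurrence and linear in A M, hence bounded and Lipschitz on
bounded sets. The variation in A is included because A moves with time, and Barbalat's lemma needs
outputs that are Lipschitz in time. -/
theorem exists_dampingOutput_bounds {C R : ℝ} (hC : 0 ≤ C) (hR : 0 ≤ R) :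
    ∃ L : ℝ, 0 ≤ L ∧ ∀ (A A' : H →L[ℝ] H) (M N : H), ‖A‖ ≤ C → ‖A'‖ ≤ C → ‖M‖ ≤ R → ‖N‖ ≤ R →
      |dampingOutput B ℓ A M| ≤ L ∧
      |dampingOutput B ℓ A M - dampingOutput B ℓ A' N| ≤ L * (‖M - N‖ + ‖A - A'‖) := by
  have hB := norm_nonneg B
  have hl := norm_nonneg ℓ
  have hBb : ∀ {x y : H} {p q : ℝ}, ‖x‖ ≤ p → ‖y‖ ≤ q → ‖B x y‖ ≤ ‖B‖ * p * q := by
    intro x y p q hx hy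
    refine (B.le_opNorm₂ x y).trans ?_
    have hp := (norm_nonneg _).trans hx
    have hq := (norm_nonneg _).trans hy
    gcongr
  have hlb : ∀ {x : H} {p : ℝ}, ‖x‖ ≤ p → ‖ℓ x‖ ≤ ‖ℓ‖ * p := fun hx =>
    (ℓ.le_opNorm _).trans (mul_le_mul_of_nonneg_left hx hl)
  refine ⟨(‖B‖ * R + ‖ℓ‖) * (C * R) + (‖B‖ * (C * R) + (‖B‖ * R + ‖ℓ‖) * (C + R)),
    by positivity, fun A A' M N hA hA' hM hN => ⟨?_, ?_⟩⟩
  · have h1 := hBb hM (norm_apply_le hA hM)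
    have h2 := hlb (norm_apply_le hA hM)
    have h3 : 0 ≤ ‖B‖ * (C * R) + (‖B‖ * R + ‖ℓ‖) * (C + R) := by positivity
    have h4 := norm_add_le (B M (A M)) (ℓ (A M))
    rw [← Real.norm_eq_abs, dampingOutput]
    linarith
  · have e : dampingOutput B ℓ A M - dampingOutput B ℓ A' N
        = B (M - N) (A M) + (B N (A M - A' N) + ℓ (A M - A' N)) := by
      simp only [dampingOutput, map_sub, _root_.sub_apply]
      ring
    have h1 := hBb (le_refl ‖M - N‖) (norm_apply_le hA hM)
    have h2 := hBb hN (norm_apply_sub_le (A' := A') (M := M) hA hN)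
    have h3 := hlb (norm_apply_sub_le (A' := A') (M := M) hA hN)
    have h4 := norm_add₃_le (a := B (M - N) (A M)) (b := B N (A M - A' N)) (c := ℓ (A M - A' N))
    have hMN := norm_nonneg (M - N)
    have hAA := norm_nonneg (A - A')
    have h5 : 0 ≤ (‖B‖ * R + ‖ℓ‖) * (C * R) * (‖M - N‖ + ‖A - A'‖) := by positivity
    have h6 : 0 ≤ ‖B‖ * (C * R) * ‖A - A'‖ := by positivity
    have h7 : 0 ≤ (‖B‖ * R + ‖ℓ‖) * (R * ‖M - N‖ + C * ‖A - A'‖) := by positivity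
    rw [← Real.norm_eq_abs, e, ← add_assoc]
    nlinarith

theorem exists_dampedField_bounds {C R : ℝ} (hC : 0 ≤ C) (hR : 0 ≤ R) :
    ∃ L : ℝ, 0 ≤ L ∧ ∀ (A A' : Fin 2 → H →L[ℝ] H) (M N : H), ‖A‖ ≤ C → ‖A'‖ ≤ C → ‖M‖ ≤ R →
      ‖N‖ ≤ R → ‖dampedField B ℓ K A M‖ ≤ L ∧
      ‖dampedField B ℓ K A M - dampedField B ℓ K A' N‖ ≤ L * (‖M - N‖ + ‖A - A'‖) := by
  obtain ⟨L, hL, h⟩ := exists_dampingOutput_bounds B ℓ hC hR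
  have hK := abs_nonneg K
  refine ⟨2 * (|K| * L * (C * R) + |K| * L * (C + R)), by positivity,
    fun A A' M N hA hA' hM hN => ⟨?_, ?_⟩⟩
  · have hj : ∀ j, ‖(-K * dampingOutput B ℓ (A j) M) • A j M‖ ≤ |K| * L * (C * R) := by
      intro j
      have hAj := (norm_le_pi_norm A j).trans hA
      have h1 := (h (A j) (A j) M M hAj hAj hM hM).1
      rw [norm_smul, Real.norm_eq_abs, abs_mul, abs_neg]
      exact mul_le_mul (mul_le_mul_of_nonneg_left h1 hK) (norm_apply_le hAj hM) (norm_nonneg _)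
        (by positivity)
    have h2 : 0 ≤ |K| * L * (C + R) := by positivity
    have h3 := norm_add_le ((-K * dampingOutput B ℓ (A 0) M) • A 0 M)
      ((-K * dampingOutput B ℓ (A 1) M) • A 1 M)
    rw [dampedField, Fin.sum_univ_two]
    linarith [hj 0, hj 1]
  · have hj : ∀ j, ‖(-K * dampingOutput B ℓ (A j) M) • A j M
        - (-K * dampingOutput B ℓ (A' j) N) • A' j N‖
          ≤ (|K| * L * (C * R) + |K| * L * (C + R)) * (‖M - N‖ + ‖A - A'‖) := by
      intro j
      have hAj := (norm_le_pi_norm A j).trans hA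
      have hAj' := (norm_le_pi_norm A' j).trans hA'
      have hd : ‖A j - A' j‖ ≤ ‖A - A'‖ := norm_le_pi_norm (A - A') j
      obtain ⟨h0, h2⟩ := h (A j) (A' j) M N hAj hAj' hM hN
      have h1 := (h (A' j) (A' j) N N hAj' hAj' hN hN).1
      have e : (-K * dampingOutput B ℓ (A j) M) • A j M
          - (-K * dampingOutput B ℓ (A' j) N) • A' j N
          = (-K * (dampingOutput B ℓ (A j) M - dampingOutput B ℓ (A' j) N)) • A j M
            + (-K * dampingOutput B ℓ (A' j) N) • (A j M - A' j N) := by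
        module
      have hMN := norm_nonneg (M - N)
      have hAA := norm_nonneg (A - A')
      have h3 : ‖(-K * (dampingOutput B ℓ (A j) M - dampingOutput B ℓ (A' j) N)) • A j M‖
          ≤ |K| * (L * (‖M - N‖ + ‖A - A'‖)) * (C * R) := by
        rw [norm_smul, Real.norm_eq_abs, abs_mul, abs_neg]
        refine mul_le_mul (mul_le_mul_of_nonneg_left (h2.trans ?_) hK) (norm_apply_le hAj hM)
          (norm_nonneg _) (by positivity)
        gcongr
      have h4 : ‖(-K * dampingOutput B ℓ (A' j) N) • (A j M - A' j N)‖
          ≤ |K| * L * (C * ‖M - N‖ + R * ‖A - A'‖) := by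
        rw [norm_smul, Real.norm_eq_abs, abs_mul, abs_neg]
        refine mul_le_mul (mul_le_mul_of_nonneg_left h1 hK) ((norm_apply_sub_le hAj hN).trans ?_)
          (norm_nonneg _) (by positivity)
        gcongr
      have h5 : 0 ≤ |K| * L * (R * ‖M - N‖ + C * ‖A - A'‖) := by positivity
      rw [e]
      refine (norm_add_le _ _).trans ((add_le_add h3 h4).trans ?_)
      nlinarith
    have e : dampedField B ℓ K A M - dampedField B ℓ K A' N
        = ((-K * dampingOutput B ℓ (A 0) M) • A 0 M - (-K * dampingOutput B ℓ (A' 0) N) • A' 0 N)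
        + ((-K * dampingOutput B ℓ (A 1) M) • A 1 M
          - (-K * dampingOutput B ℓ (A' 1) N) • A' 1 N) := by
      rw [dampedField, dampedField, Fin.sum_univ_two, Fin.sum_univ_two]
      abel
    rw [e]
    refine (norm_add_le _ _).trans ((add_le_add (hj 0) (hj 1)).trans_eq ?_)
    ring

/-- F is controlled only on the ball of radius R + 1. With M in that ball, the difference F M - F N
comes multiplied by the cutoff at N, which vanishes when N is outside. -/
theorem exists_cutoff_smul_bounds {F : H → H} {R L : ℝ} (hL : 0 ≤ L)
    (h1 : ∀ M, ‖M‖ ≤ R + 1 → ‖F M‖ ≤ L)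
    (h2 : ∀ M N, ‖M‖ ≤ R + 1 → ‖N‖ ≤ R + 1 → ‖F M - F N‖ ≤ L * ‖M - N‖) :
    (∀ M, ‖cutoff R M • F M‖ ≤ L) ∧
      ∀ M N, ‖cutoff R M • F M - cutoff R N • F N‖ ≤ 2 * L * ‖M - N‖ := by
  constructor
  · intro M
    rcases le_total ‖M‖ (R + 1) with h | h
    · rw [norm_smul, Real.norm_eq_abs, abs_of_nonneg (cutoff_nonneg R M)]
      exact (mul_le_mul (cutoff_le_one R M) (h1 M h) (norm_nonneg _) zero_le_one).trans_eq
        (one_mul L)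
    · rw [cutoff_eq_zero h, zero_smul, norm_zero]
      exact hL
  · have key : ∀ M N, ‖M‖ ≤ R + 1 →
        ‖cutoff R M • F M - cutoff R N • F N‖ ≤ 2 * L * ‖M - N‖ := by
      intro M N hM
      have e : cutoff R M • F M - cutoff R N • F N
          = (cutoff R M - cutoff R N) • F M + cutoff R N • (F M - F N) := by module
      have h3 : ‖(cutoff R M - cutoff R N) • F M‖ ≤ ‖M - N‖ * L := by
        rw [norm_smul, Real.norm_eq_abs]
        exact mul_le_mul (abs_cutoff_sub_le R M N) (h1 M hM) (norm_nonneg _) (norm_nonneg _)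
      have h4 : ‖cutoff R N • (F M - F N)‖ ≤ L * ‖M - N‖ := by
        rcases le_total ‖N‖ (R + 1) with h | h
        · rw [norm_smul, Real.norm_eq_abs, abs_of_nonneg (cutoff_nonneg R N)]
          exact (mul_le_mul (cutoff_le_one R N) (h2 M N hM h) (norm_nonneg _)
            zero_le_one).trans_eq (one_mul _)
        · rw [cutoff_eq_zero h, zero_smul, norm_zero]
          positivity
      rw [e]
      refine (norm_add_le _ _).trans ((add_le_add h3 h4).trans_eq ?_)
      ring
    intro M N
    rcases le_total ‖M‖ (R + 1) with h | h
    · exact key M N h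
    · rcases le_total ‖N‖ (R + 1) with h' | h'
      · rw [norm_sub_rev, norm_sub_rev M]
        exact key N M h'
      · rw [cutoff_eq_zero h, cutoff_eq_zero h', zero_smul, zero_smul, sub_zero, norm_zero]
        positivity

/-- Existence of a global solution of the damped system truncated outside of a ball. -/
theorem exists_truncated_solution [CompleteSpace H] {A : ℝ → Fin 2 → H →L[ℝ] H}
    (hAc : Continuous A) {C R : ℝ} (hC : ∀ t, ‖A t‖ ≤ C) (hR : 0 ≤ R) (M₀ : H) :
    ∃ M : ℝ → H, M 0 = M₀ ∧
      ∀ t, HasDerivAt M (cutoff R (M t) • dampedField B ℓ K (A t) (M t)) t := by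
  have hC0 : 0 ≤ C := (norm_nonneg _).trans (hC 0)
  obtain ⟨L, hL, h⟩ := exists_dampedField_bounds B ℓ K hC0 (show 0 ≤ R + 1 by linarith)
  have hb := fun t => exists_cutoff_smul_bounds (F := dampedField B ℓ K (A t)) (R := R) hL
    (fun M hM => (h (A t) (A t) M M (hC t) (hC t) hM hM).1)
    (fun M N hM hN => by
      simpa using (h (A t) (A t) M N (hC t) (hC t) hM hN).2)
  refine exists_global_solution (f := fun t M => cutoff R M • dampedField B ℓ K (A t) M)
    (κ := ⟨2 * L, by positivity⟩) (L := ⟨L, hL⟩) (fun t => ?_) (fun t x => (hb t).1 x)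
    (fun x => ?_) M₀
  · exact LipschitzWith.of_dist_le_mul fun M N => by
      rw [dist_eq_norm, dist_eq_norm]
      exact (hb t).2 M N
  · refine continuous_const.smul ?_
    have hj : ∀ j, Continuous fun t => A t j := fun j => (continuous_apply j).comp hAc
    refine continuous_finsetSum _ fun j _ => ?_
    have hjx : Continuous fun t => A t j x := (hj j).clm_apply continuous_const
    exact (continuous_const.mul (((B x).continuous.comp hjx).add (ℓ.continuous.comp hjx))).smul hjx

theorem exists_dampingOutput_lipschitz {C R : ℝ} (hC : 0 ≤ C) (hR : 0 ≤ R) :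
    ∃ L : ℝ, 0 ≤ L ∧ ∀ (A : H →L[ℝ] H) (M N : H), ‖A‖ ≤ C → ‖M‖ ≤ R → ‖N‖ ≤ R →
      |dampingOutput B ℓ A M - dampingOutput B ℓ A N| ≤ L * ‖M - N‖ := by
  obtain ⟨L, hL, h⟩ := exists_dampingOutput_bounds B ℓ hC hR
  exact ⟨L, hL, fun A M N hA hM hN => by simpa using (h A A M N hA hA hM hN).2⟩

theorem exists_dampedField_lipschitz {C R : ℝ} (hC : 0 ≤ C) (hR : 0 ≤ R) :
    ∃ L : ℝ, 0 ≤ L ∧ ∀ (A : Fin 2 → H →L[ℝ] H) (M N : H), ‖A‖ ≤ C → ‖M‖ ≤ R → ‖N‖ ≤ R →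
      ‖dampedField B ℓ K A M - dampedField B ℓ K A N‖ ≤ L * ‖M - N‖ := by
  obtain ⟨L, hL, h⟩ := exists_dampedField_bounds B ℓ K hC hR
  exact ⟨L, hL, fun A M N hA hM hN => by simpa using (h A A M N hA hA hM hN).2⟩

/-- By symmetry of B, the energy varies along A_j M at the rate `dampingOutput`, and the control is
-K times that rate. The factor c allows for the truncation. -/
theorem hasDerivAt_energy {B : H →L[ℝ] H →L[ℝ] ℝ} (hB : ∀ M N, B M N = B N M) {M : ℝ → H}
    {A : Fin 2 → H →L[ℝ] H} {t c : ℝ}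
    (hM : HasDerivAt M (c • dampedField B ℓ K A (M t)) t) :
    HasDerivAt (fun t => 2⁻¹ * B (M t) (M t) + ℓ (M t))
      (-(c * K * ∑ j, dampingOutput B ℓ (A j) (M t) ^ 2)) t := by
  have h1 := ((B.hasFDerivAt (x := M t)).comp_hasDerivAt t hM).clm_apply hM
  have h2 := (ℓ.hasFDerivAt (x := M t)).comp_hasDerivAt t hM
  refine ((h1.const_mul 2⁻¹).add h2).congr_deriv ?_
  rw [hB (c • dampedField B ℓ K A (M t)) (M t)]
  simp only [dampedField, map_smul, Fin.sum_univ_two, map_add, smul_eq_mul,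
    Function.comp_apply, dampingOutput]
  ring

/-- Barbalat's lemma for a dissipation rate. -/
theorem tendsto_zero_of_dissipation {e f : ℝ → ℝ} {Λ c : ℝ}
    (he : ∀ t, 0 ≤ t → HasDerivAt e (-f t) t) (hf : ∀ t, 0 ≤ t → 0 ≤ f t)
    (hlip : ∀ s t, 0 ≤ s → 0 ≤ t → |f s - f t| ≤ Λ * |s - t|) (hc : ∀ t, 0 ≤ t → c ≤ e t) :
    Tendsto f atTop (𝓝 0) := by
  have hanti : AntitoneOn e (Ici 0) := by
    refine antitoneOn_of_deriv_nonpos (convex_Ici 0)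
      (fun t ht => (he t ht).continuousAt.continuousWithinAt)
      (fun t ht => (he t (interior_subset ht)).differentiableAt.differentiableWithinAt)
      (fun t ht => ?_)
    rw [(he t (interior_subset ht)).deriv]
    linarith [hf t (interior_subset ht)]
  have hlim : ∃ l, Tendsto e atTop (𝓝 l) := by
    -- Monotonicity is known only for nonnegative times; freezing e before 0 makes it global.
    have hanti' : Antitone fun t => e (max t 0) := fun s t hst =>
      hanti (mem_Ici.2 (le_max_right _ _)) (mem_Ici.2 (le_max_right _ _)) (max_le_max_right 0 hst)
    refine ⟨_, (tendsto_atTop_ciInf hanti' ⟨c, ?_⟩).congr' ?_⟩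
    · rintro _ ⟨t, rfl⟩
      exact hc _ (le_max_right _ _)
    · filter_upwards [eventually_ge_atTop 0] with t ht
      rw [max_eq_left ht]
  obtain ⟨l, hl⟩ := hlim
  rw [Metric.tendsto_atTop]
  intro ε hε
  set Λ' := |Λ| + 1 with hΛ'
  have hΛ : 0 < Λ' := by positivity
  -- On a time δ the rate f changes by at most ε/2. If f(t) ≥ ε, then e loses at least εδ/2 on [t, t
  -- + δ], which convergence of e forbids for large t.
  set δ := ε / (2 * Λ') with hδ
  have hδ0 : 0 < δ := by positivity
  have hdiff : Tendsto (fun t => e t - e (t + δ)) atTop (𝓝 0) := by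
    have := hl.sub (hl.comp (tendsto_atTop_add_const_right atTop δ tendsto_id))
    simpa using this
  obtain ⟨N, hN⟩ := eventually_atTop.1 ((hdiff.eventually (gt_mem_nhds
    (show 0 < ε / 2 * δ by positivity))).and (eventually_ge_atTop 0))
  refine ⟨N, fun t ht => ?_⟩
  obtain ⟨h1, ht0⟩ := hN t ht
  rw [Real.dist_eq, sub_zero, abs_of_nonneg (hf t ht0)]
  by_contra hcon
  push Not at hcon
  have hlow : ∀ s ∈ Icc t (t + δ), ε / 2 ≤ f s := by
    intro s hs
    have h2 := hlip t s ht0 (ht0.trans hs.1)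
    have h3 : Λ * |t - s| ≤ Λ' * δ := by
      have h4 : |t - s| ≤ δ := by
        rw [abs_sub_comm, abs_of_nonneg (sub_nonneg.2 hs.1)]
        linarith [hs.2]
      have h5 : Λ ≤ Λ' := by linarith [le_abs_self Λ]
      exact mul_le_mul h5 h4 (abs_nonneg _) hΛ.le
    have h6 : Λ' * δ = ε / 2 := by
      rw [hδ]
      field_simp
    linarith [le_abs_self (f t - f s)]
  obtain ⟨s, hs, hs'⟩ := exists_hasDerivAt_eq_slope e (fun s => -f s)
    (show t < t + δ by linarith)
    (fun s hs => (he s (ht0.trans hs.1)).continuousAt.continuousWithinAt)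
    (fun s hs => he s (ht0.trans hs.1.le))
  have h7 := hlow s (Ioo_subset_Icc_self hs)
  rw [add_sub_cancel_left, eq_div_iff hδ0.ne'] at hs'
  nlinarith

end Damping

end

section

/-! ### The sign of the impulse train and its primitive -/

section Switch

variable {T : ℝ}

theorem abs_switchSign (T t : ℝ) : |switchSign T t| = 1 := by
  rw [switchSign, abs_zpow, abs_neg, abs_one, one_zpow]

theorem switchSign_intervalIntegrable (T x y : ℝ) :
    IntervalIntegrable (switchSign T) volume x y := by
  have hm : Measurable (switchSign T) :=
    (measurable_from_top (f := fun n : ℤ => (-1 : ℝ) ^ n)).comp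
      (Int.measurable_floor.comp (measurable_id.div_const T))
  refine (intervalIntegrable_const (c := (1 : ℝ))).mono_fun hm.aestronglyMeasurable ?_
  exact Eventually.of_forall fun t => by simp [abs_switchSign]

theorem abs_switchPrim_sub_le (T s t : ℝ) : |switchPrim T s - switchPrim T t| ≤ |s - t| := by
  rw [switchPrim, switchPrim, intervalIntegral.integral_interval_sub_left
    (switchSign_intervalIntegrable T _ _) (switchSign_intervalIntegrable T _ _),
    ← Real.norm_eq_abs]
  refine (intervalIntegral.norm_integral_le_of_norm_le_const (C := 1) fun x _ => ?_).trans_eq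
    (one_mul _)
  rw [Real.norm_eq_abs, abs_switchSign]

/-- First slope of the triangle wave. The sign has the wrong value at the right end of [0, T], hence
the passage to open intervals in the integrals. -/
theorem switchPrim_of_mem_left (hT : 0 < T) {t : ℝ} (ht : t ∈ Icc 0 T) : switchPrim T t = t := by
  have h : switchPrim T t = ∫ _ in (0 : ℝ)..t, (1 : ℝ) := by
    rw [switchPrim, intervalIntegral.integral_of_le ht.1, intervalIntegral.integral_of_le ht.1,
      integral_Ioc_eq_integral_Ioo, integral_Ioc_eq_integral_Ioo]
    refine setIntegral_congr_fun measurableSet_Ioo fun x hx => ?_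
    have : ⌊x / T⌋ = 0 := by
      rw [Int.floor_eq_zero_iff, mem_Ico, div_lt_one hT]
      exact ⟨div_nonneg hx.1.le hT.le, hx.2.trans_le ht.2⟩
    simp only [switchSign, this, zpow_zero]
  rw [h]
  simp

theorem switchPrim_of_mem_right (hT : 0 < T) {t : ℝ} (ht : t ∈ Icc T (2 * T)) :
    switchPrim T t = 2 * T - t := by
  have h : ∫ x in T..t, switchSign T x = ∫ _ in T..t, (-1 : ℝ) := by
    rw [intervalIntegral.integral_of_le ht.1, intervalIntegral.integral_of_le ht.1,
      integral_Ioc_eq_integral_Ioo, integral_Ioc_eq_integral_Ioo]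
    refine setIntegral_congr_fun measurableSet_Ioo fun x hx => ?_
    have : ⌊x / T⌋ = 1 := by
      rw [Int.floor_eq_iff, le_div_iff₀ hT, div_lt_iff₀ hT]
      constructor
      · push_cast
        linarith [hx.1]
      · push_cast
        linarith [hx.2, ht.2]
    simp only [switchSign, this, zpow_one]
  have h1 := switchPrim_of_mem_left hT (t := T) ⟨hT.le, le_rfl⟩
  have h2 := intervalIntegral.integral_add_adjacent_intervals
    (switchSign_intervalIntegrable T 0 T) (switchSign_intervalIntegrable T T t)
  rw [switchPrim] at h1 ⊢
  rw [← h2, h1, h]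
  simp
  ring

/-- The sign is 2T-periodic and its integral over a period is zero. -/
theorem switchPrim_periodic (hT : 0 < T) : Function.Periodic (switchPrim T) (2 * T) := by
  have hp : Function.Periodic (switchSign T) (2 * T) := by
    intro t
    have : (t + 2 * T) / T = t / T + 2 := by field_simp
    rw [switchSign, this, switchSign]
    have h2 : ⌊t / T + 2⌋ = ⌊t / T⌋ + 2 := by
      exact_mod_cast Int.floor_add_intCast (t / T) 2
    rw [h2, zpow_add₀ (by norm_num)]
    norm_num
  intro t
  have h1 := intervalIntegral.integral_add_adjacent_intervals
    (switchSign_intervalIntegrable T 0 t) (switchSign_intervalIntegrable T t (t + 2 * T))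
  have h2 := hp.intervalIntegral_add_eq t 0
  have h3 := switchPrim_of_mem_right hT (t := 2 * T) ⟨by linarith, le_rfl⟩
  rw [switchPrim, sub_self] at h3
  rw [zero_add] at h2
  rw [switchPrim, ← h1, h2, h3, add_zero, switchPrim]

theorem switchPrim_mem_Icc (hT : 0 < T) (t : ℝ) : switchPrim T t ∈ Icc 0 T := by
  obtain ⟨u, hu, he⟩ := (switchPrim_periodic hT).exists_mem_Ico₀ (by linarith) t
  rw [he]
  rcases le_total u T with h | h
  · rw [switchPrim_of_mem_left hT ⟨hu.1, h⟩]
    exact ⟨hu.1, h⟩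
  · rw [switchPrim_of_mem_right hT ⟨h, hu.2.le⟩]
    exact ⟨by linarith [hu.2], by linarith⟩

/-- A translate of s by a suitable multiple of 2T; rounding t up to such a multiple costs at most
2T, and adding s costs at most T. -/
theorem exists_switchPrim_eq (hT : 0 < T) {s : ℝ} (hs : s ∈ Icc 0 T) (t : ℝ) :
    ∃ u, t ≤ u ∧ u ≤ t + 3 * T ∧ switchPrim T u = s := by
  have h2 : 0 < 2 * T := by linarith
  refine ⟨s + ⌈t / (2 * T)⌉ * (2 * T), ?_, ?_, ?_⟩
  · have := (div_le_iff₀ h2).1 (Int.le_ceil (t / (2 * T)))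
    linarith [hs.1]
  · have h3 : (⌈t / (2 * T)⌉ : ℝ) ≤ t / (2 * T) + 1 := (Int.ceil_lt_add_one _).le
    have h4 := mul_le_mul_of_nonneg_right h3 h2.le
    rw [add_mul, div_mul_cancel₀ _ h2.ne'] at h4
    linarith [hs.2]
  · rw [(switchPrim_periodic hT).int_mul ⌈t / (2 * T)⌉ s, switchPrim_of_mem_left hT hs]

end Switch

/-! ### The control operators -/

variable {a b : ℝ}

/-- The infinitesimal rotation `(x, y, z) ↦ (z, 0, -x)`. -/
def rotX : Vec →L[ℝ] Vec :=
  LinearMap.toContinuousLinearMap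
    { toFun := fun m => !₂[m 2, 0, -m 0]
      map_add' := fun m n => by
        ext i
        fin_cases i <;> simp [add_comm]
      map_smul' := fun c m => by
        ext i
        fin_cases i <;> simp }

/-- The infinitesimal rotation `(x, y, z) ↦ (0, z, -y)`. -/
def rotY : Vec →L[ℝ] Vec :=
  LinearMap.toContinuousLinearMap
    { toFun := fun m => !₂[0, m 2, -m 1]
      map_add' := fun m n => by
        ext i
        fin_cases i <;> simp [add_comm]
      map_smul' := fun c m => by
        ext i
        fin_cases i <;> simp }

theorem rotX_apply (m : Vec) : rotX m = !₂[m 2, 0, -m 0] := rfl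

theorem rotY_apply (m : Vec) : rotY m = !₂[0, m 2, -m 1] := rfl

/-- The value at frequency `ω` of the driftless vector fields with controls `1` and `i`. -/
def ctrlField (j : Fin 2) (s ω : ℝ) (m : Vec) : Vec :=
  ![Real.cos (s * ω) • rotX m - Real.sin (s * ω) • rotY m,
    Real.sin (s * ω) • rotX m + Real.cos (s * ω) • rotY m] j

/-- The fields are infinitesimal rotations. Used twice: it preserves the sphere, and it removes from
the outputs the term quadratic in M'. -/
theorem inner_ctrlField (j : Fin 2) (s ω : ℝ) (m : Vec) : inner ℝ m (ctrlField j s ω m) = 0 := by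
  fin_cases j <;>
    simp [ctrlField, rotX_apply, rotY_apply, PiLp.inner_apply, Fin.sum_univ_three] <;> ring

theorem driftlessField_eq (u : Fin 2 → ℝ) (s ω : ℝ) (m : Vec) :
    driftlessField ((u 0 : ℂ) + (u 1 : ℂ) * Complex.I) s ω m
      = u 0 • ctrlField 0 s ω m + u 1 • ctrlField 1 s ω m := by
  have he : Complex.exp (-Complex.I * (ω : ℂ) * (s : ℂ))
      = (Real.cos (s * ω) : ℂ) - (Real.sin (s * ω) : ℂ) * Complex.I := by
    have : -Complex.I * (ω : ℂ) * (s : ℂ) = ((-(s * ω) : ℝ) : ℂ) * Complex.I := by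
      push_cast; ring
    rw [this, Complex.exp_mul_I, ← Complex.ofReal_cos, ← Complex.ofReal_sin, Real.cos_neg,
      Real.sin_neg]
    push_cast
    ring
  rw [driftlessField, he]
  simp only [ctrlField, rotX_apply, rotY_apply, transverse]
  generalize Real.cos (s * ω) = c
  generalize Real.sin (s * ω) = d
  ext i
  fin_cases i <;>
    simp [Complex.mul_re, Complex.mul_im] <;> ring

theorem contDiff_cos_mul (s : ℝ) : ContDiff ℝ (⊤ : ℕ∞) fun ω => Real.cos (s * ω) :=
  Real.contDiff_cos.comp (contDiff_const.mul contDiff_id)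

theorem contDiff_sin_mul (s : ℝ) : ContDiff ℝ (⊤ : ℕ∞) fun ω => Real.sin (s * ω) :=
  Real.contDiff_sin.comp (contDiff_const.mul contDiff_id)

theorem deriv_cos_mul (s ω : ℝ) :
    deriv (fun ω => Real.cos (s * ω)) ω = -(s * Real.sin (s * ω)) := by
  have h := ((hasDerivAt_id ω).const_mul s).cos
  simp only [id] at h
  rw [h.deriv]
  ring

theorem deriv_sin_mul (s ω : ℝ) :
    deriv (fun ω => Real.sin (s * ω)) ω = s * Real.cos (s * ω) := by
  have h := ((hasDerivAt_id ω).const_mul s).sin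
  simp only [id] at h
  rw [h.deriv]
  ring

section RotatedPair

variable {H : Type*} [NormedAddCommGroup H] [NormedSpace ℝ H]

/-- The pair of operators `(P X - Q Y, Q X + P Y)`. -/
def rotatedPair (P Q X Y : H →L[ℝ] H) : Fin 2 → H →L[ℝ] H :=
  ![P.comp X - Q.comp Y, Q.comp X + P.comp Y]

theorem rotatedPair_sub (P Q P' Q' X Y : H →L[ℝ] H) :
    rotatedPair P Q X Y - rotatedPair P' Q' X Y = rotatedPair (P - P') (Q - Q') X Y := by
  simp only [rotatedPair, Matrix.sub_cons, Matrix.head_cons, Matrix.tail_cons,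
    Matrix.empty_sub_empty, ContinuousLinearMap.sub_comp, sub_sub_sub_comm, add_sub_add_comm]

theorem norm_rotatedPair_le {P Q X Y : H →L[ℝ] H} {c : ℝ} (hP : ‖P‖ ≤ c) (hQ : ‖Q‖ ≤ c) :
    ‖rotatedPair P Q X Y‖ ≤ c * (‖X‖ + ‖Y‖) := by
  have hc : 0 ≤ c := (norm_nonneg _).trans hP
  have key : ∀ {Z W : H →L[ℝ] H}, ‖Z‖ ≤ c → ‖Z.comp W‖ ≤ c * ‖W‖ := fun hZ =>
    (ContinuousLinearMap.opNorm_comp_le _ _).trans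
      (mul_le_mul_of_nonneg_right hZ (norm_nonneg _))
  have hX := norm_nonneg X
  have hY := norm_nonneg Y
  refine (pi_norm_le_iff_of_nonneg (by positivity)).2 fun j => ?_
  fin_cases j
  · exact (norm_sub_le (P.comp X) (Q.comp Y)).trans
      ((add_le_add (key hP) (key hQ)).trans_eq (by ring))
  · exact (norm_add_le (Q.comp X) (P.comp Y)).trans
      ((add_le_add (key hQ) (key hP)).trans_eq (by ring))

end RotatedPair

/-- The operators on `H¹` of the driftless system with controls `1` and `i`. -/
def ctrlOp (a b s : ℝ) : Fin 2 → H1 a b →L[ℝ] H1 a b :=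
  rotatedPair (mulH1 a b (contDiff_cos_mul s)) (mulH1 a b (contDiff_sin_mul s))
    (constH1 a b rotX) (constH1 a b rotY)

theorem profile_add (M N : H1 a b) :
    profile (M + N) =ᵐ[freqMeasure a b] fun ω => profile M ω + profile N ω :=
  Lp.coeFn_add (toL2 a b M) (toL2 a b N)

theorem profile_sub (M N : H1 a b) :
    profile (M - N) =ᵐ[freqMeasure a b] fun ω => profile M ω - profile N ω :=
  Lp.coeFn_sub (toL2 a b M) (toL2 a b N)

theorem profile_smul (c : ℝ) (M : H1 a b) :
    profile (c • M) =ᵐ[freqMeasure a b] fun ω => c • profile M ω :=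
  Lp.coeFn_smul c (toL2 a b M)

theorem profileDeriv_add (M N : H1 a b) :
    profileDeriv (M + N) =ᵐ[freqMeasure a b] fun ω => profileDeriv M ω + profileDeriv N ω :=
  Lp.coeFn_add (derivL2 a b M) (derivL2 a b N)

theorem profileDeriv_sub (M N : H1 a b) :
    profileDeriv (M - N) =ᵐ[freqMeasure a b] fun ω => profileDeriv M ω - profileDeriv N ω :=
  Lp.coeFn_sub (derivL2 a b M) (derivL2 a b N)

theorem profile_ctrlOp (s : ℝ) (j : Fin 2) (M : H1 a b) :
    profile (ctrlOp a b s j M) =ᵐ[freqMeasure a b] fun ω => ctrlField j s ω (profile M ω) := by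
  fin_cases j
  · refine (profile_sub _ _).trans ?_
    filter_upwards [profile_mulH1 (contDiff_cos_mul s) (constH1 a b rotX M),
      profile_mulH1 (contDiff_sin_mul s) (constH1 a b rotY M), profile_constH1 rotX M,
      profile_constH1 rotY M] with ω h1 h2 h3 h4
    refine (congrArg₂ (· - ·) h1 h2).trans ?_
    rw [h3, h4]
    rfl
  · refine (profile_add _ _).trans ?_
    filter_upwards [profile_mulH1 (contDiff_sin_mul s) (constH1 a b rotX M),
      profile_mulH1 (contDiff_cos_mul s) (constH1 a b rotY M), profile_constH1 rotX M,
      profile_constH1 rotY M] with ω h1 h2 h3 h4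
    refine (congrArg₂ (· + ·) h1 h2).trans ?_
    rw [h3, h4]
    rfl

/-- The derivative of `ctrlField` with respect to `ω` at fixed `m`. -/
def ctrlFieldDeriv (j : Fin 2) (s ω : ℝ) (m : Vec) : Vec :=
  ![-(s * Real.sin (s * ω)) • rotX m - (s * Real.cos (s * ω)) • rotY m,
    (s * Real.cos (s * ω)) • rotX m + (-(s * Real.sin (s * ω))) • rotY m] j

theorem profileDeriv_ctrlOp (s : ℝ) (j : Fin 2) (M : H1 a b) :
    profileDeriv (ctrlOp a b s j M) =ᵐ[freqMeasure a b] fun ω =>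
      ctrlField j s ω (profileDeriv M ω) + ctrlFieldDeriv j s ω (profile M ω) := by
  fin_cases j
  · refine (profileDeriv_sub _ _).trans ?_
    filter_upwards [profileDeriv_mulH1 (contDiff_cos_mul s) (constH1 a b rotX M),
      profileDeriv_mulH1 (contDiff_sin_mul s) (constH1 a b rotY M), profile_constH1 rotX M,
      profile_constH1 rotY M, profileDeriv_constH1 rotX M, profileDeriv_constH1 rotY M]
      with ω h1 h2 h3 h4 h5 h6
    refine (congrArg₂ (· - ·) h1 h2).trans ?_
    simp only [h3, h4, h5, h6, deriv_cos_mul, deriv_sin_mul]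
    exact add_sub_add_comm _ _ _ _
  · refine (profileDeriv_add _ _).trans ?_
    filter_upwards [profileDeriv_mulH1 (contDiff_sin_mul s) (constH1 a b rotX M),
      profileDeriv_mulH1 (contDiff_cos_mul s) (constH1 a b rotY M), profile_constH1 rotX M,
      profile_constH1 rotY M, profileDeriv_constH1 rotX M, profileDeriv_constH1 rotY M]
      with ω h1 h2 h3 h4 h5 h6
    refine (congrArg₂ (· + ·) h1 h2).trans ?_
    simp only [h3, h4, h5, h6, deriv_cos_mul, deriv_sin_mul]
    exact add_add_add_comm _ _ _ _

theorem abs_cos_mul_sub_le {W : ℝ} {ω : ℝ} (hω : |ω| ≤ W) (s s' : ℝ) :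
    |Real.cos (s * ω) - Real.cos (s' * ω)| ≤ W * |s - s'| := by
  have h := Real.lipschitzWith_cos.dist_le_mul (s * ω) (s' * ω)
  rw [Real.dist_eq, Real.dist_eq, NNReal.coe_one, one_mul, ← sub_mul, abs_mul] at h
  exact h.trans ((mul_le_mul_of_nonneg_left hω (abs_nonneg _)).trans_eq (mul_comm _ _))

theorem abs_sin_mul_sub_le {W : ℝ} {ω : ℝ} (hω : |ω| ≤ W) (s s' : ℝ) :
    |Real.sin (s * ω) - Real.sin (s' * ω)| ≤ W * |s - s'| := by
  have h := Real.lipschitzWith_sin.dist_le_mul (s * ω) (s' * ω)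
  rw [Real.dist_eq, Real.dist_eq, NNReal.coe_one, one_mul, ← sub_mul, abs_mul] at h
  exact h.trans ((mul_le_mul_of_nonneg_left hω (abs_nonneg _)).trans_eq (mul_comm _ _))

theorem abs_mul_sub_mul_le {s s' p p' D S : ℝ} (hp : |p| ≤ 1) (hs : |s'| ≤ S)
    (hD : |p - p'| ≤ D * |s - s'|) : |s * p - s' * p'| ≤ (1 + S * D) * |s - s'| := by
  have e : s * p - s' * p' = (s - s') * p + s' * (p - p') := by ring
  rw [e]
  refine (abs_add_le _ _).trans ?_
  rw [abs_mul, abs_mul]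
  have h1 := mul_le_mul_of_nonneg_left hp (abs_nonneg (s - s'))
  have h2 := mul_le_mul hs hD (abs_nonneg _) ((abs_nonneg _).trans hs)
  linarith

theorem exists_trig_op_bounds (a b T : ℝ) (hT : 0 ≤ T) :
    ∃ C : ℝ, 0 ≤ C ∧
      (∀ s ∈ Icc 0 T, ‖mulH1 a b (contDiff_cos_mul s)‖ ≤ C ∧
        ‖mulH1 a b (contDiff_sin_mul s)‖ ≤ C) ∧
      ∀ s ∈ Icc 0 T, ∀ s' ∈ Icc 0 T,
        ‖mulH1 a b (contDiff_cos_mul s) - mulH1 a b (contDiff_cos_mul s')‖ ≤ C * |s - s'| ∧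
        ‖mulH1 a b (contDiff_sin_mul s) - mulH1 a b (contDiff_sin_mul s')‖ ≤ C * |s - s'| := by
  set W := max |a| |b| with hW
  have hWω : ∀ ω ∈ Ioo a b, |ω| ≤ W := fun ω hω => abs_le_max_abs_abs hω.1.le hω.2.le
  have hW0 : 0 ≤ W := (abs_nonneg a).trans (le_max_left _ _)
  -- Both summands come from the bound 2B + B' of `norm_mulH1_le`: with B = 1, B' = T for the norms,
  -- and with B = W, B' = 1 + TW, up to the factor |s - s'|, for the differences.
  refine ⟨(2 + T) + (2 * W + (1 + T * W)), by positivity, fun s hs => ?_, fun s hs s' hs' => ?_⟩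
  · have h1 : ∀ x, |Real.sin x| ≤ 1 := Real.abs_sin_le_one
    have h2 : ∀ x, |Real.cos x| ≤ 1 := Real.abs_cos_le_one
    have hsa : |s| ≤ T := by rw [abs_of_nonneg hs.1]; exact hs.2
    have h3 : 0 ≤ 2 * W + (1 + T * W) := by positivity
    constructor
    · refine (norm_mulH1_le (contDiff_cos_mul s) (B := 1) (B' := T) (fun ω _ => h2 _)
        (fun ω _ => ?_) zero_le_one hT).trans (by linarith)
      rw [deriv_cos_mul, abs_neg, abs_mul]
      exact (mul_le_mul hsa (h1 _) (abs_nonneg _) hT).trans_eq (mul_one T)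
    · refine (norm_mulH1_le (contDiff_sin_mul s) (B := 1) (B' := T) (fun ω _ => h1 _)
        (fun ω _ => ?_) zero_le_one hT).trans (by linarith)
      rw [deriv_sin_mul, abs_mul]
      exact (mul_le_mul hsa (h2 _) (abs_nonneg _) hT).trans_eq (mul_one T)
  · have hsa : |s'| ≤ T := by rw [abs_of_nonneg hs'.1]; exact hs'.2
    have h3 : 0 ≤ (2 + T) * |s - s'| := by positivity
    rw [mulH1_sub, mulH1_sub]
    constructor
    · refine (norm_mulH1_le _ (B := W * |s - s'|) (B' := (1 + T * W) * |s - s'|)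
        (fun ω hω => abs_cos_mul_sub_le (hWω ω hω) s s') (fun ω hω => ?_) (by positivity)
        (by positivity)).trans (by linarith)
      rw [deriv_fun_sub ((contDiff_cos_mul s).differentiable (by simp) ω)
        ((contDiff_cos_mul s').differentiable (by simp) ω), deriv_cos_mul, deriv_cos_mul,
        neg_sub_neg, abs_sub_comm]
      exact abs_mul_sub_mul_le (Real.abs_sin_le_one _) hsa (abs_sin_mul_sub_le (hWω ω hω) s s')
    · refine (norm_mulH1_le _ (B := W * |s - s'|) (B' := (1 + T * W) * |s - s'|)
        (fun ω hω => abs_sin_mul_sub_le (hWω ω hω) s s') (fun ω hω => ?_) (by positivity)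
        (by positivity)).trans (by linarith)
      rw [deriv_fun_sub ((contDiff_sin_mul s).differentiable (by simp) ω)
        ((contDiff_sin_mul s').differentiable (by simp) ω), deriv_sin_mul, deriv_sin_mul]
      exact abs_mul_sub_mul_le (Real.abs_cos_le_one _) hsa (abs_cos_mul_sub_le (hWω ω hω) s s')

/-- Operator-norm continuity in s holds because the frequencies are bounded; it makes the
closed-loop field continuous in time. -/
theorem exists_ctrlOp_bounds (a b T : ℝ) (hT : 0 ≤ T) :
    ∃ C : ℝ, 0 ≤ C ∧ (∀ s ∈ Icc 0 T, ‖ctrlOp a b s‖ ≤ C) ∧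
      ∀ s ∈ Icc 0 T, ∀ s' ∈ Icc 0 T, ‖ctrlOp a b s - ctrlOp a b s'‖ ≤ C * |s - s'| := by
  obtain ⟨C, hC, h1, h2⟩ := exists_trig_op_bounds a b T hT
  refine ⟨C * (‖constH1 a b rotX‖ + ‖constH1 a b rotY‖), by positivity,
    fun s hs => norm_rotatedPair_le (h1 s hs).1 (h1 s hs).2, fun s hs s' hs' => ?_⟩
  rw [ctrlOp, ctrlOp, rotatedPair_sub]
  refine (norm_rotatedPair_le (h2 s hs s' hs').1 (h2 s hs s' hs').2).trans_eq ?_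
  ring

theorem rep_ctrlOp (hab : a < b) (s : ℝ) (j : Fin 2) (M : H1 a b) {ω : ℝ} (hω : ω ∈ Icc a b) :
    rep (ctrlOp a b s j M) ω = ctrlField j s ω (rep M ω) := by
  refine rep_eq_of_ae hab (f := fun ω => ctrlField j s ω (rep M ω)) ?_ ?_ hω
  · filter_upwards [profile_ctrlOp s j M, profile_ae_eq_rep hab M] with x h1 h2
    rw [h1, h2]
  · have hx := rotX.continuous.comp_continuousOn (continuousOn_rep hab.le M)
    have hy := rotY.continuous.comp_continuousOn (continuousOn_rep hab.le M)
    have hc := (contDiff_cos_mul s).continuous.continuousOn (s := Icc a b)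
    have hs := (contDiff_sin_mul s).continuous.continuousOn (s := Icc a b)
    fin_cases j
    · exact (hc.smul hx).sub (hs.smul hy)
    · exact (hs.smul hx).add (hc.smul hy)

end

section

variable {a b : ℝ}

/-! ### The energy and the feedback law -/

/-- The bilinear form `∫ M' · N'`. -/
def dirichletForm (a b : ℝ) : H1 a b →L[ℝ] H1 a b →L[ℝ] ℝ :=
  LinearMap.mkContinuous₂
    (LinearMap.mk₂ ℝ (fun M N => inner ℝ (derivL2 a b M) (derivL2 a b N))
      (fun M M' N => by rw [map_add, inner_add_left])
      (fun c M N => by rw [map_smul, real_inner_smul_left, smul_eq_mul])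
      (fun M N N' => by rw [map_add, inner_add_right])
      (fun c M N => by rw [map_smul, real_inner_smul_right, smul_eq_mul])) 1
    (fun M N => by
      rw [one_mul]
      exact (norm_inner_le_norm _ _).trans (mul_le_mul (norm_derivL2_le M) (norm_derivL2_le N)
        (norm_nonneg _) (norm_nonneg _)))

theorem dirichletForm_apply (M N : H1 a b) :
    dirichletForm a b M N = inner ℝ (derivL2 a b M) (derivL2 a b N) := rfl

theorem dirichletForm_comm (M N : H1 a b) : dirichletForm a b M N = dirichletForm a b N M :=
  (real_inner_comm (derivL2 a b N) (derivL2 a b M) :)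

/-- The linear form `G ∫ z`. -/
def heightForm (a b G : ℝ) : H1 a b →L[ℝ] ℝ :=
  G • ((EuclideanSpace.proj (𝕜 := ℝ) (2 : Fin 3)).comp ((intL2 a b).comp (toL2 a b)))

theorem integrable_profile_apply (M : H1 a b) (i : Fin 3) :
    Integrable (fun ω => profile M ω i) (freqMeasure a b) :=
  (EuclideanSpace.proj (𝕜 := ℝ) i).integrable_comp (integrable_L2 (toL2 a b M))

theorem heightForm_apply (G : ℝ) (M : H1 a b) :
    heightForm a b G M = ∫ ω in Ioo a b, G * profile M ω 2 := by
  rw [integral_const_mul]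
  exact congrArg (G * ·) ((EuclideanSpace.proj (𝕜 := ℝ) (2 : Fin 3)).integral_comp_comm
    (integrable_L2 (toL2 a b M))).symm

/-- The closed-loop outputs of the control system for the energy `∫ |M'|² / 2 + G ∫ z`. -/
def ctrlOutput (G s : ℝ) (j : Fin 2) (M : H1 a b) : ℝ :=
  dampingOutput (dirichletForm a b) (heightForm a b G) (ctrlOp a b s j) M

/-- The integrand of `ctrlOutput`, for a profile `m` of derivative `n`. -/
def outputDensity (G s : ℝ) (j : Fin 2) (ω : ℝ) (m n : Vec) : ℝ :=
  inner ℝ n (ctrlFieldDeriv j s ω m) + G * ctrlField j s ω m 2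

theorem integrable_inner_deriv (M N : H1 a b) :
    Integrable (fun ω => inner ℝ (profileDeriv M ω) (profileDeriv N ω)) (freqMeasure a b) :=
  L2.integrable_inner (𝕜 := ℝ) (derivL2 a b M) (derivL2 a b N)

/-- By skewness the part of (A_j M)' containing M' is orthogonal to M' at each ω; only the
derivative of the coefficients contributes. -/
theorem outputDensity_ae (G s : ℝ) (j : Fin 2) (M : H1 a b) :
    (fun ω => inner ℝ (profileDeriv M ω) (profileDeriv (ctrlOp a b s j M) ω)
      + G * profile (ctrlOp a b s j M) ω 2) =ᵐ[freqMeasure a b]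
    fun ω => outputDensity G s j ω (profile M ω) (profileDeriv M ω) := by
  filter_upwards [profile_ctrlOp s j M, profileDeriv_ctrlOp s j M] with ω h1 h2
  rw [h1, h2, inner_add_right, inner_ctrlField, zero_add, outputDensity]

theorem integrable_outputDensity (G s : ℝ) (j : Fin 2) (M : H1 a b) :
    Integrable (fun ω => outputDensity G s j ω (profile M ω) (profileDeriv M ω))
      (freqMeasure a b) :=
  ((integrable_inner_deriv M (ctrlOp a b s j M)).add
    ((integrable_profile_apply (ctrlOp a b s j M) 2).const_mul G)).congr (outputDensity_ae G s j M)

theorem ctrlOutput_eq (G s : ℝ) (j : Fin 2) (M : H1 a b) :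
    ctrlOutput G s j M
      = ∫ ω in Ioo a b, outputDensity G s j ω (profile M ω) (profileDeriv M ω) := by
  rw [← integral_congr_ae (outputDensity_ae G s j M),
    integral_add (integrable_inner_deriv M (ctrlOp a b s j M))
      ((integrable_profile_apply (ctrlOp a b s j M) 2).const_mul G), ctrlOutput, dampingOutput,
    heightForm_apply, dirichletForm_apply, L2.inner_def]
  rfl

/-- The integrand of the feedback law. -/
def feedbackDensity (G s ω : ℝ) (m n : Vec) : ℂ :=
  (Complex.I * (s : ℂ) * (transverse m * (n 2 : ℂ) - transverse n * (m 2 : ℂ))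
    + (G : ℂ) * transverse m) * Complex.exp (Complex.I * (ω : ℂ) * (s : ℂ))

/-- The identity behind the choice of Ω: at each frequency, the prescribed integrand is minus the
density of the rate of change of the energy along the two control fields. -/
theorem feedbackDensity_eq (G s ω : ℝ) (m n : Vec) :
    feedbackDensity G s ω m n
      = -((outputDensity G s 0 ω m n : ℂ) + (outputDensity G s 1 ω m n : ℂ) * Complex.I) := by
  have he : Complex.exp (Complex.I * (ω : ℂ) * (s : ℂ))
      = (Real.cos (s * ω) : ℂ) + (Real.sin (s * ω) : ℂ) * Complex.I := by
    have : Complex.I * (ω : ℂ) * (s : ℂ) = ((s * ω : ℝ) : ℂ) * Complex.I := by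
      push_cast; ring
    rw [this, Complex.exp_mul_I, ← Complex.ofReal_cos, ← Complex.ofReal_sin]
  rw [feedbackDensity, he]
  simp only [outputDensity, ctrlField, ctrlFieldDeriv, rotX_apply, rotY_apply, transverse]
  generalize Real.cos (s * ω) = c
  generalize Real.sin (s * ω) = d
  apply Complex.ext
  · simp [Complex.mul_re, Complex.mul_im, PiLp.inner_apply, Fin.sum_univ_three]
    ring
  · simp [Complex.mul_re, Complex.mul_im, PiLp.inner_apply, Fin.sum_univ_three]
    ring

theorem integral_feedbackDensity (G s : ℝ) (M : H1 a b) :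
    ∫ ω in Ioo a b, feedbackDensity G s ω (profile M ω) (profileDeriv M ω)
      = -((ctrlOutput G s 0 M : ℂ) + (ctrlOutput G s 1 M : ℂ) * Complex.I) := by
  simp only [feedbackDensity_eq]
  rw [integral_neg, integral_add (integrable_outputDensity G s 0 M).ofReal
    ((integrable_outputDensity G s 1 M).ofReal.mul_const _), integral_mul_const,
    integral_complex_ofReal, integral_complex_ofReal, ctrlOutput_eq, ctrlOutput_eq]

theorem feedback_eq (T G K t : ℝ) (M : H1 a b) :
    feedback T G K t M = ((-K * ctrlOutput G (switchPrim T t) 0 M : ℝ) : ℂ)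
      + ((-K * ctrlOutput G (switchPrim T t) 1 M : ℝ) : ℂ) * Complex.I := by
  have h : feedback T G K t M = (K : ℂ) * ∫ ω in Ioo a b,
    feedbackDensity G (switchPrim T t) ω (profile M ω) (profileDeriv M ω) := rfl
  rw [h, integral_feedbackDensity]
  push_cast
  ring

/-- The closed-loop vector field on `H¹`, with `s = ∫₀ᵗ ς`. -/
def closedLoopField (a b G K s : ℝ) (M : H1 a b) : H1 a b :=
  dampedField (dirichletForm a b) (heightForm a b G) K (ctrlOp a b s) M

theorem closedLoopField_eq (G K s : ℝ) (M : H1 a b) :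
    closedLoopField a b G K s M = (-K * ctrlOutput G s 0 M) • ctrlOp a b s 0 M
      + (-K * ctrlOutput G s 1 M) • ctrlOp a b s 1 M := by
  rw [closedLoopField, dampedField, Fin.sum_univ_two]
  rfl

theorem profile_closedLoopField (T G K t : ℝ) (M : H1 a b) :
    profile (closedLoopField a b G K (switchPrim T t) M) =ᵐ[freqMeasure a b]
      fun ω => driftlessField (feedback T G K t M) (switchPrim T t) ω (profile M ω) := by
  rw [closedLoopField_eq, feedback_eq]
  filter_upwards [profile_add ((-K * ctrlOutput G (switchPrim T t) 0 M)
      • ctrlOp a b (switchPrim T t) 0 M)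
      ((-K * ctrlOutput G (switchPrim T t) 1 M) • ctrlOp a b (switchPrim T t) 1 M),
    profile_smul (-K * ctrlOutput G (switchPrim T t) 0 M) (ctrlOp a b (switchPrim T t) 0 M),
    profile_smul (-K * ctrlOutput G (switchPrim T t) 1 M) (ctrlOp a b (switchPrim T t) 1 M),
    profile_ctrlOp (switchPrim T t) 0 M, profile_ctrlOp (switchPrim T t) 1 M]
    with ω h1 h2 h3 h4 h5
  rw [h1, h2, h3, h4, h5]
  exact (driftlessField_eq (fun j => -K * ctrlOutput G (switchPrim T t) j M) _ ω _).symm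

end

section

variable {a b : ℝ}

/-! ### Sphere-valued profiles -/

/-- Continuity upgrades the a.e. constraint to every point of the closed interval, where evaluation
is a bounded linear map. -/
theorem isSphereValued_iff (hab : a < b) (M : H1 a b) :
    IsSphereValued M ↔ ∀ ω ∈ Icc a b, ‖rep M ω‖ = 1 := by
  constructor
  · intro h
    refine eqOn_Icc_of_ae_eq_Ioo hab ?_ (continuousOn_rep hab.le M).norm continuousOn_const
    filter_upwards [h, profile_ae_eq_rep hab M] with ω h1 h2
    rw [← h2]
    exact mem_sphere_zero_iff_norm.1 h1
  · intro h
    filter_upwards [profile_ae_eq_rep hab M, ae_restrict_mem measurableSet_Ioo] with ω h1 h2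
    rw [h1]
    exact mem_sphere_zero_iff_norm.2 (h ω (Ioo_subset_Icc_self h2))

theorem norm_sq_add_e3 (m : Vec) (hm : ‖m‖ = 1) : ‖m + e3‖ ^ 2 = 2 + 2 * m 2 := by
  have he : ‖e3‖ = 1 := by simp [e3]
  have hi : inner ℝ m e3 = m 2 := by simp [e3, EuclideanSpace.inner_single_right]
  rw [norm_add_sq_real, hm, he, hi]
  ring

theorem profile_constProfile (c : Vec) : profile (constProfile a b c) =ᵐ[freqMeasure a b]
    fun _ => c :=
  Lp.coeFn_const (p := 2) (μ := freqMeasure a b) (c := c)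

theorem derivL2_constProfile (c : Vec) : derivL2 a b (constProfile a b c) = 0 := rfl

/-- The energy `∫ |M'|² / 2 + G ∫ z`. -/
def energy (a b G : ℝ) (M : H1 a b) : ℝ := 2⁻¹ * dirichletForm a b M M + heightForm a b G M

/-- On the sphere |m + e₃|² = 2 + 2z, which turns the linear term G∫z into a squared L² distance. -/
theorem energy_eq (hab : a ≤ b) (G : ℝ) {M : H1 a b} (hM : IsSphereValued M) :
    energy a b G M + G * (b - a) = 2⁻¹ * ‖derivL2 a b (M + constProfile a b e3)‖ ^ 2
      + 2⁻¹ * G * ‖toL2 a b (M + constProfile a b e3)‖ ^ 2 := by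
  have h1 : ‖toL2 a b (M + constProfile a b e3)‖ ^ 2
      = 2 * (b - a) + 2 * ∫ ω in Ioo a b, profile M ω 2 := by
    have hc : ∫ _ in Ioo a b, (2 : ℝ) = 2 * (b - a) := by
      rw [setIntegral_const, Real.volume_real_Ioo_of_le hab, smul_eq_mul, mul_comm]
    rw [← real_inner_self_eq_norm_sq, L2.inner_def, ← integral_const_mul, ← hc,
      ← integral_add (integrable_const _) ((integrable_profile_apply M 2).const_mul 2)]
    apply integral_congr_ae
    filter_upwards [profile_add M (constProfile a b e3), profile_constProfile (a := a) (b := b) e3,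
      hM] with ω h2 h3 h4
    rw [coeFn_toL2, h2, h3, real_inner_self_eq_norm_sq,
      norm_sq_add_e3 _ (mem_sphere_zero_iff_norm.1 h4)]
  rw [energy, h1, map_add, derivL2_constProfile, add_zero, dirichletForm_apply,
    real_inner_self_eq_norm_sq, heightForm_apply, integral_const_mul]
  ring

theorem energy_bounds (hab : a ≤ b) (G : ℝ) {M : H1 a b} (hM : IsSphereValued M) :
    min 1 G * ‖M + constProfile a b e3‖ ^ 2 ≤ 2 * (energy a b G M + G * (b - a)) ∧
      2 * (energy a b G M + G * (b - a)) ≤ max 1 G * ‖M + constProfile a b e3‖ ^ 2 := by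
  rw [energy_eq hab G hM, norm_sq_H1]
  have h1 := sq_nonneg ‖toL2 a b (M + constProfile a b e3)‖
  have h2 := sq_nonneg ‖derivL2 a b (M + constProfile a b e3)‖
  constructor
  · nlinarith [mul_le_mul_of_nonneg_right (min_le_left 1 G) h2,
      mul_le_mul_of_nonneg_right (min_le_right 1 G) h1]
  · nlinarith [mul_le_mul_of_nonneg_right (le_max_left 1 G) h2,
      mul_le_mul_of_nonneg_right (le_max_right 1 G) h1]

theorem inner_rep_closedLoopField (hab : a < b) (G K s : ℝ) (M : H1 a b) {ω : ℝ}
    (hω : ω ∈ Icc a b) : inner ℝ (rep M ω) (rep (closedLoopField a b G K s M) ω) = 0 := by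
  have e := congrArg (evalH1 hab hω) (closedLoopField_eq G K s M)
  rw [map_add, map_smul, map_smul] at e
  simp only [evalH1_apply, rep_ctrlOp hab _ _ _ hω] at e
  rw [e, inner_add_right, inner_smul_right, inner_smul_right, inner_ctrlField, inner_ctrlField]
  simp

theorem continuous_ctrlOp_switchPrim (a b : ℝ) {T : ℝ} (hT : 0 < T) :
    Continuous fun t => ctrlOp a b (switchPrim T t) := by
  obtain ⟨C, hC, -, h⟩ := exists_ctrlOp_bounds a b T hT.le
  refine (LipschitzWith.of_dist_le_mul (α := ℝ) (β := Fin 2 → H1 a b →L[ℝ] H1 a b)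
    (K := ⟨C, hC⟩) fun s t => ?_).continuous
  exact (dist_eq_norm (ctrlOp a b (switchPrim T s)) (ctrlOp a b (switchPrim T t))).trans_le
    ((h _ (switchPrim_mem_Icc hT s) _ (switchPrim_mem_Icc hT t)).trans
      (mul_le_mul_of_nonneg_left (abs_switchPrim_sub_le T s t) hC))

/-- Existence of global solutions near `-e₃`, which stay on the sphere and near `-e₃`. -/
theorem exists_solution (hab : a < b) {T G K : ℝ} (hT : 0 < T) (hG : 0 < G) (hK : 0 < K) {ρ : ℝ}
    (hρ : 0 < ρ) :
    ∃ δ : ℝ, 0 < δ ∧ ∀ M₀ : H1 a b, IsSphereValued M₀ → ‖M₀ + constProfile a b e3‖ ≤ δ →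
      ∃ M : ℝ → H1 a b, M 0 = M₀ ∧ ∀ t, 0 ≤ t →
        HasDerivAt M (closedLoopField a b G K (switchPrim T t) (M t)) t ∧
        IsSphereValued (M t) ∧ ‖M t + constProfile a b e3‖ ≤ ρ := by
  have hmin : 0 < min 1 G := lt_min one_pos hG
  have hmax : 0 < max 1 G := lt_max_of_lt_left one_pos
  have hmm : min 1 G ≤ max 1 G := min_le_max
  obtain ⟨C, hC0, hC, -⟩ := exists_ctrlOp_bounds a b T hT.le
  -- Chosen so that max(1, G) δ² ≤ min(1, G) ρ², the loss in comparing the energy with the norm from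
  -- both sides.
  refine ⟨ρ * (min 1 G / max 1 G), by positivity, fun M₀ hM₀ hδ => ?_⟩
  -- The ball of radius R contains all states within ρ of -e₃, so the truncation is inactive there.
  set R := ρ + ‖constProfile a b e3‖ with hR
  obtain ⟨M, hM0, hM⟩ := exists_truncated_solution (dirichletForm a b) (heightForm a b G) K
    (continuous_ctrlOp_switchPrim a b hT) (C := C) (R := R)
    (fun t => hC _ (switchPrim_mem_Icc hT t)) (by positivity) M₀
  have hsphere : ∀ t, IsSphereValued (M t) := by
    intro t
    rw [isSphereValued_iff hab]
    intro ω hω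
    -- Truncation only rescales a field tangent to the spheres, so |M(t, ω)| is constant at each ω.
    have hd : ∀ t, HasDerivAt (fun t => ‖rep (M t) ω‖ ^ 2) 0 t := by
      intro t
      have h1 := ((evalH1 hab hω).hasFDerivAt (x := M t)).comp_hasDerivAt t (hM t)
      refine h1.norm_sq.congr_deriv ?_
      rw [map_smul, inner_smul_right]
      exact mul_eq_zero_of_right _
        (mul_eq_zero_of_right _ (inner_rep_closedLoopField hab G K (switchPrim T t) (M t) hω))
    have h2 := is_const_of_deriv_eq_zero (fun t => (hd t).differentiableAt)
      (fun t => (hd t).deriv) t 0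
    simp only [hM0] at h2
    rw [(isSphereValued_iff hab M₀).1 hM₀ ω hω] at h2
    exact (sq_eq_sq₀ (norm_nonneg _) zero_le_one).1 h2
  have hanti : Antitone fun t => energy a b G (M t) := by
    have hd := fun t => hasDerivAt_energy (heightForm a b G) K dirichletForm_comm (hM t)
    refine antitone_of_deriv_nonpos (fun t => (hd t).differentiableAt) (fun t => ?_)
    refine (hd t).deriv.le.trans (neg_nonpos.2 ?_)
    exact mul_nonneg (mul_nonneg (cutoff_nonneg R (M t)) hK.le)
      (Finset.sum_nonneg fun j _ => sq_nonneg _)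
  have hnear : ∀ t, 0 ≤ t → ‖M t + constProfile a b e3‖ ≤ ρ := by
    intro t ht
    have h1 := (energy_bounds hab.le G (hsphere t)).1
    have h2 := (energy_bounds hab.le G hM₀).2
    have h3 := hanti ht
    simp only [hM0] at h3
    have h4 : max 1 G * ‖M₀ + constProfile a b e3‖ ^ 2 ≤ min 1 G * ρ ^ 2 := by
      have h5 := pow_le_pow_left₀ (norm_nonneg _) hδ 2
      have h6 : max 1 G * (ρ * (min 1 G / max 1 G)) ^ 2
          = min 1 G * ρ ^ 2 * (min 1 G / max 1 G) := by
        field_simp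
      have h7 : min 1 G / max 1 G ≤ 1 := (div_le_one hmax).2 hmm
      have h8 : 0 ≤ min 1 G * ρ ^ 2 := by positivity
      nlinarith [mul_le_mul_of_nonneg_left h5 hmax.le, mul_le_mul_of_nonneg_left h7 h8]
    have h9 : min 1 G * ‖M t + constProfile a b e3‖ ^ 2 ≤ min 1 G * ρ ^ 2 := by linarith
    exact (sq_le_sq₀ (norm_nonneg _) hρ.le).1 (le_of_mul_le_mul_left h9 hmin)
  refine ⟨M, hM0, fun t ht => ⟨?_, hsphere t, hnear t ht⟩⟩
  have hb : ‖M t‖ ≤ R := by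
    have h1 := norm_sub_le (M t + constProfile a b e3) (constProfile a b e3)
    rw [add_sub_cancel_right] at h1
    exact h1.trans (add_le_add_left (hnear t ht) _)
  have h := hM t
  rwa [cutoff_eq_one hb, one_smul] at h

/-! ### Solutions in the sense of `IsClosedLoopSolution` -/

/-- Time enters the field only through S, which is Lipschitz: nothing jumps at the switching times.
-/
theorem continuousWithinAt_closedLoopField {T : ℝ} (hT : 0 < T) (G K : ℝ) {M : ℝ → H1 a b}
    {s : Set ℝ} {t : ℝ} (hM : ContinuousWithinAt M s t) :
    ContinuousWithinAt (fun t => closedLoopField a b G K (switchPrim T t) (M t)) s t := by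
  have hA : ∀ j, ContinuousWithinAt (fun t => ctrlOp a b (switchPrim T t) j (M t)) s t := fun j =>
    (((continuous_apply j).comp (continuous_ctrlOp_switchPrim a b hT)).continuousWithinAt).clm_apply
      hM
  have hB : ∀ j, ContinuousWithinAt
      (fun t => dirichletForm a b (M t) (ctrlOp a b (switchPrim T t) j (M t))) s t := fun j =>
    ((dirichletForm a b).continuous.continuousAt.comp_continuousWithinAt hM).clm_apply (hA j)
  have hl : ∀ j, ContinuousWithinAt
      (fun t => heightForm a b G (ctrlOp a b (switchPrim T t) j (M t))) s t := fun j =>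
    (heightForm a b G).continuous.continuousAt.comp_continuousWithinAt (hA j)
  have hj : ∀ j, ContinuousWithinAt (fun t => (-K * dampingOutput (dirichletForm a b)
      (heightForm a b G) (ctrlOp a b (switchPrim T t) j) (M t))
        • ctrlOp a b (switchPrim T t) j (M t)) s t := fun j =>
    (continuousWithinAt_const.mul ((hB j).add (hl j))).smul (hA j)
  simp only [closedLoopField, dampedField, Fin.sum_univ_two]
  exact (hj 0).add (hj 1)

theorem isClosedLoopSolution_of_hasDerivAt {T G K : ℝ} (hT : 0 < T) {M : ℝ → H1 a b}
    (hM : ∀ t, 0 ≤ t → HasDerivAt M (closedLoopField a b G K (switchPrim T t) (M t)) t) :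
    IsClosedLoopSolution T G K M := by
  have hk : ∀ k : ℕ, (0 : ℝ) ≤ k * T := fun k => by positivity
  have hcont : ∀ t, 0 ≤ t →
      ContinuousAt (fun t => closedLoopField a b G K (switchPrim T t) (M t)) t := fun t ht => by
    rw [← continuousWithinAt_univ]
    exact continuousWithinAt_closedLoopField hT G K (hM t ht).continuousAt.continuousWithinAt
  refine ⟨⟨?_, ?_, ?_, ?_, ?_⟩, ?_⟩
  · exact fun t ht => (hM t ht).continuousAt.continuousWithinAt
  · exact fun k t ht => (hM t ((hk k).trans ht.1.le)).differentiableAt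
  · refine fun k => ContinuousOn.congr (f := fun t => closedLoopField a b G K (switchPrim T t) (M t))
      (fun t ht => (hcont t ((hk k).trans ht.1.le)).continuousWithinAt) fun t ht => ?_
    exact (hM t ((hk k).trans ht.1.le)).deriv
  · refine fun k => ⟨_, ((hcont _ (hk k)).tendsto.mono_left nhdsWithin_le_nhds).congr' ?_⟩
    filter_upwards [self_mem_nhdsWithin] with t ht
    exact ((hM t ((hk k).trans (le_of_lt ht))).deriv).symm
  · intro k
    have h1 : (k * T : ℝ) < (k + 1) * T := by nlinarith
    refine ⟨_, ((hcont ((k + 1) * T) ((hk k).trans h1.le)).tendsto.mono_left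
      nhdsWithin_le_nhds).congr' ?_⟩
    filter_upwards [Ioo_mem_nhdsLT h1] with t ht
    exact ((hM t ((hk k).trans ht.1.le)).deriv).symm
  · intro k t ht
    rw [(hM t ((hk k).trans ht.1.le)).deriv]
    exact profile_closedLoopField T G K t (M t)

/-- At a switching time the equation is not assumed; there the right derivative is the limit of the
derivatives from the right, which the equation and continuity of the field identify. -/
theorem IsClosedLoopSolution.hasDerivWithinAt {T G K : ℝ} (hT : 0 < T) {N : ℝ → H1 a b}
    (hN : IsClosedLoopSolution T G K N) {t : ℝ} (ht : 0 ≤ t) :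
    HasDerivWithinAt N (closedLoopField a b G K (switchPrim T t) (N t)) (Ici t) t := by
  set k := ⌊t / T⌋₊ with hk
  have hk1 : (k * T : ℝ) ≤ t := (le_div_iff₀ hT).1 (Nat.floor_le (div_nonneg ht hT.le))
  have hk2 : t < (k + 1) * T := (div_lt_iff₀ hT).1 (Nat.lt_floor_add_one _)
  have hsub : Ioo t ((k + 1) * T) ⊆ Ioo (k * T) ((k + 1) * T) := Ioo_subset_Ioo_left hk1
  have hcw : ContinuousWithinAt N (Ioi t) t :=
    (hN.regular.continuousOn t ht).mono fun x hx => mem_Ici.2 (ht.trans (le_of_lt hx))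
  refine hasDerivWithinAt_Ici_of_tendsto_deriv (s := Ioo t ((k + 1) * T))
    (fun x hx => (hN.regular.differentiableOn k x (hsub hx)).differentiableWithinAt)
    (hcw.mono Ioo_subset_Ioi_self) (Ioo_mem_nhdsGT hk2)
    ((continuousWithinAt_closedLoopField hT G K hcw).tendsto.congr' ?_)
  filter_upwards [Ioo_mem_nhdsGT hk2] with x hx
  exact ext_profile ((profile_closedLoopField T G K x (N x)).trans
    (hN.equation k x (hsub hx)).symm)

/-- On [0, t] both curves lie in a common ball, where the field is Lipschitz; Grönwall's argument
needs only right derivatives. -/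
theorem IsClosedLoopSolution.eq {T G K : ℝ} (hT : 0 < T) {M N : ℝ → H1 a b}
    (hM : IsClosedLoopSolution T G K M) (hN : IsClosedLoopSolution T G K N) (h0 : N 0 = M 0)
    {t : ℝ} (ht : 0 ≤ t) : N t = M t := by
  obtain ⟨C, hC0, hC, -⟩ := exists_ctrlOp_bounds a b T hT.le
  have hcM : ContinuousOn M (Icc 0 t) := hM.regular.continuousOn.mono Icc_subset_Ici_self
  have hcN : ContinuousOn N (Icc 0 t) := hN.regular.continuousOn.mono Icc_subset_Ici_self
  obtain ⟨R₁, hR₁⟩ := isCompact_Icc.exists_bound_of_continuousOn hcM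
  obtain ⟨R₂, hR₂⟩ := isCompact_Icc.exists_bound_of_continuousOn hcN
  have hR : 0 ≤ max R₁ R₂ := (norm_nonneg _).trans ((hR₁ 0 ⟨le_rfl, ht⟩).trans (le_max_left _ _))
  obtain ⟨L, hL, h⟩ := exists_dampedField_lipschitz (dirichletForm a b) (heightForm a b G) K hC0 hR
  refine ODE_solution_unique_of_mem_Icc_right
    (v := fun t => closedLoopField a b G K (switchPrim T t)) (K := ⟨L, hL⟩)
    (s := fun _ => {M | ‖M‖ ≤ max R₁ R₂}) (fun x _ => ?_) hcN
    (fun x hx => hN.hasDerivWithinAt hT hx.1)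
    (fun x hx => (hR₂ x (Ico_subset_Icc_self hx)).trans (le_max_right _ _)) hcM
    (fun x hx => hM.hasDerivWithinAt hT hx.1)
    (fun x hx => (hR₁ x (Ico_subset_Icc_self hx)).trans (le_max_left _ _)) h0 ⟨ht, le_rfl⟩
  refine LipschitzOnWith.of_dist_le_mul fun P hP Q hQ => ?_
  rw [dist_eq_norm, dist_eq_norm]
  exact h (ctrlOp a b (switchPrim T x)) P Q (hC _ (switchPrim_mem_Icc hT x)) hP hQ

/-! ### Decay of the outputs -/

theorem norm_sub_le_of_hasDerivAt {E : Type*} [NormedAddCommGroup E] [NormedSpace ℝ E]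
    {M F : ℝ → E} {τ c : ℝ} (hM : ∀ t, τ ≤ t → HasDerivAt M (F t) t)
    (hF : ∀ t, τ ≤ t → ‖F t‖ ≤ c) {s t : ℝ} (hs : τ ≤ s) (ht : τ ≤ t) :
    ‖M t - M s‖ ≤ c * |t - s| :=
  (convex_Ici τ).norm_image_sub_le_of_norm_hasDerivWithin_le
    (fun x hx => (hM x hx).hasDerivWithinAt) hF hs ht

/-- Barbalat's lemma for E, whose dissipation rate is K∑y_j². The rate is Lipschitz in time since M
has bounded speed and S is Lipschitz. -/
theorem tendsto_ctrlOutput_switchPrim {T G K : ℝ} (hab : a < b) (hT : 0 < T) (hG : 0 < G)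
    (hK : 0 < K) {M : ℝ → H1 a b} {R : ℝ}
    (hM : ∀ t, 0 ≤ t → HasDerivAt M (closedLoopField a b G K (switchPrim T t) (M t)) t)
    (hs : ∀ t, 0 ≤ t → IsSphereValued (M t)) (hR : ∀ t, 0 ≤ t → ‖M t‖ ≤ R) (j : Fin 2) :
    Tendsto (fun t => ctrlOutput G (switchPrim T t) j (M t)) atTop (𝓝 0) := by
  obtain ⟨C, hC0, hC, hC'⟩ := exists_ctrlOp_bounds a b T hT.le
  have hR0 : 0 ≤ R := (norm_nonneg _).trans (hR 0 le_rfl)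
  obtain ⟨V, hV, hVb⟩ := exists_dampedField_bounds (dirichletForm a b) (heightForm a b G) K hC0 hR0
  obtain ⟨L, hL, hLb⟩ := exists_dampingOutput_bounds (dirichletForm a b) (heightForm a b G) hC0 hR0
  have hA := fun t => hC _ (switchPrim_mem_Icc hT t)
  have hAj : ∀ t j, ‖ctrlOp a b (switchPrim T t) j‖ ≤ C := fun t j =>
    (norm_le_pi_norm _ j).trans (hA t)
  have hMlip : ∀ s t, 0 ≤ s → 0 ≤ t → ‖M s - M t‖ ≤ V * |s - t| := fun s t hs ht =>
    norm_sub_le_of_hasDerivAt hM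
      (fun t ht => (hVb _ _ _ _ (hA t) (hA t) (hR t ht) (hR t ht)).1) ht hs
  set y : Fin 2 → ℝ → ℝ := fun j t => ctrlOutput G (switchPrim T t) j (M t) with hy
  have hyb : ∀ j t, 0 ≤ t → |y j t| ≤ L := fun j t ht =>
    (hLb _ _ _ _ (hAj t j) (hAj t j) (hR t ht) (hR t ht)).1
  have hylip : ∀ j s t, 0 ≤ s → 0 ≤ t → |y j s - y j t| ≤ L * (V + C) * |s - t| := by
    intro j s t hs ht
    refine ((hLb _ _ _ _ (hAj s j) (hAj t j) (hR s hs) (hR t ht)).2).trans ?_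
    have h1 := hMlip s t hs ht
    have h2 : ‖ctrlOp a b (switchPrim T s) j - ctrlOp a b (switchPrim T t) j‖ ≤ C * |s - t| :=
      (norm_le_pi_norm (ctrlOp a b (switchPrim T s) - ctrlOp a b (switchPrim T t)) j).trans
        ((hC' _ (switchPrim_mem_Icc hT s) _ (switchPrim_mem_Icc hT t)).trans
          (mul_le_mul_of_nonneg_left (abs_switchPrim_sub_le T s t) hC0))
    rw [mul_assoc, add_mul]
    exact mul_le_mul_of_nonneg_left (add_le_add h1 h2) hL
  have hsq : ∀ j s t, 0 ≤ s → 0 ≤ t →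
      |y j s ^ 2 - y j t ^ 2| ≤ 2 * L * (L * (V + C)) * |s - t| := by
    intro j s t hs ht
    rw [sq_sub_sq, abs_mul]
    have h1 : |y j s + y j t| ≤ 2 * L :=
      (abs_add_le _ _).trans (by linarith [hyb j s hs, hyb j t ht])
    exact (mul_le_mul h1 (hylip j s t hs ht) (abs_nonneg _) (by positivity)).trans_eq (by ring)
  have hlim : Tendsto (fun t => K * ∑ j, y j t ^ 2) atTop (𝓝 0) := by
    refine tendsto_zero_of_dissipation (e := fun t => energy a b G (M t))
      (Λ := K * (2 * (2 * L * (L * (V + C))))) (c := -(G * (b - a)))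
      (fun t ht => ?_) (fun t _ => ?_) (fun s t hs ht => ?_) (fun t ht => ?_)
    · have h1 := hasDerivAt_energy (heightForm a b G) K (c := 1) dirichletForm_comm
        (A := ctrlOp a b (switchPrim T t)) (by rw [one_smul]; exact hM t ht)
      rw [one_mul] at h1
      exact h1
    · exact mul_nonneg hK.le (Finset.sum_nonneg fun j _ => sq_nonneg _)
    · rw [← mul_sub, abs_mul, abs_of_pos hK, Fin.sum_univ_two, Fin.sum_univ_two,
        add_sub_add_comm, mul_assoc]
      refine mul_le_mul_of_nonneg_left ((abs_add_le _ _).trans ?_) hK.le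
      linarith [hsq 0 s t hs ht, hsq 1 s t hs ht]
    · have h1 := (energy_bounds hab.le G (hs t ht)).1
      have h2 : 0 ≤ min 1 G * ‖M t + constProfile a b e3‖ ^ 2 := by positivity
      linarith
  have hsum : Tendsto (fun t => √(∑ j, y j t ^ 2)) atTop (𝓝 0) := by
    have h1 := (hlim.const_mul K⁻¹).sqrt
    simpa [← mul_assoc, inv_mul_cancel₀ hK.ne'] using h1
  refine squeeze_zero_norm (fun t => ?_) hsum
  refine Real.abs_le_sqrt ?_
  exact Finset.single_le_sum (f := fun j => y j t ^ 2) (fun j _ => sq_nonneg _) (Finset.mem_univ j)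

/-- Compare t with a time u in [t, t + 3T] at which S(u) = s: the output at u is small, and M(u) is
close to M(t) because the speed is bounded by the outputs. -/
theorem tendsto_ctrlOutput {T G K : ℝ} (hab : a < b) (hT : 0 < T) (hG : 0 < G)
    (hK : 0 < K) {M : ℝ → H1 a b} {R : ℝ}
    (hM : ∀ t, 0 ≤ t → HasDerivAt M (closedLoopField a b G K (switchPrim T t) (M t)) t)
    (hs : ∀ t, 0 ≤ t → IsSphereValued (M t)) (hR : ∀ t, 0 ≤ t → ‖M t‖ ≤ R) (j : Fin 2)
    {s : ℝ} (hsT : s ∈ Icc 0 T) :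
    Tendsto (fun t => ctrlOutput G s j (M t)) atTop (𝓝 0) := by
  obtain ⟨C, hC0, hC, -⟩ := exists_ctrlOp_bounds a b T hT.le
  have hR0 : 0 ≤ R := (norm_nonneg _).trans (hR 0 le_rfl)
  obtain ⟨L, hL, hLb⟩ :=
    exists_dampingOutput_lipschitz (dirichletForm a b) (heightForm a b G) hC0 hR0
  have hlim := fun j => tendsto_ctrlOutput_switchPrim hab hT hG hK hM hs hR j
  have hF : ∀ t, 0 ≤ t → ∀ η, (∀ j, |ctrlOutput G (switchPrim T t) j (M t)| ≤ η) →
      ‖closedLoopField a b G K (switchPrim T t) (M t)‖ ≤ 2 * K * C * R * η := by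
    intro t ht η hη
    have hj : ∀ j, ‖(-K * ctrlOutput G (switchPrim T t) j (M t))
        • ctrlOp a b (switchPrim T t) j (M t)‖ ≤ K * η * (C * R) := by
      intro j
      rw [norm_smul, Real.norm_eq_abs, abs_mul, abs_neg, abs_of_pos hK]
      refine mul_le_mul (mul_le_mul_of_nonneg_left (hη j) hK.le) (norm_apply_le
        ((norm_le_pi_norm _ j).trans (hC _ (switchPrim_mem_Icc hT t))) (hR t ht))
        (norm_nonneg _) (mul_nonneg hK.le ((abs_nonneg _).trans (hη j)))
    rw [closedLoopField, dampedField, Fin.sum_univ_two]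
    refine (norm_add_le _ _).trans ((add_le_add (hj 0) (hj 1)).trans_eq ?_)
    ring
  rw [Metric.tendsto_atTop]
  intro ε hε
  set Q := L * (2 * K * C * R * (3 * T)) with hQ
  have hQ0 : 0 ≤ Q := by positivity
  -- If all outputs are at most η after time N, the output at (s, M(t)) is at most Qη + η, with Q
  -- collecting the displacement over a time 3T; this is less than (Q + 2)η = ε.
  have hη : 0 < ε / (Q + 2) := by positivity
  have hev : ∀ᶠ t in atTop, (0 : ℝ) ≤ t ∧
      ∀ j, |ctrlOutput G (switchPrim T t) j (M t)| ≤ ε / (Q + 2) := by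
    refine (eventually_ge_atTop 0).and (eventually_all.2 fun j => ?_)
    filter_upwards [(hlim j).abs.eventually (ge_mem_nhds (by rwa [abs_zero]))] with t ht
    exact ht
  obtain ⟨N, hN⟩ := eventually_atTop.1 hev
  refine ⟨N, fun t ht => ?_⟩
  have ht0 := (hN t ht).1
  obtain ⟨u, htu, hut, hu⟩ := exists_switchPrim_eq hT hsT t
  have hu0 : 0 ≤ u := ht0.trans htu
  have h1 : ‖M t - M u‖ ≤ 2 * K * C * R * (ε / (Q + 2)) * (3 * T) := by
    refine (norm_sub_le_of_hasDerivAt (τ := t) (fun x hx => hM x (ht0.trans hx))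
      (fun x hx => hF x (ht0.trans hx) _ (hN x (ht.trans hx)).2) htu le_rfl).trans ?_
    refine mul_le_mul_of_nonneg_left ?_ (by positivity)
    rw [abs_sub_comm, abs_of_nonneg (sub_nonneg.2 htu)]
    linarith
  have hAj : ‖ctrlOp a b s j‖ ≤ C := (norm_le_pi_norm _ j).trans (hC s hsT)
  have h3 := (hN u (ht.trans htu)).2 j
  rw [hu] at h3
  have h4 := mul_le_mul_of_nonneg_left h1 hL
  have h5 : L * (2 * K * C * R * (ε / (Q + 2)) * (3 * T)) = Q * (ε / (Q + 2)) := by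
    rw [hQ]; ring
  have h6 : (Q + 2) * (ε / (Q + 2)) = ε := mul_div_cancel₀ _ (by positivity)
  rw [Real.dist_eq, sub_zero]
  have h7 : |ctrlOutput G s j (M t)| ≤ |ctrlOutput G s j (M t) - ctrlOutput G s j (M u)|
      + |ctrlOutput G s j (M u)| := by
    have := abs_add_le (ctrlOutput G s j (M t) - ctrlOutput G s j (M u)) (ctrlOutput G s j (M u))
    rwa [sub_add_cancel] at this
  have h8 : |ctrlOutput G s j (M t) - ctrlOutput G s j (M u)| ≤ L * ‖M t - M u‖ :=
    hLb _ (M t) (M u) hAj (hR t ht0) (hR u hu0)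
  linarith

end

section

/-! ### Weak limits -/

theorem tendsto_toWeakSpace {H ι : Type*} [NormedAddCommGroup H] [NormedSpace ℝ H] {l : Filter ι}
    {M : ι → H} {N : H} (h : ∀ φ : H →L[ℝ] ℝ, Tendsto (fun t => φ (M t)) l (𝓝 (φ N))) :
    Tendsto (fun t => toWeakSpace ℝ H (M t)) l (𝓝 (toWeakSpace ℝ H N)) := by
  refine (WeakBilin.tendsto_iff_forall_eval_tendsto (topDualPairing ℝ H).flip fun x y hxy => ?_).2 h
  by_contra hne
  obtain ⟨φ, hφ⟩ := SeparatingDual.exists_separating_of_ne (R := ℝ) hne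
  exact hφ (LinearMap.congr_fun hxy φ)

/-- Bounded families in a Hilbert space converge weakly along ultrafilters. -/
theorem exists_weak_limit {H ι : Type*} [NormedAddCommGroup H] [InnerProductSpace ℝ H]
    [CompleteSpace H] (U : Ultrafilter ι) {M : ι → H} {R : ℝ} (hR : ∀ t, ‖M t‖ ≤ R) :
    ∃ N : H, ∀ φ : H →L[ℝ] ℝ, Tendsto (fun t => φ (M t)) U (𝓝 (φ N)) := by
  -- The Riesz isomorphism moves the family to the dual, where Banach–Alaoglu provides a limit along
  -- the ultrafilter.
  set g : ι → WeakDual ℝ H := fun t =>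
    WeakDual.toStrongDual.symm (InnerProductSpace.toDual ℝ H (M t)) with hg
  obtain ⟨ψ, -, hψ⟩ := (WeakDual.isCompact_closedBall (0 : StrongDual ℝ H) R).ultrafilter_le_nhds
    (U.map g) (by
      rw [le_principal_iff, Ultrafilter.coe_map, mem_map]
      refine Eventually.of_forall fun t => ?_
      simp only [mem_preimage, hg, LinearEquiv.apply_symm_apply, mem_closedBall_zero_iff,
        LinearIsometryEquiv.norm_map]
      exact hR t)
  refine ⟨(InnerProductSpace.toDual ℝ H).symm (WeakDual.toStrongDual ψ), fun φ => ?_⟩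
  obtain ⟨y, rfl⟩ := (InnerProductSpace.toDual ℝ H).surjective φ
  have h1 : Tendsto (fun t => g t y) U (𝓝 (ψ y)) :=
    ((WeakDual.eval_continuous y).tendsto ψ).comp hψ
  simp only [InnerProductSpace.toDual_apply_apply]
  rw [real_inner_comm, InnerProductSpace.toDual_symm_apply]
  refine h1.congr fun t => ?_
  exact (real_inner_comm _ _)

variable {a b : ℝ} {ι : Type*} {l : Filter ι} {M : ι → H1 a b} {N : H1 a b}

theorem tendsto_rep (hab : a < b)
    (hw : ∀ φ : H1 a b →L[ℝ] ℝ, Tendsto (fun t => φ (M t)) l (𝓝 (φ N))) {ω : ℝ}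
    (hω : ω ∈ Icc a b) : Tendsto (fun t => rep (M t) ω) l (𝓝 (rep N ω)) := by
  have h : Tendsto (fun t => WithLp.ofLp (rep (M t) ω)) l (𝓝 (WithLp.ofLp (rep N ω))) :=
    tendsto_pi_nhds.2 fun i => hw ((EuclideanSpace.proj (𝕜 := ℝ) i).comp (evalH1 hab hω))
  exact ((PiLp.continuous_toLp 2 (fun _ : Fin 3 => ℝ)).tendsto _).comp h

/-- Compact embedding in C⁰: weak convergence gives pointwise convergence, and equicontinuity on a
compact interval makes it uniform. -/
theorem tendstoUniformlyOn_rep (hab : a < b)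
    (hw : ∀ φ : H1 a b →L[ℝ] ℝ, Tendsto (fun t => φ (M t)) l (𝓝 (φ N))) {R : ℝ}
    (hR : ∀ t, ‖M t‖ ≤ R) :
    TendstoUniformlyOn (fun t ω => rep (M t) ω) (rep N) l (Icc a b) := by
  have hequi : Equicontinuous fun (t : ι) (ω : Icc a b) => rep (M t) ω := by
    refine Metric.equicontinuous_of_continuity_modulus (fun r => √r * R) ?_ _ fun x y t => ?_
    · have : Continuous fun r : ℝ => √r * R := Real.continuous_sqrt.mul continuous_const
      simpa using this.tendsto 0
    · rw [dist_eq_norm, Subtype.dist_eq, Real.dist_eq]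
      exact (norm_rep_sub_le x.2 y.2).trans
        (mul_le_mul_of_nonneg_left (hR t) (Real.sqrt_nonneg _))
  rw [tendstoUniformlyOn_iff_tendstoUniformly_comp_coe]
  refine UniformFun.tendsto_iff_tendstoUniformly.1
    ((hequi.tendsto_uniformFun_iff_pi l (rep N ∘ ((↑) : Icc a b → ℝ))).2 ?_)
  exact tendsto_pi_nhds.2 fun ω => tendsto_rep hab hw ω.2

theorem tendsto_toL2 (hab : a < b)
    (hw : ∀ φ : H1 a b →L[ℝ] ℝ, Tendsto (fun t => φ (M t)) l (𝓝 (φ N))) {R : ℝ}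
    (hR : ∀ t, ‖M t‖ ≤ R) : Tendsto (fun t => ‖toL2 a b (M t) - toL2 a b N‖) l (𝓝 0) := by
  have hu := tendstoUniformlyOn_rep hab hw hR
  rw [Metric.tendsto_nhds]
  intro ε hε
  obtain ⟨η, hη, hlt⟩ : ∃ η, 0 < η ∧ measureUnivNNReal (freqMeasure a b) ^ (2 : ENNReal).toReal⁻¹ * η < ε := by
    set c : ℝ := measureUnivNNReal (freqMeasure a b) ^ (2 : ENNReal).toReal⁻¹
    have hc : 0 ≤ c := by positivity
    refine ⟨ε / (c + 1), by positivity, ?_⟩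
    rw [mul_div_assoc', div_lt_iff₀ (by positivity)]
    nlinarith
  filter_upwards [Metric.tendstoUniformlyOn_iff.1 hu η hη] with t ht
  rw [Real.dist_eq, sub_zero, abs_norm]
  refine lt_of_le_of_lt (Lp.norm_le_of_ae_bound hη.le ?_) hlt
  filter_upwards [Lp.coeFn_sub (toL2 a b (M t)) (toL2 a b N), profile_ae_eq_rep hab (M t),
    profile_ae_eq_rep hab N, ae_restrict_mem measurableSet_Ioo] with ω h1 h2 h3 h4
  rw [h1, Pi.sub_apply, coeFn_toL2, coeFn_toL2, h2, h3, ← dist_eq_norm, dist_comm]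
  exact (ht ω (Ioo_subset_Icc_self h4)).le

/-- Application of `ctrlFieldDeriv` to square integrable profiles. -/
def ctrlDerivOp (a b s : ℝ) : Fin 2 → L2Space a b →L[ℝ] L2Space a b :=
  rotatedPair (mulL2 a b ((contDiff_cos_mul s).continuous_deriv (by simp)))
    (mulL2 a b ((contDiff_sin_mul s).continuous_deriv (by simp)))
    (rotX.compLpL 2 (freqMeasure a b)) (rotY.compLpL 2 (freqMeasure a b))

theorem coeFn_ctrlDerivOp (s : ℝ) (j : Fin 2) (f : L2Space a b) :
    ctrlDerivOp a b s j f =ᵐ[freqMeasure a b] fun ω => ctrlFieldDeriv j s ω (f ω) := by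
  have hc := (contDiff_cos_mul s).continuous_deriv (by simp)
  have hs := (contDiff_sin_mul s).continuous_deriv (by simp)
  fin_cases j
  · refine (Lp.coeFn_sub _ _).trans ?_
    filter_upwards [coeFn_mulL2 hc (rotX.compLpL 2 (freqMeasure a b) f),
      coeFn_mulL2 hs (rotY.compLpL 2 (freqMeasure a b) f),
      rotX.coeFn_compLpL (p := 2) (μ := freqMeasure a b) f,
      rotY.coeFn_compLpL (p := 2) (μ := freqMeasure a b) f] with ω h1 h2 h3 h4
    refine (congrArg₂ (· - ·) h1 h2).trans ?_
    simp only [h3, h4, deriv_cos_mul, deriv_sin_mul]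
    rfl
  · refine (Lp.coeFn_add _ _).trans ?_
    filter_upwards [coeFn_mulL2 hs (rotX.compLpL 2 (freqMeasure a b) f),
      coeFn_mulL2 hc (rotY.compLpL 2 (freqMeasure a b) f),
      rotX.coeFn_compLpL (p := 2) (μ := freqMeasure a b) f,
      rotY.coeFn_compLpL (p := 2) (μ := freqMeasure a b) f] with ω h1 h2 h3 h4
    refine (congrArg₂ (· + ·) h1 h2).trans ?_
    simp only [h3, h4, deriv_cos_mul, deriv_sin_mul]
    rfl

/-- In this form M' meets only M in the bilinear term, which prepares the passage to weak limits. -/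
theorem ctrlOutput_eq_inner (G s : ℝ) (j : Fin 2) (M : H1 a b) :
    ctrlOutput G s j M = inner ℝ (derivL2 a b M) (ctrlDerivOp a b s j (toL2 a b M))
      + heightForm a b G (ctrlOp a b s j M) := by
  have h : inner ℝ (derivL2 a b M) (derivL2 a b (ctrlOp a b s j M))
      = inner ℝ (derivL2 a b M) (ctrlDerivOp a b s j (toL2 a b M)) := by
    rw [L2.inner_def, L2.inner_def]
    apply integral_congr_ae
    filter_upwards [profileDeriv_ctrlOp s j M, coeFn_ctrlDerivOp s j (toL2 a b M)] with ω h1 h2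
    rw [h2, coeFn_derivL2, coeFn_derivL2, h1, inner_add_right, inner_ctrlField, zero_add]
    rfl
  rw [← h]
  rfl

/-- A weakly convergent factor M' against a strongly convergent factor built from M, plus a bounded
linear functional. -/
theorem tendsto_ctrlOutput_of_weak (hab : a < b)
    (hw : ∀ φ : H1 a b →L[ℝ] ℝ, Tendsto (fun t => φ (M t)) l (𝓝 (φ N))) {R : ℝ}
    (hR : ∀ t, ‖M t‖ ≤ R) (G s : ℝ) (j : Fin 2) :
    Tendsto (fun t => ctrlOutput G s j (M t)) l (𝓝 (ctrlOutput G s j N)) := by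
  simp only [ctrlOutput_eq_inner]
  refine Tendsto.add ?_ (hw ((heightForm a b G).comp (ctrlOp a b s j)))
  set Q := ctrlDerivOp a b s j
  have h1 : Tendsto (fun t => inner ℝ (derivL2 a b (M t)) (Q (toL2 a b N))) l
      (𝓝 (inner ℝ (derivL2 a b N) (Q (toL2 a b N)))) := by
    have h5 := hw ((innerSL ℝ (Q (toL2 a b N))).comp (derivL2 a b))
    simp only [ContinuousLinearMap.comp_apply, innerSL_apply_apply] at h5
    rw [real_inner_comm (Q (toL2 a b N)) (derivL2 a b N)]
    exact h5.congr fun t => real_inner_comm _ _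
  have h2 : Tendsto (fun t => inner ℝ (derivL2 a b (M t)) (Q (toL2 a b (M t) - toL2 a b N))) l
      (𝓝 0) := by
    have h3 := ((tendsto_toL2 hab hw hR).const_mul (R * ‖Q‖))
    rw [mul_zero] at h3
    refine squeeze_zero_norm (fun t => (norm_inner_le_norm _ _).trans ?_) h3
    rw [mul_assoc]
    exact mul_le_mul ((norm_derivL2_le _).trans (hR t)) (Q.le_opNorm _) (norm_nonneg _)
      ((norm_nonneg _).trans (hR t))
  have h4 := h1.add h2
  rw [add_zero] at h4
  refine h4.congr fun t => ?_
  rw [← inner_add_right, ← map_add, add_sub_cancel]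

end

section

variable {a b : ℝ}

/-! ### Integrable functions on a bounded interval with vanishing moments -/

/-- Weierstrass approximation replaces a test function by a polynomial, uniformly on [a, b]. -/
theorem ae_eq_zero_of_moments {g : ℝ → ℂ} (hg : IntegrableOn g (Ioo a b))
    (h0 : ∀ n : ℕ, ∫ ω in Ioo a b, ((ω ^ n : ℝ) : ℂ) * g ω = 0) : g =ᵐ[freqMeasure a b] 0 := by
  have hi : ∀ {p : ℝ → ℝ}, Continuous p → IntegrableOn (fun ω => (p ω : ℂ) * g ω) (Ioo a b) := by
    intro p hp
    obtain ⟨C, hC⟩ := isCompact_Icc.exists_bound_of_continuousOn (s := Icc a b) hp.continuousOn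
    refine Integrable.bdd_mul (c := C) hg
      (Complex.continuous_ofReal.comp hp).aestronglyMeasurable ?_
    filter_upwards [ae_restrict_mem measurableSet_Ioo] with ω hω
    rw [Complex.norm_real]
    exact hC ω (Ioo_subset_Icc_self hω)
  have hpoly : ∀ p : Polynomial ℝ, ∫ ω in Ioo a b, ((p.eval ω : ℝ) : ℂ) * g ω = 0 := by
    intro p
    simp only [Polynomial.eval_eq_sum_range, Complex.ofReal_sum, Finset.sum_mul]
    rw [integral_finsetSum _ fun n _ => hi (by fun_prop)]
    refine Finset.sum_eq_zero fun n _ => ?_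
    simp only [Complex.ofReal_mul, mul_assoc]
    rw [integral_const_mul, h0, mul_zero]
  refine ae_eq_zero_of_integral_test hg fun φ hφ => ?_
  have hφc := hφ.smooth.continuous
  have hI : 0 ≤ ∫ ω in Ioo a b, ‖g ω‖ := integral_nonneg fun _ => norm_nonneg _
  refine norm_le_zero_iff.1 (le_of_forall_pos_le_add fun ε hε => ?_)
  obtain ⟨p, hp⟩ := exists_polynomial_near_of_continuousOn a b φ hφc.continuousOn
    (ε / ((∫ ω in Ioo a b, ‖g ω‖) + 1)) (by positivity)
  have e : ∫ ω in Ioo a b, φ ω • g ω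
      = ∫ ω in Ioo a b, ((φ ω - p.eval ω : ℝ) : ℂ) * g ω := by
    simp only [Complex.ofReal_sub, sub_mul]
    rw [integral_sub (hi hφc) (hi p.continuous), hpoly, sub_zero]
    simp only [Complex.real_smul]
  rw [e, zero_add]
  refine (norm_integral_le_of_norm_le (hg.norm.const_mul
    (ε / ((∫ ω in Ioo a b, ‖g ω‖) + 1))) ?_).trans ?_
  · filter_upwards [ae_restrict_mem measurableSet_Ioo] with ω hω
    rw [norm_mul, Complex.norm_real, Real.norm_eq_abs, abs_sub_comm]
    exact mul_le_mul_of_nonneg_right (hp ω (Ioo_subset_Icc_self hω)).le (norm_nonneg _)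
  · rw [integral_const_mul, div_mul_eq_mul_div, div_le_iff₀ (by positivity)]
    nlinarith

theorem norm_exp_I_mul (s ω : ℝ) : ‖Complex.exp (Complex.I * (ω : ℂ) * (s : ℂ))‖ = 1 := by
  have : Complex.I * (ω : ℂ) * (s : ℂ) = ((ω * s : ℝ) : ℂ) * Complex.I := by push_cast; ring
  rw [this, Complex.norm_exp_ofReal_mul_I]

theorem hasDerivAt_integral_exp {g : ℝ → ℂ} (hg : IntegrableOn g (Ioo a b)) (s : ℝ) :
    HasDerivAt (fun s : ℝ => ∫ ω in Ioo a b, g ω * Complex.exp (Complex.I * (ω : ℂ) * (s : ℂ)))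
      (∫ ω in Ioo a b, g ω * (Complex.I * (ω : ℂ)) * Complex.exp (Complex.I * (ω : ℂ) * (s : ℂ)))
      s := by
  have hexp : ∀ s : ℝ, Continuous fun ω : ℝ => Complex.exp (Complex.I * (ω : ℂ) * (s : ℂ)) :=
    fun s => by fun_prop
  have hW : ∀ ω ∈ Ioo a b, |ω| ≤ max |a| |b| := fun ω hω => abs_le_max_abs_abs hω.1.le hω.2.le
  refine (hasDerivAt_integral_of_dominated_loc_of_deriv_le (s := univ) (𝕜 := ℝ)
    (F := fun (s ω : ℝ) => g ω * Complex.exp (Complex.I * (ω : ℂ) * (s : ℂ)))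
    (F' := fun (s ω : ℝ) =>
      g ω * (Complex.I * (ω : ℂ)) * Complex.exp (Complex.I * (ω : ℂ) * (s : ℂ)))
    (bound := fun ω => ‖g ω‖ * max |a| |b|) univ_mem
    (Eventually.of_forall fun s => hg.1.mul (hexp s).aestronglyMeasurable) ?_ ?_ ?_
    (hg.norm.mul_const _) ?_).2
  · refine hg.mul_bdd (c := 1) (hexp s).aestronglyMeasurable (Eventually.of_forall fun ω => ?_)
    rw [norm_exp_I_mul]
  · refine (hg.1.mul ?_).mul (hexp s).aestronglyMeasurable
    exact Continuous.aestronglyMeasurable (by fun_prop)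
  · filter_upwards [ae_restrict_mem measurableSet_Ioo] with ω hω x _
    rw [norm_mul, norm_exp_I_mul, mul_one, norm_mul, norm_mul, Complex.norm_I, one_mul,
      Complex.norm_real]
    exact mul_le_mul_of_nonneg_left (hW ω hω) (norm_nonneg _)
  · refine Eventually.of_forall fun ω x _ => ?_
    have h1 : HasDerivAt (fun x : ℝ => Complex.I * (ω : ℂ) * (x : ℂ)) (Complex.I * (ω : ℂ)) x := by
      simpa using (Complex.ofRealCLM.hasDerivAt (x := x)).const_mul (Complex.I * (ω : ℂ))
    refine (h1.cexp.const_mul (g ω)).congr_deriv ?_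
    ring

/-- An integrable function on a bounded interval is zero if its Fourier transform vanishes on an
interval. -/
theorem ae_eq_zero_of_integral_exp {g : ℝ → ℂ} (hg : IntegrableOn g (Ioo a b)) {T : ℝ} (hT : 0 < T)
    (h0 : ∀ s ∈ Ioo 0 T,
      ∫ ω in Ioo a b, g ω * Complex.exp (Complex.I * (ω : ℂ) * (s : ℂ)) = 0) :
    g =ᵐ[freqMeasure a b] 0 := by
  have hi : ∀ n : ℕ, IntegrableOn (fun ω => g ω * (Complex.I * (ω : ℂ)) ^ n) (Ioo a b) := by
    intro n
    have hc : Continuous fun ω : ℝ => (Complex.I * (ω : ℂ)) ^ n := by fun_prop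
    obtain ⟨C, hC⟩ := isCompact_Icc.exists_bound_of_continuousOn (s := Icc a b) hc.continuousOn
    refine Integrable.mul_bdd (c := C) hg hc.aestronglyMeasurable ?_
    filter_upwards [ae_restrict_mem measurableSet_Ioo] with ω hω
    exact hC ω (Ioo_subset_Icc_self hω)
  -- Differentiating n times in s on the open interval where the transform vanishes.
  have hn : ∀ n : ℕ, ∀ s ∈ Ioo 0 T, ∫ ω in Ioo a b, g ω * (Complex.I * (ω : ℂ)) ^ n
      * Complex.exp (Complex.I * (ω : ℂ) * (s : ℂ)) = 0 := by
    intro n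
    induction n with
    | zero => simpa using h0
    | succ n ih =>
      intro s hs
      have h1 := hasDerivAt_integral_exp (hi n) s
      have h2 : HasDerivAt (fun s : ℝ => ∫ ω in Ioo a b, g ω * (Complex.I * (ω : ℂ)) ^ n
          * Complex.exp (Complex.I * (ω : ℂ) * (s : ℂ))) 0 s := by
        refine (hasDerivAt_const s (0 : ℂ)).congr_of_eventuallyEq ?_
        filter_upwards [Ioo_mem_nhds hs.1 hs.2] with x hx using ih x hx
      rw [← h1.unique h2]
      refine integral_congr_ae (Eventually.of_forall fun ω => ?_)
      simp only [pow_succ]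
      ring
  -- At one interior point, these derivatives are, up to powers of i, the moments of g e^{iωT/2}.
  have hmid : T / 2 ∈ Ioo 0 T := ⟨by linarith, by linarith⟩
  have hexp : Continuous fun ω : ℝ => Complex.exp (Complex.I * (ω : ℂ) * ((T / 2 : ℝ) : ℂ)) := by
    fun_prop
  have hz : (fun ω => g ω * Complex.exp (Complex.I * (ω : ℂ) * ((T / 2 : ℝ) : ℂ)))
      =ᵐ[freqMeasure a b] 0 := by
    refine ae_eq_zero_of_moments (hg.mul_bdd (c := 1) hexp.aestronglyMeasurable
      (Eventually.of_forall fun ω => ?_)) fun n => ?_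
    · rw [norm_exp_I_mul]
    · have h1 := hn n _ hmid
      have h2 : ∀ ω : ℝ, g ω * (Complex.I * (ω : ℂ)) ^ n
          * Complex.exp (Complex.I * (ω : ℂ) * ((T / 2 : ℝ) : ℂ))
          = Complex.I ^ n * (((ω ^ n : ℝ) : ℂ)
            * (g ω * Complex.exp (Complex.I * (ω : ℂ) * ((T / 2 : ℝ) : ℂ)))) := by
        intro ω
        rw [mul_pow]
        push_cast
        ring
      simp only [h2] at h1
      rw [integral_const_mul] at h1
      exact (mul_eq_zero.1 h1).resolve_left (pow_ne_zero _ Complex.I_ne_zero)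
  filter_upwards [hz] with ω hω
  exact (mul_eq_zero.1 hω).resolve_right (Complex.exp_ne_zero _)

/-! ### Profiles with vanishing outputs -/

/-- Differentiate |M|² = 1. -/
theorem ae_inner_rep_deriv (hab : a < b) {M : H1 a b} (hM : IsSphereValued M) :
    ∀ᵐ ω ∂freqMeasure a b, inner ℝ (rep M ω) (profileDeriv M ω) = 0 := by
  filter_upwards [ae_hasDerivAt_rep hab M, ae_restrict_mem measurableSet_Ioo] with ω h1 h2
  have h3 : HasDerivAt (fun ω => ‖rep M ω‖ ^ 2) 0 ω := by
    refine (hasDerivAt_const ω (1 : ℝ)).congr_of_eventuallyEq ?_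
    filter_upwards [Ioo_mem_nhds h2.1 h2.2] with x hx
    rw [(isSphereValued_iff hab M).1 hM x (Ioo_subset_Icc_self hx), one_pow]
  have h4 := h1.norm_sq.unique h3
  linarith

/-- The components of `Z z' - Z' z`. -/
def flux (M : H1 a b) (i : Fin 3) (ω : ℝ) : ℝ :=
  rep M ω i * profileDeriv M ω 2 - profileDeriv M ω i * rep M ω 2

/-- The primitive of a component of `G Z`. -/
def fluxPrim (G : ℝ) (M : H1 a b) (i : Fin 3) (ω : ℝ) : ℝ := ∫ t in a..ω, G * rep M t i

theorem continuousOn_rep_apply (hab : a ≤ b) (M : H1 a b) (i : Fin 3) :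
    ContinuousOn (fun ω => rep M ω i) (Icc a b) :=
  (EuclideanSpace.proj (𝕜 := ℝ) i).continuous.comp_continuousOn (continuousOn_rep hab M)

theorem integrable_rep_mul_deriv (hab : a ≤ b) (M : H1 a b) (i j : Fin 3) :
    IntegrableOn (fun ω => rep M ω i * profileDeriv M ω j) (Ioo a b) := by
  have h1 := intervalIntegrable_of_Ioo hab
    ((EuclideanSpace.proj (𝕜 := ℝ) j).integrable_comp (integrable_L2 (derivL2 a b M)))
  have h2 := h1.continuousOn_mul (by rw [uIcc_of_le hab]; exact continuousOn_rep_apply hab M i)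
  exact (intervalIntegrable_iff_integrableOn_Ioo_of_le hab).1 h2

theorem integrable_flux (hab : a ≤ b) (M : H1 a b) (i : Fin 3) :
    IntegrableOn (flux M i) (Ioo a b) := by
  refine (integrable_rep_mul_deriv hab M i 2).sub
    ((integrable_rep_mul_deriv hab M 2 i).congr (Eventually.of_forall fun ω => mul_comm _ _))

theorem intervalIntegrable_rep (hab : a ≤ b) (G : ℝ) (M : H1 a b) (i : Fin 3) :
    IntervalIntegrable (fun ω => G * rep M ω i) volume a b :=
  ContinuousOn.intervalIntegrable
    (by rw [uIcc_of_le hab]; exact continuousOn_const.mul (continuousOn_rep_apply hab M i))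

theorem continuousOn_fluxPrim (hab : a ≤ b) (G : ℝ) (M : H1 a b) (i : Fin 3) :
    ContinuousOn (fluxPrim G M i) (Icc a b) := by
  rw [← uIcc_of_le hab]
  refine intervalIntegral.continuousOn_primitive_interval ?_
  rw [uIcc_of_le hab]
  exact (continuousOn_const.mul (continuousOn_rep_apply hab M i)).integrableOn_Icc

theorem hasDerivAt_fluxPrim (hab : a ≤ b) (G : ℝ) (M : H1 a b) (i : Fin 3) {ω : ℝ}
    (hω : ω ∈ Ioo a b) : HasDerivAt (fluxPrim G M i) (G * rep M ω i) ω := by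
  have hc : ContinuousOn (fun ω => G * rep M ω i) (Icc a b) :=
    continuousOn_const.mul (continuousOn_rep_apply hab M i)
  have hn : Icc a b ∈ 𝓝 ω := Icc_mem_nhds hω.1 hω.2
  refine intervalIntegral.integral_hasDerivAt_right ?_
    (hc.stronglyMeasurableAtFilter_nhdsWithin measurableSet_Icc ω |>.filter_mono ?_)
    (hc.continuousAt hn)
  · exact (intervalIntegrable_rep hab G M i).mono_set
      (uIcc_subset_uIcc_left (by rw [uIcc_of_le hab]; exact Ioo_subset_Icc_self hω))
  · rw [nhdsWithin_eq_nhds.2 hn]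

/-- If the outputs vanish on an interval of values of `s`, then `Z z' - Z' z` is the primitive of
`G Z` which vanishes at both ends. -/
theorem flux_ae_eq (hab : a < b) {G T : ℝ} (hT : 0 < T) {M : H1 a b}
    (h0 : ∀ s ∈ Icc 0 T, ∀ j, ctrlOutput G s j M = 0) :
    (∀ᵐ ω ∂freqMeasure a b, flux M 0 ω = fluxPrim G M 0 ω ∧ flux M 1 ω = fluxPrim G M 1 ω) ∧
      fluxPrim G M 0 b = 0 ∧ fluxPrim G M 1 b = 0 := by
  set f : ℝ → ℂ := fun ω => (flux M 0 ω : ℂ) + Complex.I * (flux M 1 ω : ℂ) with hf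
  set V : ℝ → ℂ := fun ω => (fluxPrim G M 0 ω : ℂ) + Complex.I * (fluxPrim G M 1 ω : ℂ) with hV
  set W : ℝ → ℂ := fun ω => (G : ℂ) * transverse (rep M ω) with hW
  set E : ℝ → ℝ → ℂ := fun s ω => Complex.exp (Complex.I * (ω : ℂ) * (s : ℂ)) with hE
  have hEc : ∀ s, Continuous (E s) := fun s => by
    simp only [hE]
    fun_prop
  have hfi : IntegrableOn f (Ioo a b) :=
    (integrable_flux hab.le M 0).ofReal.add ((integrable_flux hab.le M 1).ofReal.const_mul _)
  have hVc : ContinuousOn V (Icc a b) :=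
    (Complex.continuous_ofReal.comp_continuousOn (continuousOn_fluxPrim hab.le G M 0)).add
      (continuousOn_const.mul
        (Complex.continuous_ofReal.comp_continuousOn (continuousOn_fluxPrim hab.le G M 1)))
  have hVi : IntegrableOn V (Ioo a b) := hVc.integrableOn_Icc.mono_set Ioo_subset_Icc_self
  have hWc : ContinuousOn W (Icc a b) :=
    continuousOn_const.mul
      ((Complex.continuous_ofReal.comp_continuousOn (continuousOn_rep_apply hab.le M 0)).add
        (continuousOn_const.mul
          (Complex.continuous_ofReal.comp_continuousOn (continuousOn_rep_apply hab.le M 1))))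
  have hVa : V a = 0 := by simp [hV, fluxPrim]
  have hVd : ∀ ω ∈ Ioo a b, HasDerivAt V (W ω) ω := by
    intro ω hω
    have h1 := (hasDerivAt_fluxPrim hab.le G M 0 hω).ofReal_comp
    have h2 := ((hasDerivAt_fluxPrim hab.le G M 1 hω).ofReal_comp).const_mul Complex.I
    refine (h1.add h2).congr_deriv ?_
    simp only [hW, transverse]
    push_cast
    ring
  have hEd : ∀ s ω : ℝ, HasDerivAt (E s) (Complex.I * (s : ℂ) * E s ω) ω := by
    intro s ω
    have h1 : HasDerivAt (fun ω : ℝ => Complex.I * (ω : ℂ) * (s : ℂ)) (Complex.I * (s : ℂ)) ω := by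
      have := ((Complex.ofRealCLM.hasDerivAt (x := ω)).const_mul Complex.I).mul_const (s : ℂ)
      simpa using this
    refine h1.cexp.congr_deriv ?_
    simp only [hE]
    ring
  -- V' = GZ and V(a) = 0, so only the boundary term at b remains.
  have hparts : ∀ s, ∫ ω in Ioo a b, W ω * E s ω
      = V b * E s b - ∫ ω in Ioo a b, V ω * (Complex.I * (s : ℂ) * E s ω) := by
    intro s
    have hu : uIcc a b = Icc a b := uIcc_of_le hab.le
    have hEc' : Continuous fun ω => Complex.I * (s : ℂ) * E s ω := continuous_const.mul (hEc s)
    have h := intervalIntegral.integral_deriv_mul_eq_sub_of_hasDerivAt (u := V) (v := E s)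
      (u' := W) (v' := fun ω => Complex.I * (s : ℂ) * E s ω) (hu ▸ hVc) (hEc s).continuousOn
      (fun x hx => hVd x (by rwa [min_eq_left hab.le, max_eq_right hab.le] at hx))
      (fun x _ => hEd s x) (ContinuousOn.intervalIntegrable (hu ▸ hWc))
      (hEc'.intervalIntegrable _ _)
    rw [hVa, zero_mul, sub_zero, ← setIntegral_Ioo_eq hab.le, integral_add] at h
    · rw [← h, add_sub_cancel_right]
    · exact (hWc.mul (hEc s).continuousOn).integrableOn_Icc.mono_set Ioo_subset_Icc_self
    · exact (hVc.mul hEc'.continuousOn).integrableOn_Icc.mono_set Ioo_subset_Icc_self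
  have hmain : ∀ s ∈ Icc 0 T,
      Complex.I * (s : ℂ) * (∫ ω in Ioo a b, (f ω - V ω) * E s ω) + V b * E s b = 0 := by
    intro s hs
    have h1 := integral_feedbackDensity G s M
    rw [h0 s hs 0, h0 s hs 1] at h1
    have h2 : ∫ ω in Ioo a b, feedbackDensity G s ω (profile M ω) (profileDeriv M ω)
        = ∫ ω in Ioo a b, (Complex.I * (s : ℂ) * (f ω * E s ω) + W ω * E s ω) := by
      apply integral_congr_ae
      filter_upwards [profile_ae_eq_rep hab M] with ω hω
      rw [hω]
      simp only [feedbackDensity, hf, hW, hE, flux, transverse]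
      push_cast
      ring
    have j1 : IntegrableOn (fun ω => f ω * E s ω) (Ioo a b) :=
      Integrable.mul_bdd (c := 1) hfi (hEc s).aestronglyMeasurable
        (Eventually.of_forall fun ω => (norm_exp_I_mul s ω).le)
    have j2 : IntegrableOn (fun ω => V ω * E s ω) (Ioo a b) :=
      Integrable.mul_bdd (c := 1) hVi (hEc s).aestronglyMeasurable
        (Eventually.of_forall fun ω => (norm_exp_I_mul s ω).le)
    have j3 : IntegrableOn (fun ω => W ω * E s ω) (Ioo a b) :=
      (hWc.mul (hEc s).continuousOn).integrableOn_Icc.mono_set Ioo_subset_Icc_self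
    have h3 : ∫ ω in Ioo a b, V ω * (Complex.I * (s : ℂ) * E s ω)
        = Complex.I * (s : ℂ) * ∫ ω in Ioo a b, V ω * E s ω := by
      rw [← integral_const_mul]
      exact integral_congr_ae (Eventually.of_forall fun ω => by ring)
    rw [h2, integral_add (j1.const_mul _) j3, integral_const_mul, hparts, h3] at h1
    simp only [sub_mul]
    rw [integral_sub j1 j2]
    simp only [Complex.ofReal_zero, zero_mul, add_zero, neg_zero] at h1
    linear_combination h1
  -- The value s = 0 isolates the boundary term; once it is known to vanish, the factor is can be
  -- divided out for s > 0.
  have hVb : V b = 0 := by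
    have h1 := hmain 0 ⟨le_rfl, hT.le⟩
    simpa [hE] using h1
  have hz : (fun ω => f ω - V ω) =ᵐ[freqMeasure a b] 0 := by
    refine ae_eq_zero_of_integral_exp (hfi.sub hVi) hT fun s hs => ?_
    have h1 := hmain s (Ioo_subset_Icc_self hs)
    rw [hVb, zero_mul, add_zero] at h1
    exact (mul_eq_zero.1 h1).resolve_left
      (mul_ne_zero Complex.I_ne_zero (Complex.ofReal_ne_zero.2 hs.1.ne'))
  refine ⟨?_, ?_, ?_⟩
  · filter_upwards [hz] with ω hω
    have h1 := congrArg Complex.re hω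
    have h2 := congrArg Complex.im hω
    simp [hf, hV] at h1 h2
    exact ⟨by linarith, by linarith⟩
  · have := congrArg Complex.re hVb
    simpa [hV] using this
  · have := congrArg Complex.im hVb
    simpa [hV] using this

/-- The integrand is the derivative of the product of the component with the primitive, and the
primitive vanishes at both ends. -/
theorem integral_deriv_mul_fluxPrim (hab : a < b) (G : ℝ) (M : H1 a b) (i : Fin 3)
    (hb : fluxPrim G M i b = 0) :
    ∫ ω in Ioo a b, (profileDeriv M ω i * fluxPrim G M i ω + G * rep M ω i ^ 2) = 0 := by
  have hg := intervalIntegrable_of_Ioo hab.le (integrable_L2 (derivL2 a b M))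
  have hi : IntervalIntegrable (fun ω => profileDeriv M ω i) volume a b :=
    intervalIntegrable_of_Ioo hab.le
      ((EuclideanSpace.proj (𝕜 := ℝ) i).integrable_comp (integrable_L2 (derivL2 a b M)))
  have h := integral_primitive_parts hi (intervalIntegrable_rep hab.le G M i) (repBase M i) 0
  have hb' : ∫ t in a..b, G * rep M t i = 0 := hb
  rw [hb', add_zero, mul_zero, mul_zero, sub_zero, ← setIntegral_Ioo_eq hab.le] at h
  rw [← h]
  refine setIntegral_congr_fun measurableSet_Ioo fun ω hω => ?_
  have hr : rep M ω i = repBase M i + ∫ t in a..ω, profileDeriv M t i := by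
    have hx : IntervalIntegrable (profileDeriv M) volume a ω := hg.mono_set
      (uIcc_subset_uIcc_left (by rw [uIcc_of_le hab.le]; exact Ioo_subset_Icc_self hω))
    have e := (EuclideanSpace.proj (𝕜 := ℝ) i).intervalIntegral_comp_comm hx
    exact congrArg (repBase M i + ·) e.symm
  simp only [fluxPrim, zero_add, ← hr]
  ring

/-- The only sphere-valued profile of the lower hemisphere with vanishing outputs is `-e₃`. -/
theorem eq_constProfile_of_ctrlOutput (hab : a < b) {G T : ℝ} (hG : 0 < G) (hT : 0 < T)
    {M : H1 a b} (hM : IsSphereValued M) (hz : ∀ ω ∈ Icc a b, rep M ω 2 < 0)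
    (h0 : ∀ s ∈ Icc 0 T, ∀ j, ctrlOutput G s j M = 0) : M = constProfile a b (-e3) := by
  obtain ⟨hfl, hb0, hb1⟩ := flux_ae_eq hab hT h0
  have hi : ∀ i, IntegrableOn
      (fun ω => profileDeriv M ω i * fluxPrim G M i ω + G * rep M ω i ^ 2) (Ioo a b) := by
    intro i
    have h1 := intervalIntegrable_of_Ioo hab.le
      ((EuclideanSpace.proj (𝕜 := ℝ) i).integrable_comp (integrable_L2 (derivL2 a b M)))
    have h2 := h1.mul_continuousOn
      (by rw [uIcc_of_le hab.le]; exact continuousOn_fluxPrim hab.le G M i)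
    refine IntegrableOn.add ((intervalIntegrable_iff_integrableOn_Ioo_of_le hab.le).1 h2) ?_
    exact ((continuousOn_const.mul
      ((continuousOn_rep_apply hab.le M i).pow 2)).integrableOn_Icc).mono_set Ioo_subset_Icc_self
  have hsum := integral_add (hi 0) (hi 1)
  rw [integral_deriv_mul_fluxPrim hab G M 0 hb0, integral_deriv_mul_fluxPrim hab G M 1 hb1,
    add_zero] at hsum
  set D : ℝ → ℝ := fun ω => -rep M ω 2
    * (profileDeriv M ω 0 ^ 2 + profileDeriv M ω 1 ^ 2 + profileDeriv M ω 2 ^ 2)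
    + G * (rep M ω 0 ^ 2 + rep M ω 1 ^ 2) with hD
  -- Replace the primitives by the components of Zz' - Z'z. The cross term z'(xx' + yy') equals -z
  -- z'² because M·M' = 0, which completes -z|Z'|² into -z|M'|².
  have hDe : (fun ω => (profileDeriv M ω 0 * fluxPrim G M 0 ω + G * rep M ω 0 ^ 2)
      + (profileDeriv M ω 1 * fluxPrim G M 1 ω + G * rep M ω 1 ^ 2)) =ᵐ[freqMeasure a b] D := by
    filter_upwards [hfl, ae_inner_rep_deriv hab hM] with ω h1 h2
    simp only [PiLp.inner_apply, Fin.sum_univ_three, RCLike.inner_apply, conj_trivial] at h2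
    rw [← h1.1, ← h1.2]
    simp only [hD, flux]
    linear_combination profileDeriv M ω 2 * h2
  -- Here the lower hemisphere matters: z < 0 makes both terms of D nonnegative, so zero integral
  -- forces D = 0.
  have hD0 : 0 ≤ᵐ[freqMeasure a b] D := by
    filter_upwards [ae_restrict_mem measurableSet_Ioo] with ω hω
    have h1 := hz ω (Ioo_subset_Icc_self hω)
    have h2 : 0 ≤ -rep M ω 2 := by linarith
    simp only [hD, Pi.zero_apply]
    positivity
  have hDi : Integrable D (freqMeasure a b) := ((hi 0).add (hi 1)).congr hDe
  have hDz := (integral_eq_zero_iff_of_nonneg_ae hD0 hDi).1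
    ((integral_congr_ae hDe).symm.trans hsum)
  refine ext_profile ((profile_ae_eq_rep hab M).trans (EventuallyEq.trans ?_
    (profile_constProfile (-e3)).symm))
  filter_upwards [hDz, ae_restrict_mem measurableSet_Ioo] with ω h1 hω
  have hω' := Ioo_subset_Icc_self hω
  have h2 := hz ω hω'
  have h3 := (isSphereValued_iff hab M).1 hM ω hω'
  have h4 : ‖rep M ω‖ ^ 2 = rep M ω 0 ^ 2 + rep M ω 1 ^ 2 + rep M ω 2 ^ 2 := by
    rw [EuclideanSpace.real_norm_sq_eq, Fin.sum_univ_three]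
  rw [h3] at h4
  simp only [hD, Pi.zero_apply] at h1
  have h5 : 0 ≤ -rep M ω 2
      * (profileDeriv M ω 0 ^ 2 + profileDeriv M ω 1 ^ 2 + profileDeriv M ω 2 ^ 2) :=
    mul_nonneg (by linarith) (by positivity)
  have h6 : rep M ω 0 ^ 2 + rep M ω 1 ^ 2 = 0 := by
    have h7 : 0 ≤ rep M ω 0 ^ 2 + rep M ω 1 ^ 2 := by positivity
    nlinarith
  have h8 : rep M ω 0 = 0 := by nlinarith [sq_nonneg (rep M ω 0), sq_nonneg (rep M ω 1)]
  have h9 : rep M ω 1 = 0 := by nlinarith [sq_nonneg (rep M ω 0), sq_nonneg (rep M ω 1)]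
  have h10 : rep M ω 2 = -1 := by nlinarith
  ext i
  fin_cases i <;> simp [h8, h9, h10, e3]

end

/-! ### Weak convergence to the south pole -/

section

variable {a b : ℝ}

/-- A bounded family of sphere-valued profiles close to `-e₃` on which the outputs vanish
asymptotically converges weakly to `-e₃`. -/
theorem tendsto_weak_of_tendsto_ctrlOutput (hab : a < b) {T G R : ℝ} (hG : 0 < G) (hT : 0 < T)
    {M : ℝ → H1 a b} (hs : ∀ t, IsSphereValued (M t)) (hR : ∀ t, ‖M t‖ ≤ R)
    (hnear : ∀ t, ∀ ω ∈ Icc a b, rep (M t) ω 2 ≤ -(1 / 2))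
    (h0 : ∀ s ∈ Icc 0 T, ∀ j, Tendsto (fun t => ctrlOutput G s j (M t)) atTop (𝓝 0))
    (φ : H1 a b →L[ℝ] ℝ) :
    Tendsto (fun t => φ (M t)) atTop (𝓝 (φ (constProfile a b (-e3)))) := by
  -- It suffices to identify the limit along every ultrafilter, where weak limits of bounded
  -- families exist without extracting subsequences.
  rw [tendsto_iff_ultrafilter]
  intro U hU
  obtain ⟨N, hN⟩ := exists_weak_limit U hR
  have hrep : ∀ ω ∈ Icc a b, Tendsto (fun t => rep (M t) ω) U (𝓝 (rep N ω)) :=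
    fun ω hω => tendsto_rep hab hN hω
  have hNs : IsSphereValued N := by
    rw [isSphereValued_iff hab]
    intro ω hω
    refine tendsto_nhds_unique (hrep ω hω).norm (tendsto_const_nhds.congr fun t => ?_)
    exact ((isSphereValued_iff hab _).1 (hs t) ω hω).symm
  have hNz : ∀ ω ∈ Icc a b, rep N ω 2 < 0 := by
    intro ω hω
    have h1 : Tendsto (fun t => rep (M t) ω 2) U (𝓝 (rep N ω 2)) :=
      ((EuclideanSpace.proj (𝕜 := ℝ) (2 : Fin 3)).continuous.tendsto _).comp (hrep ω hω)
    have h2 := le_of_tendsto h1 (Eventually.of_forall fun t => hnear t ω hω)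
    linarith
  have hNo : ∀ s ∈ Icc 0 T, ∀ j, ctrlOutput G s j N = 0 := fun s hs j =>
    tendsto_nhds_unique (tendsto_ctrlOutput_of_weak hab hN hR G s j) ((h0 s hs j).mono_left hU)
  rw [← eq_constProfile_of_ctrlOutput hab hG hT hNs hNz hNo]
  exact hN φ

end

end BlochEnsemble

end

/-! ### The main theorem -/

theorem theorem1 (a b T G K : ℝ) (hab : a < b) (hT : 0 < T) (hG : 0 < G) (hK : 0 < K) :
    ∃ δ' : ℝ, 0 < δ' ∧
      ∀ M₀ : BlochEnsemble.H1 a b, BlochEnsemble.IsSphereValued M₀ →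
        ‖M₀ + BlochEnsemble.constProfile a b BlochEnsemble.e3‖ ≤ δ' →
          ∃ M : ℝ → BlochEnsemble.H1 a b,
            BlochEnsemble.IsClosedLoopSolution T G K M ∧ M 0 = M₀ ∧
            (∀ N : ℝ → BlochEnsemble.H1 a b,
              BlochEnsemble.IsClosedLoopSolution T G K N → N 0 = M₀ →
                ∀ t, 0 ≤ t → N t = M t) ∧
            (∀ t, 0 ≤ t → BlochEnsemble.IsSphereValued (M t)) ∧
            BlochEnsemble.TendstoWeakly M
              (BlochEnsemble.constProfile a b (-BlochEnsemble.e3)) ∧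
            BlochEnsemble.TendstoUniformlyToConst M (-BlochEnsemble.e3) := by
  open BlochEnsemble in
  have hc : 0 ≤ √(b - a) / (b - a) + √(b - a) := by
    have := sub_pos.2 hab
    positivity
  -- With c the constant of `norm_rep_le`, this ρ satisfies cρ ≤ 1/2, so |M(t, ω) + e₃| ≤ 1/2 and z
  -- ≤ -1/2 everywhere.
  obtain ⟨δ, hδ, h⟩ := exists_solution hab hT hG hK
    (ρ := 1 / (2 * (√(b - a) / (b - a) + √(b - a) + 1))) (by positivity)
  refine ⟨δ, hδ, fun M₀ hM₀ hM₀δ => ?_⟩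
  obtain ⟨M, hM0, hM⟩ := h M₀ hM₀ hM₀δ
  have hsol := isClosedLoopSolution_of_hasDerivAt hT fun t ht => (hM t ht).1
  set ρ := 1 / (2 * (√(b - a) / (b - a) + √(b - a) + 1)) with hρ
  have hnorm : ∀ t, 0 ≤ t → ‖M t‖ ≤ ρ + ‖constProfile a b e3‖ := fun t ht => by
    have h1 := norm_sub_le (M t + constProfile a b e3) (constProfile a b e3)
    rw [add_sub_cancel_right] at h1
    linarith [(hM t ht).2.2]
  have hnear : ∀ t, 0 ≤ t → ∀ ω ∈ Icc a b, rep (M t) ω 2 ≤ -(1 / 2) := by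
    intro t ht ω hω
    have h1 : ‖rep (M t) ω + e3‖ ≤ 1 / 2 := by
      rw [← rep_constProfile hab e3 hω, ← rep_add hab _ _ hω]
      refine (norm_rep_le hab _ hω).trans
        ((mul_le_mul_of_nonneg_left (hM t ht).2.2 hc).trans ?_)
      rw [hρ, mul_one_div, div_le_div_iff₀ (by positivity) two_pos]
      linarith
    have h2 := (PiLp.norm_apply_le (rep (M t) ω + e3) 2).trans h1
    rw [Real.norm_eq_abs, PiLp.add_apply] at h2
    have h3 : e3 2 = 1 := by simp [e3]
    rw [h3] at h2
    linarith [le_abs_self (rep (M t) ω 2 + 1)]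
  -- The estimates hold for t ≥ 0 while the convergence lemma asks for all t; freezing the curve
  -- before 0 does not change its limit.
  have hmax : ∀ t : ℝ, 0 ≤ max t 0 := fun t => le_max_right _ _
  have heq : ∀ᶠ t : ℝ in atTop, M (max t 0) = M t := by
    filter_upwards [eventually_ge_atTop 0] with t ht
    rw [max_eq_left ht]
  have hweak := tendsto_weak_of_tendsto_ctrlOutput hab hG hT (M := fun t => M (max t 0))
    (fun t => (hM _ (hmax t)).2.1) (fun t => hnorm _ (hmax t)) (fun t => hnear _ (hmax t))
    (fun s hs j => (tendsto_ctrlOutput hab hT hG hK (fun t ht => (hM t ht).1)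
      (fun t ht => (hM t ht).2.1) hnorm j hs).comp
        (tendsto_atTop_mono (fun t => le_max_left t 0) tendsto_id))
  refine ⟨M, hsol, hM0, fun N hN hN0 t ht => hsol.eq hT hN (hN0.trans hM0.symm) ht,
    fun t ht => (hM t ht).2.1, ?_, fun t => rep (M t),
    fun t _ => ⟨continuousOn_rep hab.le _, profile_ae_eq_rep hab _⟩, ?_⟩
  · refine (tendsto_toWeakSpace hweak).congr' ?_
    filter_upwards [heq] with t ht
    rw [ht]
  · refine ((tendstoUniformlyOn_rep hab hweak fun t => hnorm _ (hmax t)).congr ?_).congr_right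
      fun ω hω => rep_constProfile hab (-e3) hω
    filter_upwards [heq] with t ht ω _
    simp only [ht]
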